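/- Let $V$ be a finite-dimensional complex vector space with dual $V^\vee$. The holomorphic string on $\mathbb C$ with target $V$ has fields $\gamma\in\Omega^{0,*}(\mathbb C)\otimes V$, $\beta\in\Omega^{1,*}(\mathbb C)\otimes V^\vee$, $c\in\Omega^{0,*}(\mathbb C,T^{1,0})[1]$, $b\in\Omega^{1,*}(\mathbb C,T^{1,0*})[-1]$ and action $S=\int\langle\beta,\bar\partial\gamma\rangle+\langle b,\bar\partial c\rangle+\langle\beta,[c,\gamma]\rangle+\tfrac12\langle b,[c,c]\rangle$. Let $\mathcal O_{\rm red}(J_0)$ be the graded-commutative algebra of polynomial functions without constant term on the $\infty$-jets of the fields at $0\in\mathbb C$, that is, polynomials in the continuous linear functionals $\partial_z^m\partial_{\bar z}^n\varphi(0)$ of the components $\varphi$ of the fields. The differential $\{S,-\}$ is the derivation of degree $1$ commuting with $\partial_z,\partial_{\bar z}$ which on the fields is $\gamma\mapsto\bar\partial\gamma+c\,\partial_z\gamma$, $\beta\mapsto\bar\partial\beta+\partial_z(c\beta)$, $c\mapsto\bar\partial c+c\,\partial_zc$, $b\mapsto\bar\partial b+c\,\partial_zb+2(\partial_zc)b+\langle\beta,\partial_z\gamma\rangle$.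 The translation-invariant deformation complex is $$\mathrm{Def}_{\rm string}(\mathbb C)^{\mathbb C}=\bigl(\mathcal O_{\rm red}(J_0)\,d^2z,\ \{S,-\}\bigr)[2],$$ where a translation-invariant Lagrangian density is encoded by its function of the jets at the origin, and functions of degree $p$ on jets are placed in degree $p-2$. The group $\mathbb C^\times_{\rm cot}$ gives the fields $\gamma,c$ weight $0$ and $\beta,b$ weight $1$, and $\mathrm{Def}_{\rm string}(\mathbb C)^{\mathbb C,{\rm wt}(0)}$ is the subcomplex of functions of weight $0$. Let $\Omega^k(V)=\mathrm{Sym}(V^\vee)\otimes\Lambda^kV^\vee$ be the polynomial $k$-forms on $V$ and $\Omega^k_{cl}(V)$ the closed ones. Then there is a $GL(V)$-equivariant quasi-isomorphism of complexes of complex vector spaces $$\mathrm{Def}_{\rm string}(\mathbb C)^{\mathbb C,{\rm wt}(0)}\;\simeq\;\mathbb C[-1]\oplus\Omega^2_{cl}(V)[1]\oplus\Omega^1(V)\oplus\Omega^1_{cl}(V)[-1],$$ where the right side has zero differential, $GL(V)$ acts trivially on $\mathbb C[-1]$, and $M[k]$ denotes $M$ placed in degree $-k$. -/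

import Mathlib

open CategoryTheory
universe u
noncomputable section
namespace HolomorphicString

/-- Coordinates on the space of jets at the origin of `ℂ` of the fields of the holomorphic string
with target `V`. Each field is a Dolbeault form `φ = φ⁰ + φ¹ dz̄` with values in a trivialised
holomorphic line bundle tensored with a vector space, and `j` is its `dz̄`-degree:
* `gamma j m n l` is `φ ↦ ⟨l, (∂_z^m ∂_z̄^n γʲ)(0)⟩`, with `γ ∈ Ω^{0,j}(ℂ) ⊗ V` in degree `j`;
* `beta j m n v` is `φ ↦ ⟨(∂_z^m ∂_z̄^n βʲ)(0), v⟩`, with `β ∈ Ω^{1,j}(ℂ) ⊗ V^∨` in degree `j`;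
* `c j m n` is `φ ↦ (∂_z^m ∂_z̄^n cʲ)(0)`, with `c ∈ Ω^{0,j}(ℂ, T^{1,0})` in degree `j - 1`;
* `b j m n` is `φ ↦ (∂_z^m ∂_z̄^n bʲ)(0)`, with `b ∈ Ω^{1,j}(ℂ, T^{1,0*})` in degree `j + 1`. -/
inductive JetCoord (V : Type u) [AddCommGroup V] [Module ℂ V] : Type u
  | gamma (j : Fin 2) (m n : ℕ) (l : Module.Dual ℂ V)
  | beta (j : Fin 2) (m n : ℕ) (v : V)
  | c (j : Fin 2) (m n : ℕ)
  | b (j : Fin 2) (m n : ℕ)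

variable {V : Type u} [AddCommGroup V] [Module ℂ V]

/-- Cohomological degree of a coordinate: minus the degree of the field component it reads off. -/
def JetCoord.deg : JetCoord V → ℤ
  | .gamma j _ _ _ => -(j : ℕ)
  | .beta j _ _ _ => -(j : ℕ)
  | .c j _ _ => 1 - (j : ℕ)
  | .b j _ _ => -1 - (j : ℕ)

/-- Weight for the group `ℂ^×_cot` scaling the cotangent fibres: the fields `γ`, `c` have weight `0`
and the fields `β`, `b` have weight `1`. -/
def JetCoord.cotWeight : JetCoord V → ℕ
  | .gamma _ _ _ _ => 0
  | .beta _ _ _ _ => 1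
  | .c _ _ _ => 0
  | .b _ _ _ => 1

/-- The coordinate with one more `∂_z`. -/
def JetCoord.dz : JetCoord V → JetCoord V
  | .gamma j m n l => .gamma j (m + 1) n l
  | .beta j m n v => .beta j (m + 1) n v
  | .c j m n => .c j (m + 1) n
  | .b j m n => .b j (m + 1) n

/-- The coordinate with one more `∂_z̄`. -/
def JetCoord.dzbar : JetCoord V → JetCoord V
  | .gamma j m n l => .gamma j m (n + 1) l
  | .beta j m n v => .beta j m (n + 1) v
  | .c j m n => .c j m (n + 1)
  | .b j m n => .b j m (n + 1)

/-- The Koszul sign `(-1) ^ (p * q)`. -/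
def koszul (p q : ℤ) : ℂ := (-1) ^ (p * q)

open JetCoord in
/-- Relations of the free graded-commutative algebra on the jet coordinates: the coordinates of `γ`
and `β` depend linearly on the (co)vector, and any two coordinates commute up to the Koszul sign. -/
inductive JetRel : FreeAlgebra ℂ (JetCoord V) → FreeAlgebra ℂ (JetCoord V) → Prop
  | gamma_add (j : Fin 2) (m n : ℕ) (l l' : Module.Dual ℂ V) :
      JetRel (FreeAlgebra.ι ℂ (gamma j m n (l + l')))
        (FreeAlgebra.ι ℂ (gamma j m n l) + FreeAlgebra.ι ℂ (gamma j m n l'))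
  | gamma_smul (j : Fin 2) (m n : ℕ) (a : ℂ) (l : Module.Dual ℂ V) :
      JetRel (FreeAlgebra.ι ℂ (gamma j m n (a • l))) (a • FreeAlgebra.ι ℂ (gamma j m n l))
  | beta_add (j : Fin 2) (m n : ℕ) (v v' : V) :
      JetRel (FreeAlgebra.ι ℂ (beta j m n (v + v')))
        (FreeAlgebra.ι ℂ (beta j m n v) + FreeAlgebra.ι ℂ (beta j m n v'))
  | beta_smul (j : Fin 2) (m n : ℕ) (a : ℂ) (v : V) :
      JetRel (FreeAlgebra.ι ℂ (beta j m n (a • v))) (a • FreeAlgebra.ι ℂ (beta j m n v))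
  | comm (x y : JetCoord V) :
      JetRel (FreeAlgebra.ι ℂ x * FreeAlgebra.ι ℂ y)
        (koszul x.deg y.deg • (FreeAlgebra.ι ℂ y * FreeAlgebra.ι ℂ x))

variable (V) in
/-- The graded-commutative algebra of polynomial functions on the jets at the origin of the fields
(polynomials in the continuous linear functionals of the jets). -/
def JetFun : Type u := RingQuot (JetRel (V := V))

instance : Ring (JetFun V) := inferInstanceAs (Ring (RingQuot (JetRel (V := V))))

instance : Algebra ℂ (JetFun V) := inferInstanceAs (Algebra ℂ (RingQuot (JetRel (V := V))))

variable (V) in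
/-- The quotient map. -/
def JetFun.mk : FreeAlgebra ℂ (JetCoord V) →ₐ[ℂ] JetFun V := RingQuot.mkAlgHom ℂ JetRel

/-- A jet coordinate, as a function on jets. -/
def X (x : JetCoord V) : JetFun V := JetFun.mk V (FreeAlgebra.ι ℂ x)

theorem JetFun.mk_rel {a a' : FreeAlgebra ℂ (JetCoord V)} (h : JetRel a a') :
    JetFun.mk V a = JetFun.mk V a' := RingQuot.mkAlgHom_rel ℂ h

theorem JetFun.mk_surjective : Function.Surjective (JetFun.mk V) :=
  RingQuot.mkAlgHom_surjective ℂ _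

/-- The product of a list of jet coordinates. -/
def mono (l : List (JetCoord V)) : JetFun V := (l.map X).prod

/-- `f` respects the linear relations between jet coordinates. -/
structure Compatible {B : Type*} [Ring B] [Algebra ℂ B] (f : JetCoord V → B) : Prop where
  gamma_add : ∀ j m n l l', f (.gamma j m n (l + l')) = f (.gamma j m n l) + f (.gamma j m n l')
  gamma_smul : ∀ j m n (a : ℂ) l, f (.gamma j m n (a • l)) = a • f (.gamma j m n l)
  beta_add : ∀ j m n v v', f (.beta j m n (v + v')) = f (.beta j m n v) + f (.beta j m n v')
  beta_smul : ∀ j m n (a : ℂ) v, f (.beta j m n (a • v)) = a • f (.beta j m n v)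

theorem X_compatible : Compatible (X : JetCoord V → JetFun V) where
  gamma_add j m n l l' := by
    simpa [X] using JetFun.mk_rel (JetRel.gamma_add j m n l l')
  gamma_smul j m n a l := by
    simpa [X] using JetFun.mk_rel (JetRel.gamma_smul j m n a l)
  beta_add j m n l l' := by
    simpa [X] using JetFun.mk_rel (JetRel.beta_add j m n l l')
  beta_smul j m n a l := by
    simpa [X] using JetFun.mk_rel (JetRel.beta_smul j m n a l)

theorem X_comm (x y : JetCoord V) : X x * X y = koszul x.deg y.deg • (X y * X x) := by
  simpa [X] using JetFun.mk_rel (JetRel.comm x y)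

/-- The universal property of the algebra of functions on jets. -/
def liftHom {B : Type*} [Ring B] [Algebra ℂ B] (f : JetCoord V → B) (hf : Compatible f)
    (hc : ∀ x y, f x * f y = koszul x.deg y.deg • (f y * f x)) : JetFun V →ₐ[ℂ] B :=
  RingQuot.liftAlgHom ℂ ⟨FreeAlgebra.lift ℂ f, by
    rintro _ _ (⟨j, m, n, l, l'⟩ | ⟨j, m, n, a, l⟩ | ⟨j, m, n, l, l'⟩ | ⟨j, m, n, a, l⟩ | ⟨x, y⟩)
    · simpa using hf.gamma_add j m n l l'
    · simpa using hf.gamma_smul j m n a l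
    · simpa using hf.beta_add j m n l l'
    · simpa using hf.beta_smul j m n a l
    · simpa using hc x y⟩

@[simp] theorem liftHom_X {B : Type*} [Ring B] [Algebra ℂ B] (f : JetCoord V → B)
    (hf : Compatible f) (hc) (x : JetCoord V) : liftHom f hf hc (X x) = f x := by
  have : liftHom f hf hc (X x) = FreeAlgebra.lift ℂ f (FreeAlgebra.ι ℂ x) :=
    RingQuot.liftAlgHom_mkAlgHom_apply ..
  rw [this, FreeAlgebra.lift_ι_apply]

theorem mono_cons (x : JetCoord V) (l : List (JetCoord V)) : mono (x :: l) = X x * mono l := by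
  simp [mono]

theorem mono_append (l l' : List (JetCoord V)) : mono (l ++ l') = mono l * mono l' := by
  simp [mono]

theorem span_mono : Submodule.span ℂ (Set.range (mono (V := V))) = ⊤ := by
  rw [eq_top_iff]
  rintro a -
  obtain ⟨a, rfl⟩ := JetFun.mk_surjective a
  induction a using FreeAlgebra.induction with
  | grade0 r =>
    rw [AlgHom.commutes, Algebra.algebraMap_eq_smul_one]
    exact Submodule.smul_mem _ _ (Submodule.subset_span ⟨[], by simp [mono]⟩)
  | grade1 x => exact Submodule.subset_span ⟨[x], by simp [mono, X]⟩
  | add a b ha hb => rw [map_add]; exact add_mem ha hb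
  | mul a b ha hb =>
    rw [map_mul]
    have := Submodule.mul_mem_mul ha hb
    rw [Submodule.span_mul_span] at this
    refine Submodule.span_mono ?_ this
    rintro _ ⟨_, ⟨l, rfl⟩, _, ⟨l', rfl⟩, rfl⟩
    exact ⟨l ++ l', mono_append l l'⟩

theorem linearMap_ext_mono {M : Type*} [AddCommGroup M] [Module ℂ M] {f g : JetFun V →ₗ[ℂ] M}
    (h : ∀ l, f (mono l) = g (mono l)) : f = g :=
  LinearMap.ext_on span_mono (by rintro _ ⟨l, rfl⟩; exact h l)

theorem koszul_mul_self (p q : ℤ) : koszul p q * koszul p q = 1 := by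
  unfold koszul; rw [← mul_zpow]; norm_num

theorem koszul_add_left (p p' q : ℤ) : koszul (p + p') q = koszul p q * koszul p' q := by
  unfold koszul; rw [add_mul, zpow_add₀ (by norm_num)]

theorem koszul_add_right (p q q' : ℤ) : koszul p (q + q') = koszul p q * koszul p q' := by
  unfold koszul; rw [mul_add, zpow_add₀ (by norm_num)]

theorem koszul_symm (p q : ℤ) : koszul p q = koszul q p := by
  unfold koszul; rw [mul_comm]

/-- The algebra automorphism `a ↦ (-1)^(e |a|) a`. -/
def sgn (e : ℤ) : JetFun V →ₐ[ℂ] JetFun V :=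
  liftHom (fun x => koszul e x.deg • X x)
    ⟨by intros; simp [X_compatible.gamma_add, JetCoord.deg],
     by intros; rw [X_compatible.gamma_smul, smul_comm]; rfl,
     by intros; simp [X_compatible.beta_add, JetCoord.deg],
     by intros; rw [X_compatible.beta_smul, smul_comm]; rfl⟩
    (by
      intro x y
      simp only [smul_mul_smul_comm]
      rw [X_comm x y, smul_smul, smul_smul]
      congr 1; ring)

@[simp] theorem sgn_X (e : ℤ) (x : JetCoord V) : sgn e (X x) = koszul e x.deg • X x := by
  simp [sgn]

/-- The algebra map `a ↦ !![sgn e a, D a; 0, a]` that encodes the derivation `D` of degree `e` with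
value `f x` on the coordinate `x`. -/
def superDerHom (e : ℤ) (f : JetCoord V → JetFun V) (hf : Compatible f)
    (hc : ∀ x y, f x * X y = koszul (x.deg + e) y.deg • (X y * f x)) :
    JetFun V →ₐ[ℂ] Matrix (Fin 2) (Fin 2) (JetFun V) :=
  liftHom (fun x => !![sgn e (X x), f x; 0, X x])
    ⟨by intros; simp only [X_compatible.gamma_add, hf.gamma_add, map_add]; ext i j; fin_cases i <;> fin_cases j <;> simp,
     by intros; simp only [X_compatible.gamma_smul, hf.gamma_smul, map_smul]; ext i j; fin_cases i <;> fin_cases j <;> simp,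
     by intros; simp only [X_compatible.beta_add, hf.beta_add, map_add]; ext i j; fin_cases i <;> fin_cases j <;> simp,
     by intros; simp only [X_compatible.beta_smul, hf.beta_smul, map_smul]; ext i j; fin_cases i <;> fin_cases j <;> simp⟩
    (by
      intro x y
      have h1 : sgn e (X x * X y) = sgn e (koszul x.deg y.deg • (X y * X x)) := by rw [← X_comm]
      have h2 : sgn e (X x) * f y + f x * X y
          = koszul x.deg y.deg • (sgn e (X y) * f x + f y * X x) := by
        rw [hc x y, hc y x, sgn_X, sgn_X]
        simp only [smul_add, smul_mul_assoc, smul_smul]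
        rw [koszul_add_left, koszul_add_left, koszul_symm y.deg x.deg, ← mul_assoc,
          koszul_mul_self, one_mul, add_comm]
      rw [map_mul, map_smul, map_mul] at h1
      ext i j
      fin_cases i <;> fin_cases j
      · simpa [Matrix.mul_apply, -sgn_X] using h1
      · simpa [Matrix.mul_apply, -sgn_X] using h2
      · simp [Matrix.mul_apply]
      · simpa [Matrix.mul_apply] using X_comm x y)

/-- The derivation `D` of degree `e` with value `f x` on the coordinate `x`; it satisfies
`D (a a') = (-1)^(e |a|) a D a' + D a a'`. -/
def superDer (e : ℤ) (f : JetCoord V → JetFun V) (hf : Compatible f)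
    (hc : ∀ x y, f x * X y = koszul (x.deg + e) y.deg • (X y * f x)) :
    JetFun V →ₗ[ℂ] JetFun V where
  toFun a := superDerHom e f hf hc a 0 1
  map_add' a b := by simp
  map_smul' r a := by simp

section
variable (e : ℤ) (f : JetCoord V → JetFun V) (hf : Compatible f)
    (hc : ∀ x y, f x * X y = koszul (x.deg + e) y.deg • (X y * f x))

theorem superDer_X (x : JetCoord V) : superDer e f hf hc (X x) = f x := by
  simp [superDer, superDerHom]

theorem superDer_one : superDer e f hf hc 1 = 0 := by
  simp [superDer]

theorem superDerHom_diag (a : JetFun V) : superDerHom e f hf hc a 0 0 = sgn e a ∧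
    superDerHom e f hf hc a 1 1 = a ∧ superDerHom e f hf hc a 1 0 = 0 := by
  have ha : a ∈ Submodule.span ℂ (Set.range (mono (V := V))) := by rw [span_mono]; trivial
  induction ha using Submodule.span_induction with
  | mem a h =>
    obtain ⟨l, rfl⟩ := h
    induction l with
    | nil => simp [mono]
    | cons x l ih =>
      obtain ⟨h1, h2, h3⟩ := ih
      simp only [mono_cons, map_mul, Matrix.mul_apply, Fin.sum_univ_two, h1, h2, h3]
      simp [superDerHom]
  | zero => simp
  | add a b _ _ iha ihb => simp [iha, ihb]
  | smul r a _ ih => simp [ih]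

theorem superDer_mul (a b : JetFun V) : superDer e f hf hc (a * b)
    = sgn e a * superDer e f hf hc b + superDer e f hf hc a * b := by
  have := superDerHom_diag e f hf hc
  simp [superDer, Matrix.mul_apply, Fin.sum_univ_two, (this _).1, (this _).2.1]
end


/-! ### Homogeneous pieces -/

variable (V) in
/-- The functions without constant term, of cohomological degree `p` and of `ℂ^×_cot`-weight `w`:
the span of the nonempty monomials of degree `p` and weight `w`. -/
def reducedPart (p : ℤ) (w : ℕ) : Submodule ℂ (JetFun V) :=
  Submodule.span ℂ {a | ∃ l : List (JetCoord V), l ≠ [] ∧ (l.map JetCoord.deg).sum = p ∧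
    (l.map JetCoord.cotWeight).sum = w ∧ a = mono l}

theorem X_mem_reducedPart (x : JetCoord V) : X x ∈ reducedPart V x.deg x.cotWeight :=
  Submodule.subset_span ⟨[x], by simp, by simp, by simp, by simp [mono]⟩

theorem mul_mem_reducedPart {p q : ℤ} {w w' : ℕ} {a b : JetFun V} (ha : a ∈ reducedPart V p w)
    (hb : b ∈ reducedPart V q w') : a * b ∈ reducedPart V (p + q) (w + w') := by
  have := Submodule.mul_mem_mul ha hb
  rw [reducedPart, reducedPart, Submodule.span_mul_span] at this
  refine Submodule.span_mono ?_ this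
  rintro _ ⟨_, ⟨l, hl, h1, h2, rfl⟩, _, ⟨l', hl', h1', h2', rfl⟩, rfl⟩
  exact ⟨l ++ l', by simp [hl], by simp [h1, h1'], by simp [h2, h2'], (mono_append l l').symm⟩

theorem mono_mul_X (l : List (JetCoord V)) (y : JetCoord V) :
    mono l * X y = koszul (l.map JetCoord.deg).sum y.deg • (X y * mono l) := by
  induction l with
  | nil => simp [mono, koszul]
  | cons x l ih =>
    rw [mono_cons, mul_assoc, ih, mul_smul_comm, ← mul_assoc, X_comm x y, smul_mul_assoc,
      smul_smul, List.map_cons, List.sum_cons, koszul_add_left, mul_assoc, mul_comm (koszul _ _)]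

theorem reducedPart_mul_X {p : ℤ} {w : ℕ} {a : JetFun V} (ha : a ∈ reducedPart V p w) (y : JetCoord V) :
    a * X y = koszul p y.deg • (X y * a) := by
  induction ha using Submodule.span_induction with
  | mem a h => obtain ⟨l, -, rfl, -, rfl⟩ := h; exact mono_mul_X l y
  | zero => simp
  | add a b _ _ iha ihb => rw [add_mul, iha, ihb, mul_add, smul_add]
  | smul r a _ ih => rw [smul_mul_assoc, ih, mul_smul_comm, smul_comm]

theorem sgn_mono (e : ℤ) (l : List (JetCoord V)) :
    sgn e (mono l) = koszul e (l.map JetCoord.deg).sum • mono l := by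
  induction l with
  | nil => simp [mono, koszul]
  | cons x l ih =>
    rw [mono_cons, map_mul, ih, sgn_X, smul_mul_smul_comm, List.map_cons, List.sum_cons,
      koszul_add_right]

theorem sgn_reducedPart (e : ℤ) {p : ℤ} {w : ℕ} {a : JetFun V} (ha : a ∈ reducedPart V p w) :
    sgn e a = koszul e p • a := by
  induction ha using Submodule.span_induction with
  | mem a h => obtain ⟨l, -, rfl, -, rfl⟩ := h; exact sgn_mono e l
  | zero => simp
  | add a b _ _ iha ihb => rw [map_add, iha, ihb, smul_add]
  | smul r a _ ih => rw [map_smul, ih, smul_comm]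

theorem superDer_mem_reducedPart (e : ℤ) (f : JetCoord V → JetFun V) (hf : Compatible f)
    (hc : ∀ x y, f x * X y = koszul (x.deg + e) y.deg • (X y * f x))
    (hd : ∀ x, f x ∈ reducedPart V (x.deg + e) x.cotWeight) {p : ℤ} {w : ℕ} {a : JetFun V}
    (ha : a ∈ reducedPart V p w) : superDer e f hf hc a ∈ reducedPart V (p + e) w := by
  induction ha using Submodule.span_induction with
  | mem a h =>
    obtain ⟨l, hl, rfl, rfl, rfl⟩ := h
    induction l with
    | nil => exact absurd rfl hl
    | cons x l ih =>
      rw [mono_cons, superDer_mul, superDer_X, sgn_X]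
      rcases eq_or_ne l [] with rfl | hl'
      · simpa [mono, superDer_one] using hd x
      · have h1 := mul_mem_reducedPart (X_mem_reducedPart x) (ih hl')
        have h2 := mul_mem_reducedPart (hd x)
          (Submodule.subset_span ⟨l, hl', rfl, rfl, rfl⟩ : mono l ∈ reducedPart V _ _)
        simp only [List.map_cons, List.sum_cons]
        refine add_mem ?_ ?_
        · rw [smul_mul_assoc, add_assoc]
          exact Submodule.smul_mem _ _ h1
        · rw [add_right_comm]; exact h2
  | zero => simp
  | add a b _ _ iha ihb => rw [map_add]; exact add_mem iha ihb
  | smul r a _ ih => rw [map_smul]; exact Submodule.smul_mem _ _ ih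

/-! ### Total derivatives -/

@[simp] theorem deg_dz (x : JetCoord V) : x.dz.deg = x.deg := by cases x <;> rfl
@[simp] theorem deg_dzbar (x : JetCoord V) : x.dzbar.deg = x.deg := by cases x <;> rfl
@[simp] theorem cotWeight_dz (x : JetCoord V) : x.dz.cotWeight = x.cotWeight := by cases x <;> rfl
@[simp] theorem cotWeight_dzbar (x : JetCoord V) : x.dzbar.cotWeight = x.cotWeight := by
  cases x <;> rfl

theorem dz_compatible : Compatible (fun x : JetCoord V => X x.dz) :=
  ⟨fun _ _ _ _ _ => X_compatible.gamma_add _ _ _ _ _,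
   fun _ _ _ _ _ => X_compatible.gamma_smul _ _ _ _ _,
   fun _ _ _ _ _ => X_compatible.beta_add _ _ _ _ _,
   fun _ _ _ _ _ => X_compatible.beta_smul _ _ _ _ _⟩

theorem dzbar_compatible : Compatible (fun x : JetCoord V => X x.dzbar) :=
  ⟨fun _ _ _ _ _ => X_compatible.gamma_add _ _ _ _ _,
   fun _ _ _ _ _ => X_compatible.gamma_smul _ _ _ _ _,
   fun _ _ _ _ _ => X_compatible.beta_add _ _ _ _ _,
   fun _ _ _ _ _ => X_compatible.beta_smul _ _ _ _ _⟩

theorem dz_comm (x y : JetCoord V) :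
    X x.dz * X y = koszul (x.deg + 0) y.deg • (X y * X x.dz) := by
  rw [X_comm, deg_dz, add_zero]

theorem dzbar_comm (x y : JetCoord V) :
    X x.dzbar * X y = koszul (x.deg + 0) y.deg • (X y * X x.dzbar) := by
  rw [X_comm, deg_dzbar, add_zero]

/-- The total derivative `∂_z`: the derivation of degree `0` raising the `z`-order of each jet. -/
def Dz : JetFun V →ₗ[ℂ] JetFun V := superDer 0 (fun x => X x.dz) dz_compatible dz_comm

/-- The total derivative `∂_z̄`. -/
def Dzbar : JetFun V →ₗ[ℂ] JetFun V :=
  superDer 0 (fun x => X x.dzbar) dzbar_compatible dzbar_comm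

theorem sgn_zero (a : JetFun V) : sgn 0 a = a := by
  have : (sgn 0 : JetFun V →ₐ[ℂ] JetFun V).toLinearMap = LinearMap.id :=
    linearMap_ext_mono (fun l => by simp [sgn_mono, koszul])
  exact LinearMap.congr_fun this a

@[simp] theorem Dz_X (x : JetCoord V) : Dz (X x) = X x.dz := superDer_X ..
@[simp] theorem Dzbar_X (x : JetCoord V) : Dzbar (X x) = X x.dzbar := superDer_X ..

theorem Dz_mul (a b : JetFun V) : Dz (a * b) = a * Dz b + Dz a * b := by
  rw [Dz, superDer_mul, sgn_zero]

theorem Dzbar_mul (a b : JetFun V) : Dzbar (a * b) = a * Dzbar b + Dzbar a * b := by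
  rw [Dzbar, superDer_mul, sgn_zero]

theorem Dz_mem_reducedPart {p : ℤ} {w : ℕ} {a : JetFun V} (ha : a ∈ reducedPart V p w) :
    Dz a ∈ reducedPart V p w := by
  have := superDer_mem_reducedPart 0 (fun x : JetCoord V => X x.dz) dz_compatible dz_comm
    (fun x => by simpa using X_mem_reducedPart x.dz) ha
  rwa [add_zero] at this

theorem Dzbar_mem_reducedPart {p : ℤ} {w : ℕ} {a : JetFun V} (ha : a ∈ reducedPart V p w) :
    Dzbar a ∈ reducedPart V p w := by
  have := superDer_mem_reducedPart 0 (fun x : JetCoord V => X x.dzbar) dzbar_compatible dzbar_comm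
    (fun x => by simpa using X_mem_reducedPart x.dzbar) ha
  rwa [add_zero] at this

/-- The operator `∂_z^m ∂_z̄^n`. -/
def Dpow (m n : ℕ) : JetFun V →ₗ[ℂ] JetFun V := (Dz ^ m) * (Dzbar ^ n)

theorem Dpow_mem_reducedPart {p : ℤ} {w : ℕ} {a : JetFun V} (ha : a ∈ reducedPart V p w) (m n : ℕ) :
    Dpow m n a ∈ reducedPart V p w := by
  have h : (Dzbar ^ n) a ∈ reducedPart V p w := by
    induction n with
    | zero => simpa using ha
    | succ n ih => rw [pow_succ']; exact Dzbar_mem_reducedPart ih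
  have h' : (Dz ^ m) ((Dzbar ^ n) a) ∈ reducedPart V p w := by
    induction m with
    | zero => simpa using h
    | succ n ih => rw [pow_succ']; exact Dz_mem_reducedPart ih
  exact h'

theorem Dz_Dzbar (a : JetFun V) : Dz (Dzbar a) = Dzbar (Dz a) := by
  have : (Dz * Dzbar : Module.End ℂ (JetFun V)) = Dzbar * Dz := by
    refine linearMap_ext_mono (fun l => ?_)
    simp only [Module.End.mul_apply]
    induction l with
    | nil => simp [mono, Dz, Dzbar, superDer_one]
    | cons x l ih =>
      have : x.dz.dzbar = x.dzbar.dz := by cases x <;> rfl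
      simp only [mono_cons, Dz_mul, Dzbar_mul, map_add, Dz_X, Dzbar_X, ih, this]
      abel
  exact LinearMap.congr_fun this a

theorem mem_reducedPart_of_eq {p q : ℤ} {w w' : ℕ} {a : JetFun V} (ha : a ∈ reducedPart V p w) (h : p = q)
    (h' : w = w') : a ∈ reducedPart V q w' := by subst h h'; exact ha

theorem Dpow_succ_left (m n : ℕ) (a : JetFun V) : Dpow (m + 1) n a = Dz (Dpow m n a) := by
  simp [Dpow, pow_succ']

theorem Dpow_succ_right (m n : ℕ) (a : JetFun V) : Dpow m (n + 1) a = Dzbar (Dpow m n a) := by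
  induction m with
  | zero => simp [Dpow, pow_succ']
  | succ m ih => rw [Dpow_succ_left, ih, Dz_Dzbar, ← Dpow_succ_left]

/-! ### The BRST operator -/

section brst

open JetCoord

/-- The value of `γʲ`, paired with the covector `l`. -/
def gammaJet (j : Fin 2) (l : Module.Dual ℂ V) : JetFun V := X (gamma j 0 0 l)
/-- The value of `βʲ`, paired with the vector `v`. -/
def betaJet (j : Fin 2) (v : V) : JetFun V := X (beta j 0 0 v)
variable (V) in
/-- The value of `cʲ`. -/
def cJet (j : Fin 2) : JetFun V := X (c j 0 0)
variable (V) in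
/-- The value of `bʲ`. -/
def bJet (j : Fin 2) : JetFun V := X (b j 0 0)

variable [Module.Finite ℂ V]

variable (V) in
/-- The function `⟨βʲ, ∂_z γᵏ⟩_V`. -/
def stress (j k : Fin 2) : JetFun V :=
  ∑ i, betaJet j (Module.finBasis ℂ V i) * Dz (gammaJet k ((Module.finBasis ℂ V).coord i))

/-- The operator `Q = {S, -}` on the undifferentiated fields (the jet orders of the argument are
ignored). Write `Φ = φ⁰ + θ φ¹` for each field, with `θ = dz̄` odd, and `∂̄ = θ ∂_z̄`. The action
is `S = ∫ ⟨β, ∂̄γ⟩ + ⟨b, ∂̄c⟩ + ⟨β, [c,γ]⟩ + ½ ⟨b, [c,c]⟩`, and `Q` is given by its variations: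
* `Q γ = ∂̄γ + c ∂γ`,
* `Q β = ∂̄β + ∂(c β)`,
* `Q c = ∂̄c + c ∂c`, which is `∂̄c + ½ [c,c]`,
* `Q b = ∂̄b + c ∂b + 2 ∂c b + ⟨β, ∂γ⟩`,
where `∂ = ∂_z`. As `Q` anticommutes with `θ`, the component `Q φ⁰` is the `θ⁰`-part of the right
side, and `Q φ¹` is minus the coefficient of `θ`. -/
def brstBase : JetCoord V → JetFun V
  | gamma 0 _ _ l => cJet V 0 * Dz (gammaJet 0 l)
  | gamma 1 _ _ l => -(Dzbar (gammaJet 0 l) + (cJet V 1 * Dz (gammaJet 0 l) - cJet V 0 * Dz (gammaJet 1 l)))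
  | beta 0 _ _ v => Dz (cJet V 0 * betaJet 0 v)
  | beta 1 _ _ v => -(Dzbar (betaJet 0 v) + Dz (cJet V 1 * betaJet 0 v - cJet V 0 * betaJet 1 v))
  | c 0 _ _ => cJet V 0 * Dz (cJet V 0)
  | c 1 _ _ => -(Dzbar (cJet V 0) + (cJet V 1 * Dz (cJet V 0) - cJet V 0 * Dz (cJet V 1)))
  | b 0 _ _ => cJet V 0 * Dz (bJet V 0) + (2 : ℂ) • (Dz (cJet V 0) * bJet V 0) + stress V 0 0
  | b 1 _ _ => -(Dzbar (bJet V 0) + (cJet V 1 * Dz (bJet V 0) - cJet V 0 * Dz (bJet V 1))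
      + (2 : ℂ) • (Dz (cJet V 1) * bJet V 0 - Dz (cJet V 0) * bJet V 1)
      + (stress V 1 0 + stress V 0 1))

/-- `Q` on an arbitrary jet coordinate; it commutes with total derivatives. -/
def brstGen (x : JetCoord V) : JetFun V :=
  match x with
  | gamma _ m n _ => Dpow m n (brstBase x)
  | beta _ m n _ => Dpow m n (brstBase x)
  | c _ m n => Dpow m n (brstBase x)
  | b _ m n => Dpow m n (brstBase x)

theorem brstBase_mem (x : JetCoord V) : brstBase x ∈ reducedPart V (x.deg + 1) x.cotWeight := by
  have hg : ∀ (j : Fin 2) (l : Module.Dual ℂ V), gammaJet j l ∈ reducedPart V (-((j : ℕ) : ℤ)) 0 :=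
    fun j l => X_mem_reducedPart (gamma j 0 0 l)
  have hb : ∀ (j : Fin 2) (v : V), betaJet j v ∈ reducedPart V (-((j : ℕ) : ℤ)) 1 :=
    fun j v => X_mem_reducedPart (beta j 0 0 v)
  have hc : ∀ j : Fin 2, cJet V j ∈ reducedPart V (1 - ((j : ℕ) : ℤ)) 0 := fun j => X_mem_reducedPart (c j 0 0)
  have hbb : ∀ j : Fin 2, bJet V j ∈ reducedPart V (-1 - ((j : ℕ) : ℤ)) 1 :=
    fun j => X_mem_reducedPart (b j 0 0)
  have hs : ∀ j k : Fin 2, stress V j k ∈ reducedPart V (-((j : ℕ) : ℤ) + -((k : ℕ) : ℤ)) (1 + 0) :=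
    fun j k => sum_mem fun i _ => mul_mem_reducedPart (hb _ _) (Dz_mem_reducedPart (hg _ _))
  rcases x with ⟨j, m, n, l⟩ | ⟨j, m, n, v⟩ | ⟨j, m, n⟩ | ⟨j, m, n⟩ <;> fin_cases j
  · exact mem_reducedPart_of_eq (mul_mem_reducedPart (hc 0) (Dz_mem_reducedPart (hg 0 l)))
      (by simp [JetCoord.deg]) rfl
  · refine neg_mem (add_mem (mem_reducedPart_of_eq (Dzbar_mem_reducedPart (hg 0 l)) ?_ rfl) (sub_mem
      (mem_reducedPart_of_eq (mul_mem_reducedPart (hc 1) (Dz_mem_reducedPart (hg 0 l))) ?_ rfl)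
      (mem_reducedPart_of_eq (mul_mem_reducedPart (hc 0) (Dz_mem_reducedPart (hg 1 l))) ?_ rfl))) <;>
    simp [JetCoord.deg]
  · exact mem_reducedPart_of_eq (Dz_mem_reducedPart (mul_mem_reducedPart (hc 0) (hb 0 v)))
      (by simp [JetCoord.deg]) rfl
  · refine neg_mem (add_mem (mem_reducedPart_of_eq (Dzbar_mem_reducedPart (hb 0 v)) ?_ rfl)
      (Dz_mem_reducedPart (sub_mem (mem_reducedPart_of_eq (mul_mem_reducedPart (hc 1) (hb 0 v)) ?_ rfl)
      (mem_reducedPart_of_eq (mul_mem_reducedPart (hc 0) (hb 1 v)) ?_ rfl)))) <;>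
    simp [JetCoord.deg]
  · exact mem_reducedPart_of_eq (mul_mem_reducedPart (hc 0) (Dz_mem_reducedPart (hc 0)))
      (by simp [JetCoord.deg]) rfl
  · refine neg_mem (add_mem (mem_reducedPart_of_eq (Dzbar_mem_reducedPart (hc 0)) ?_ rfl) (sub_mem
      (mem_reducedPart_of_eq (mul_mem_reducedPart (hc 1) (Dz_mem_reducedPart (hc 0))) ?_ rfl)
      (mem_reducedPart_of_eq (mul_mem_reducedPart (hc 0) (Dz_mem_reducedPart (hc 1))) ?_ rfl))) <;>
    simp [JetCoord.deg]
  · refine add_mem (add_mem (mem_reducedPart_of_eq (mul_mem_reducedPart (hc 0) (Dz_mem_reducedPart (hbb 0))) ?_ rfl)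
      (Submodule.smul_mem _ _ (mem_reducedPart_of_eq (mul_mem_reducedPart (Dz_mem_reducedPart (hc 0)) (hbb 0))
        ?_ rfl)))
      (mem_reducedPart_of_eq (hs 0 0) ?_ rfl) <;>
    simp [JetCoord.deg]
  · refine neg_mem (add_mem (add_mem (add_mem (mem_reducedPart_of_eq (Dzbar_mem_reducedPart (hbb 0)) ?_ rfl)
      (sub_mem
        (mem_reducedPart_of_eq (mul_mem_reducedPart (hc 1) (Dz_mem_reducedPart (hbb 0))) ?_ rfl)
        (mem_reducedPart_of_eq (mul_mem_reducedPart (hc 0) (Dz_mem_reducedPart (hbb 1))) ?_ rfl)))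
      (Submodule.smul_mem _ _ (sub_mem
        (mem_reducedPart_of_eq (mul_mem_reducedPart (Dz_mem_reducedPart (hc 1)) (hbb 0)) ?_ rfl)
        (mem_reducedPart_of_eq (mul_mem_reducedPart (Dz_mem_reducedPart (hc 0)) (hbb 1)) ?_ rfl))))
      (add_mem (mem_reducedPart_of_eq (hs 1 0) ?_ rfl) (mem_reducedPart_of_eq (hs 0 1) ?_ rfl))) <;>
    simp [JetCoord.deg]

theorem brstGen_mem (x : JetCoord V) : brstGen x ∈ reducedPart V (x.deg + 1) x.cotWeight := by
  cases x <;> exact Dpow_mem_reducedPart (brstBase_mem _) _ _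

theorem brstGen_compatible : Compatible (brstGen : JetCoord V → JetFun V) where
  gamma_add j m n l l' := by
    have h : ∀ k, (gammaJet k (l + l') : JetFun V) = gammaJet k l + gammaJet k l' :=
      fun k => X_compatible.gamma_add _ _ _ _ _
    simp only [brstGen, ← map_add]
    congr 1
    fin_cases j <;> simp only [brstBase, h, map_add, mul_add] <;> abel
  gamma_smul j m n a l := by
    have h : ∀ k, (gammaJet k (a • l) : JetFun V) = a • gammaJet k l :=
      fun k => X_compatible.gamma_smul _ _ _ _ _
    simp only [brstGen, ← map_smul]
    congr 1
    fin_cases j <;> simp only [brstBase, h, map_smul, mul_smul_comm, smul_neg, smul_add, smul_sub]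
  beta_add j m n l l' := by
    have h : ∀ k, (betaJet k (l + l') : JetFun V) = betaJet k l + betaJet k l' :=
      fun k => X_compatible.beta_add _ _ _ _ _
    simp only [brstGen, ← map_add]
    congr 1
    fin_cases j <;> simp only [brstBase, h, map_add, map_sub, mul_add] <;> abel
  beta_smul j m n a l := by
    have h : ∀ k, (betaJet k (a • l) : JetFun V) = a • betaJet k l :=
      fun k => X_compatible.beta_smul _ _ _ _ _
    simp only [brstGen, ← map_smul]
    congr 1
    fin_cases j <;> simp only [brstBase, h, map_smul, map_sub, mul_smul_comm, smul_neg, smul_add,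
      smul_sub]

variable (V) in
/-- The differential `Q = {S, -}`, the derivation of degree `1` extending `brstGen`. -/
def brst : JetFun V →ₗ[ℂ] JetFun V :=
  superDer 1 brstGen brstGen_compatible (fun x y => reducedPart_mul_X (brstGen_mem x) y)

theorem brst_X (x : JetCoord V) : brst V (X x) = brstGen x := superDer_X ..

theorem brst_mul (a a' : JetFun V) : brst V (a * a') = sgn 1 a * brst V a' + brst V a * a' :=
  superDer_mul ..

theorem brst_mem {p : ℤ} {w : ℕ} {a : JetFun V} (ha : a ∈ reducedPart V p w) :
    brst V a ∈ reducedPart V (p + 1) w :=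
  superDer_mem_reducedPart 1 brstGen _ _ brstGen_mem ha

theorem brst_Dz (a : JetFun V) : brst V (Dz a) = Dz (brst V a) := by
  have : (brst V * Dz : Module.End ℂ (JetFun V)) = Dz * brst V := by
    refine linearMap_ext_mono (fun l => ?_)
    simp only [Module.End.mul_apply]
    induction l with
    | nil => simp [mono, Dz, brst, superDer_one]
    | cons x l ih =>
      have h : brst V (X x.dz) = Dz (brst V (X x)) := by
        rw [brst_X, brst_X]
        rcases x with ⟨j, m, n, l⟩ | ⟨j, m, n, v⟩ | ⟨j, m, n⟩ | ⟨j, m, n⟩ <;> fin_cases j <;>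
          exact Dpow_succ_left _ _ _
      simp only [mono_cons, Dz_mul, brst_mul, map_add, Dz_X, ih, sgn_X, h, deg_dz, map_smul,
        smul_mul_assoc, smul_add]
      abel
  exact LinearMap.congr_fun this a

theorem brst_Dzbar (a : JetFun V) : brst V (Dzbar a) = Dzbar (brst V a) := by
  have : (brst V * Dzbar : Module.End ℂ (JetFun V)) = Dzbar * brst V := by
    refine linearMap_ext_mono (fun l => ?_)
    simp only [Module.End.mul_apply]
    induction l with
    | nil => simp [mono, Dzbar, brst, superDer_one]
    | cons x l ih =>
      have h : brst V (X x.dzbar) = Dzbar (brst V (X x)) := by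
        rw [brst_X, brst_X]
        rcases x with ⟨j, m, n, l⟩ | ⟨j, m, n, v⟩ | ⟨j, m, n⟩ | ⟨j, m, n⟩ <;> fin_cases j <;>
          exact Dpow_succ_right _ _ _
      simp only [mono_cons, Dzbar_mul, brst_mul, map_add, Dzbar_X, ih, sgn_X, h, deg_dzbar,
        map_smul, smul_mul_assoc, smul_add]
      abel
  exact LinearMap.congr_fun this a

theorem brst_Dpow (m n : ℕ) (a : JetFun V) : brst V (Dpow m n a) = Dpow m n (brst V a) := by
  induction m with
  | zero =>
    induction n with
    | zero => simp [Dpow]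
    | succ n ih => rw [Dpow_succ_right, Dpow_succ_right, brst_Dzbar, ih]
  | succ m ih => rw [Dpow_succ_left, Dpow_succ_left, brst_Dz, ih]

/-- An auxiliary ordering of the coordinates, used to normalise products. -/
def JetCoord.rank : JetCoord V → ℕ
  | .gamma j m n _ => 1000 + 100 * (j : ℕ) + 10 * m + n
  | .beta j m n _ => 2000 + 100 * (j : ℕ) + 10 * m + n
  | .c j m n => 3000 + 100 * (j : ℕ) + 10 * m + n
  | .b j m n => 4000 + 100 * (j : ℕ) + 10 * m + n

theorem X_swap (x y : JetCoord V) (_ : x.rank < y.rank) :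
    X x * X y = koszul x.deg y.deg • (X y * X x) := X_comm x y

theorem X_swap_assoc (x y : JetCoord V) (_ : x.rank < y.rank) (a : JetFun V) :
    X x * (X y * a) = koszul x.deg y.deg • (X y * (X x * a)) := by
  rw [← mul_assoc, X_comm, smul_mul_assoc, mul_assoc]

theorem X_sq (x : JetCoord V) (h : koszul x.deg x.deg = -1) : X x * X x = 0 := by
  have := X_comm x x
  rw [h, neg_smul, one_smul, eq_neg_iff_add_eq_zero, ← two_smul ℂ] at this
  exact (smul_eq_zero.mp this).resolve_left two_ne_zero

theorem X_sq_assoc (x : JetCoord V) (h : koszul x.deg x.deg = -1) (a : JetFun V) :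
    X x * (X x * a) = 0 := by
  rw [← mul_assoc, X_sq x h, zero_mul]

theorem brst_gammaJet_zero (l : Module.Dual ℂ V) : brst V (gammaJet 0 l) = cJet V 0 * Dz (gammaJet 0 l) := by
  rw [gammaJet, brst_X]; simp [brstGen, Dpow, brstBase, gammaJet]

theorem brst_cJet_zero : brst V (cJet V 0) = cJet V 0 * Dz (cJet V 0) := by
  rw [cJet, brst_X]; simp [brstGen, Dpow, brstBase, cJet]

theorem brst_betaJet_zero (v : V) : brst V (betaJet 0 v) = Dz (cJet V 0 * betaJet 0 v) := by
  rw [betaJet, brst_X]; simp [brstGen, Dpow, brstBase, betaJet]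

theorem brst_bJet_zero : brst V (bJet V 0) = 
    cJet V 0 * Dz (bJet V 0) + (2 : ℂ) • (Dz (cJet V 0) * bJet V 0) + stress V 0 0 := by
  rw [bJet, brst_X]; simp [brstGen, Dpow, brstBase, bJet]

theorem brst_gammaJet_one (l : Module.Dual ℂ V) : brst V (gammaJet 1 l) =
    -(Dzbar (gammaJet 0 l) + (cJet V 1 * Dz (gammaJet 0 l) - cJet V 0 * Dz (gammaJet 1 l))) := by
  rw [gammaJet, brst_X]; simp [brstGen, Dpow, brstBase, gammaJet]

theorem brst_cJet_one : brst V (cJet V 1) =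
    -(Dzbar (cJet V 0) + (cJet V 1 * Dz (cJet V 0) - cJet V 0 * Dz (cJet V 1))) := by
  rw [cJet, brst_X]; simp [brstGen, Dpow, brstBase, cJet]

theorem brst_betaJet_one (v : V) : brst V (betaJet 1 v) =
    -(Dzbar (betaJet 0 v) + Dz (cJet V 1 * betaJet 0 v - cJet V 0 * betaJet 1 v)) := by
  rw [betaJet, brst_X]; simp [brstGen, Dpow, brstBase, betaJet]

theorem brst_bJet_one : brst V (bJet V 1) =
    -(Dzbar (bJet V 0) + (cJet V 1 * Dz (bJet V 0) - cJet V 0 * Dz (bJet V 1))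
      + (2 : ℂ) • (Dz (cJet V 1) * bJet V 0 - Dz (cJet V 0) * bJet V 1)
      + (stress V 1 0 + stress V 0 1)) := by
  rw [bJet, brst_X]; simp [brstGen, Dpow, brstBase, bJet]

set_option linter.unusedSimpArgs false in
set_option maxHeartbeats 2000000 in
theorem brst_brstBase (x : JetCoord V) : brst V (brstBase x) = 0 := by
  rcases x with ⟨j, m, n, l⟩ | ⟨j, m, n, v⟩ | ⟨j, m, n⟩ | ⟨j, m, n⟩ <;> fin_cases j
  · simp only [brstBase, brst_mul, brst_Dz, brst_gammaJet_zero, brst_cJet_zero]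
    simp only [gammaJet, cJet, betaJet, bJet, stress]
    simp [Dz_mul, Dzbar_mul, JetCoord.dz, JetCoord.dzbar, mul_add, add_mul, mul_sub, sub_mul, X_swap, X_swap_assoc, X_sq, X_sq_assoc, JetCoord.rank, JetCoord.deg, koszul, mul_assoc, sub_eq_add_neg, mul_neg, neg_mul, neg_smul, smul_smul, mul_smul_comm, smul_mul_assoc]
  · simp only [brstBase, brst_mul, brst_Dz, brst_Dzbar, map_neg, map_add, map_sub, brst_gammaJet_zero, brst_cJet_zero, brst_gammaJet_one, brst_cJet_one]
    simp only [gammaJet, cJet, betaJet, bJet, stress]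
    simp [Dz_mul, Dzbar_mul, JetCoord.dz, JetCoord.dzbar, mul_add, add_mul, mul_sub, sub_mul, X_swap, X_swap_assoc, X_sq, X_sq_assoc, JetCoord.rank, JetCoord.deg, koszul, mul_assoc, sub_eq_add_neg, mul_neg, neg_mul, neg_smul, smul_smul, mul_smul_comm, smul_mul_assoc]
    try abel
  · simp only [brstBase, brst_mul, brst_Dz, brst_Dzbar, map_neg, map_add, map_sub, brst_betaJet_zero, brst_cJet_zero]
    simp only [gammaJet, cJet, betaJet, bJet, stress]
    simp [Dz_mul, Dzbar_mul, JetCoord.dz, JetCoord.dzbar, mul_add, add_mul, mul_sub, sub_mul, X_swap, X_swap_assoc, X_sq, X_sq_assoc, JetCoord.rank, JetCoord.deg, koszul, mul_assoc, sub_eq_add_neg, mul_neg, neg_mul, neg_smul, smul_smul, mul_smul_comm, smul_mul_assoc]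
    try abel
  · simp only [brstBase, brst_mul, brst_Dz, brst_Dzbar, map_neg, map_add, map_sub, brst_betaJet_zero, brst_cJet_zero, brst_betaJet_one, brst_cJet_one]
    simp only [gammaJet, cJet, betaJet, bJet, stress]
    simp [Dz_mul, Dzbar_mul, JetCoord.dz, JetCoord.dzbar, mul_add, add_mul, mul_sub, sub_mul, X_swap, X_swap_assoc, X_sq, X_sq_assoc, JetCoord.rank, JetCoord.deg, koszul, mul_assoc, sub_eq_add_neg, mul_neg, neg_mul, neg_smul, smul_smul, mul_smul_comm, smul_mul_assoc]
    try abel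
  · simp only [brstBase, brst_mul, brst_Dz, brst_Dzbar, map_neg, map_add, map_sub, brst_cJet_zero]
    simp only [gammaJet, cJet, betaJet, bJet, stress]
    simp [Dz_mul, Dzbar_mul, JetCoord.dz, JetCoord.dzbar, mul_add, add_mul, mul_sub, sub_mul, X_swap, X_swap_assoc, X_sq, X_sq_assoc, JetCoord.rank, JetCoord.deg, koszul, mul_assoc, sub_eq_add_neg, mul_neg, neg_mul, neg_smul, smul_smul, mul_smul_comm, smul_mul_assoc]
    try abel
  · simp only [brstBase, brst_mul, brst_Dz, brst_Dzbar, map_neg, map_add, map_sub, brst_cJet_zero, brst_cJet_one]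
    simp only [gammaJet, cJet, betaJet, bJet, stress]
    simp [Dz_mul, Dzbar_mul, JetCoord.dz, JetCoord.dzbar, mul_add, add_mul, mul_sub, sub_mul, X_swap, X_swap_assoc, X_sq, X_sq_assoc, JetCoord.rank, JetCoord.deg, koszul, mul_assoc, sub_eq_add_neg, mul_neg, neg_mul, neg_smul, smul_smul, mul_smul_comm, smul_mul_assoc]
    try abel
  · simp only [brstBase, stress, map_sum, brst_mul, brst_Dz, brst_Dzbar, map_neg, map_add, map_sub, map_smul, brst_cJet_zero, brst_bJet_zero, brst_gammaJet_zero, brst_betaJet_zero]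
    simp only [gammaJet, cJet, betaJet, bJet, stress]
    simp [Dz_mul, Dzbar_mul, JetCoord.dz, JetCoord.dzbar, mul_add, add_mul, mul_sub, sub_mul, X_swap, X_swap_assoc, X_sq, X_sq_assoc, JetCoord.rank, JetCoord.deg, koszul, mul_assoc, sub_eq_add_neg, mul_neg, neg_mul, neg_smul, smul_smul, mul_smul_comm, smul_mul_assoc, Finset.mul_sum, Finset.sum_mul, Finset.sum_add_distrib]
    try module
  · simp only [brstBase, stress, map_sum, brst_mul, brst_Dz, brst_Dzbar, map_neg, map_add, map_sub, map_smul, brst_cJet_zero, brst_bJet_zero, brst_gammaJet_zero, brst_betaJet_zero, brst_cJet_one, brst_bJet_one, brst_gammaJet_one, brst_betaJet_one]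
    simp only [gammaJet, cJet, betaJet, bJet, stress]
    simp [Dz_mul, Dzbar_mul, JetCoord.dz, JetCoord.dzbar, mul_add, add_mul, mul_sub, sub_mul, X_swap, X_swap_assoc, X_sq, X_sq_assoc, JetCoord.rank, JetCoord.deg, koszul, mul_assoc, sub_eq_add_neg, mul_neg, neg_mul, neg_smul, smul_smul, mul_smul_comm, smul_mul_assoc, Finset.mul_sum, Finset.sum_mul, Finset.sum_add_distrib]
    try module

theorem brst_brst (a : JetFun V) : brst V (brst V a) = 0 := by
  have : (brst V * brst V : Module.End ℂ (JetFun V)) = 0 := by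
    refine linearMap_ext_mono (fun l => ?_)
    simp only [Module.End.mul_apply, LinearMap.zero_apply]
    induction l with
    | nil => simp [mono, brst, superDer_one]
    | cons x l ih =>
      have h : brst V (brstGen x) = 0 := by
        cases x <;> simp only [brstGen, brst_Dpow, brst_brstBase, map_zero]
      have hk : koszul 1 (x.deg + 1) = - koszul 1 x.deg := by
        rw [koszul_add_right]; simp [koszul]
      rw [mono_cons, brst_mul, map_add, brst_mul, brst_mul, brst_X, h, ih,
        sgn_reducedPart 1 (brstGen_mem x), sgn_X, hk]
      simp only [map_smul, brst_X]
      simp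
  exact LinearMap.congr_fun this a

variable (V) in
/-- The complex of functions without constant term, of `ℂ^×_cot`-weight `w`, on the jets at the origin
of the fields, with differential `{S, -}`. -/
def jetComplex (w : ℕ) : CochainComplex (ModuleCat.{u} ℂ) ℤ :=
  CochainComplex.of (fun p => ModuleCat.of ℂ (reducedPart V p w))
    (fun _ => ModuleCat.ofHom ((brst V).restrict (fun _ ha => brst_mem ha)))
    (fun _ => by
      ext a
      exact brst_brst a.1)

theorem jetComplex_d (w : ℕ) (p : ℤ) : (jetComplex V w).d p (p + 1) =
    ModuleCat.ofHom ((brst V).restrict (fun _ ha => brst_mem (w := w) ha)) := by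
  simp [jetComplex]

variable (V) in
/-- The `ℂ^×_cot`-weight `w` part of the translation-invariant deformation complex of the holomorphic
string on `ℂ` with target `V`. A translation-invariant Lagrangian density is a function on the jets
of the fields at the origin times the density `d²z`; constants are discarded; the differential is
`{S, -}`; and the complex carries the overall shift `[2]` of local functionals, for which a function
of degree `p` on jets sits in degree `p - 2`. -/
def defComplex (w : ℕ) : CochainComplex (ModuleCat.{u} ℂ) ℤ := (jetComplex V w)⟦(2 : ℤ)⟧

/-! ### GL(V) -/

end brst

/-- The contragredient action of `GL(V)` on `V^∨`. -/
def dualAct (g : V ≃ₗ[ℂ] V) : Module.Dual ℂ V →ₗ[ℂ] Module.Dual ℂ V := g.symm.toLinearMap.dualMap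

theorem sum_basis_act [Module.Finite ℂ V] {M : Type*} [AddCommGroup M] [Module ℂ M]
    (B : V →ₗ[ℂ] Module.Dual ℂ V →ₗ[ℂ] M) (g : V ≃ₗ[ℂ] V) :
    ∑ i, B (g (Module.finBasis ℂ V i)) (dualAct g ((Module.finBasis ℂ V).coord i))
      = ∑ i, B (Module.finBasis ℂ V i) ((Module.finBasis ℂ V).coord i) := by
  set e := Module.finBasis ℂ V
  have h1 : ∀ i, B (g (e i)) (dualAct g (e.coord i))
      = ∑ k, B (e k) (e.coord k (g (e i)) • dualAct g (e.coord i)) := by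
    intro i
    conv_lhs => rw [← e.sum_repr (g (e i))]
    simp only [map_sum, map_smul, LinearMap.sum_apply, LinearMap.smul_apply,
      Module.Basis.coord_apply]
  have h2 : ∀ k, ∑ i, e.coord k (g (e i)) • dualAct g (e.coord i) = e.coord k := by
    intro k
    ext v
    have h3 : v = g (g.symm v) := by simp
    have h4 := congrArg (fun x => e.coord k (g x)) (e.sum_repr (g.symm v))
    simp only [map_sum, map_smul, ← h3] at h4
    rw [← h4]
    simp [dualAct, mul_comm]
  rw [Finset.sum_congr rfl fun i _ => h1 i, Finset.sum_comm]
  refine Finset.sum_congr rfl fun k _ => ?_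
  rw [← map_sum, h2]

/-- The action of `GL(V)` on jet coordinates; it is trivial on `b` and `c`. -/
def JetCoord.act (g : V ≃ₗ[ℂ] V) : JetCoord V → JetCoord V
  | .gamma j m n l => .gamma j m n (dualAct g l)
  | .beta j m n v => .beta j m n (g v)
  | .c j m n => .c j m n
  | .b j m n => .b j m n

@[simp] theorem deg_act (g : V ≃ₗ[ℂ] V) (x : JetCoord V) : (x.act g).deg = x.deg := by
  cases x <;> rfl

@[simp] theorem cotWeight_act (g : V ≃ₗ[ℂ] V) (x : JetCoord V) :
    (x.act g).cotWeight = x.cotWeight := by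
  cases x <;> rfl

/-- The action of `GL(V)` on functions on jets. -/
def jetAct (g : V ≃ₗ[ℂ] V) : JetFun V →ₐ[ℂ] JetFun V :=
  liftHom (fun x => X (x.act g))
    ⟨fun _ _ _ _ _ => by simp only [JetCoord.act, map_add, X_compatible.gamma_add],
     fun _ _ _ _ _ => by simp only [JetCoord.act, map_smul, X_compatible.gamma_smul],
     fun _ _ _ _ _ => by simp only [JetCoord.act, map_add, X_compatible.beta_add],
     fun _ _ _ _ _ => by simp only [JetCoord.act, map_smul, X_compatible.beta_smul]⟩
    (fun x y => by rw [X_comm, deg_act, deg_act])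

@[simp] theorem jetAct_X (g : V ≃ₗ[ℂ] V) (x : JetCoord V) : jetAct g (X x) = X (x.act g) :=
  liftHom_X ..

theorem jetAct_mono (g : V ≃ₗ[ℂ] V) (l : List (JetCoord V)) :
    jetAct g (mono l) = mono (l.map (JetCoord.act g)) := by
  induction l with
  | nil => simp [mono]
  | cons x l ih => rw [mono_cons, map_mul, ih, jetAct_X, List.map_cons, mono_cons]

theorem jetAct_mem {p : ℤ} {w : ℕ} (g : V ≃ₗ[ℂ] V) {a : JetFun V} (ha : a ∈ reducedPart V p w) :
    jetAct g a ∈ reducedPart V p w := by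
  induction ha using Submodule.span_induction with
  | mem a h =>
    obtain ⟨l, hl, rfl, rfl, rfl⟩ := h
    refine Submodule.subset_span ⟨l.map (JetCoord.act g), by simpa using hl, ?_, ?_,
      jetAct_mono g l⟩ <;>
    simp [Function.comp_def]
  | zero => simp
  | add a b _ _ iha ihb => rw [map_add]; exact add_mem iha ihb
  | smul r a _ ih => rw [map_smul]; exact Submodule.smul_mem _ _ ih

theorem jetAct_Dz (g : V ≃ₗ[ℂ] V) (a : JetFun V) : jetAct g (Dz a) = Dz (jetAct g a) := by
  have : (jetAct g).toLinearMap ∘ₗ Dz = Dz ∘ₗ (jetAct g).toLinearMap := by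
    refine linearMap_ext_mono (fun l => ?_)
    simp only [LinearMap.comp_apply, AlgHom.toLinearMap_apply]
    induction l with
    | nil => simp [mono, Dz, superDer_one]
    | cons x l ih =>
      have : (x.act g).dz = x.dz.act g := by cases x <;> rfl
      simp only [mono_cons, map_mul, Dz_mul, map_add, ih, Dz_X, jetAct_X, this]
  exact LinearMap.congr_fun this a

theorem jetAct_Dzbar (g : V ≃ₗ[ℂ] V) (a : JetFun V) :
    jetAct g (Dzbar a) = Dzbar (jetAct g a) := by
  have : (jetAct g).toLinearMap ∘ₗ Dzbar = Dzbar ∘ₗ (jetAct g).toLinearMap := by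
    refine linearMap_ext_mono (fun l => ?_)
    simp only [LinearMap.comp_apply, AlgHom.toLinearMap_apply]
    induction l with
    | nil => simp [mono, Dzbar, superDer_one]
    | cons x l ih =>
      have : (x.act g).dzbar = x.dzbar.act g := by cases x <;> rfl
      simp only [mono_cons, map_mul, Dzbar_mul, map_add, ih, Dzbar_X, jetAct_X, this]
  exact LinearMap.congr_fun this a

theorem jetAct_Dpow (g : V ≃ₗ[ℂ] V) (m n : ℕ) (a : JetFun V) :
    jetAct g (Dpow m n a) = Dpow m n (jetAct g a) := by
  induction m with
  | zero =>
    induction n with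
    | zero => simp [Dpow]
    | succ n ih => rw [Dpow_succ_right, Dpow_succ_right, jetAct_Dzbar, ih]
  | succ m ih => rw [Dpow_succ_left, Dpow_succ_left, jetAct_Dz, ih]

section equivariance
variable [Module.Finite ℂ V]
open JetCoord

theorem jetAct_stress (g : V ≃ₗ[ℂ] V) (j k : Fin 2) : jetAct g (stress V j k) = stress V j k := by
  let B : V →ₗ[ℂ] Module.Dual ℂ V →ₗ[ℂ] JetFun V :=
    LinearMap.mk₂ ℂ (fun v l => betaJet j v * Dz (gammaJet k l))
      (fun v v' l => by simp only [betaJet, X_compatible.beta_add, add_mul])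
      (fun a v l => by simp only [betaJet, X_compatible.beta_smul, smul_mul_assoc])
      (fun v l l' => by simp only [gammaJet, X_compatible.gamma_add, mul_add, map_add])
      (fun a v l => by simp only [gammaJet, X_compatible.gamma_smul, map_smul, mul_smul_comm])
  have := sum_basis_act B g
  change jetAct g (stress V j k) = ∑ i, B _ _
  rw [← this, stress, map_sum]
  refine Finset.sum_congr rfl fun i _ => ?_
  rw [map_mul, jetAct_Dz, betaJet, gammaJet, jetAct_X, jetAct_X]
  rfl

theorem jetAct_brstBase (g : V ≃ₗ[ℂ] V) (x : JetCoord V) :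
    jetAct g (brstBase x) = brstBase (x.act g) := by
  have hg : ∀ (j : Fin 2) (l : Module.Dual ℂ V), jetAct g (gammaJet j l) = gammaJet j (dualAct g l) :=
    fun j l => jetAct_X g (gamma j 0 0 l)
  have hb : ∀ (j : Fin 2) (v : V), jetAct g (betaJet j v) = betaJet j (g v) :=
    fun j v => jetAct_X g (beta j 0 0 v)
  have hc : ∀ j : Fin 2, jetAct g (cJet V j) = cJet V j := fun j => jetAct_X g (c j 0 0)
  have hbb : ∀ j : Fin 2, jetAct g (bJet V j) = bJet V j := fun j => jetAct_X g (b j 0 0)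
  rcases x with ⟨j, m, n, l⟩ | ⟨j, m, n, v⟩ | ⟨j, m, n⟩ | ⟨j, m, n⟩ <;> fin_cases j <;>
    simp only [JetCoord.act, brstBase, map_neg, map_add, map_sub, map_smul, map_mul, jetAct_Dz,
      jetAct_Dzbar, hg, hb, hc, hbb, jetAct_stress]

theorem jetAct_brst (g : V ≃ₗ[ℂ] V) (a : JetFun V) :
    jetAct g (brst V a) = brst V (jetAct g a) := by
  have : (jetAct g).toLinearMap ∘ₗ brst V = brst V ∘ₗ (jetAct g).toLinearMap := by
    refine linearMap_ext_mono (fun l => ?_)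
    simp only [LinearMap.comp_apply, AlgHom.toLinearMap_apply]
    induction l with
    | nil => simp [mono, brst, superDer_one]
    | cons x l ih =>
      have h : jetAct g (brstGen x) = brstGen (x.act g) := by
        cases x <;> simp only [brstGen, jetAct_Dpow, jetAct_brstBase, JetCoord.act]
      simp only [mono_cons, map_mul, brst_mul, map_add, ih, brst_X, jetAct_X, sgn_X, h, deg_act,
        map_smul]
  exact LinearMap.congr_fun this a

/-- The action of `GL(V)` on the complex of functions on jets. -/
def jetComplexAct (w : ℕ) (g : V ≃ₗ[ℂ] V) : jetComplex V w ⟶ jetComplex V w :=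
  CochainComplex.ofHom
    (fun _ => ModuleCat.ofHom ((jetAct g).toLinearMap.restrict (fun _ ha => jetAct_mem g ha)))
    (fun _ => by
      rw [jetComplex_d]
      ext a
      apply Subtype.ext
      exact (jetAct_brst g a.1).symm)

/-- The action of `GL(V)` on the deformation complex. -/
def defComplexAct (w : ℕ) (g : V ≃ₗ[ℂ] V) : defComplex V w ⟶ defComplex V w :=
  (jetComplexAct w g)⟦(2 : ℤ)⟧'

end equivariance

/-! ### Polynomial differential forms -/

open TensorProduct

variable (V) in
/-- Polynomial functions on `V`, that is `Sym(V^∨)`. -/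
abbrev Poly : Type u := SymmetricAlgebra ℂ (Module.Dual ℂ V)

/-- The algebra map `f ↦ f + ε ∂_v f`. -/
def polyDerivHom (v : V) : Poly V →ₐ[ℂ] TrivSqZeroExt (Poly V) (Poly V) :=
  SymmetricAlgebra.lift
    ((TrivSqZeroExt.inlAlgHom ℂ (Poly V) (Poly V)).toLinearMap ∘ₗ SymmetricAlgebra.ι ℂ _
      + (TrivSqZeroExt.inrHom (Poly V) (Poly V)).restrictScalars ℂ ∘ₗ
          Algebra.linearMap ℂ (Poly V) ∘ₗ Module.Dual.eval ℂ V v)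

theorem polyDerivHom_fst (v : V) (f : Poly V) : (polyDerivHom v f).fst = f := by
  have : (TrivSqZeroExt.fstHom ℂ (Poly V) (Poly V)).comp (polyDerivHom v) = AlgHom.id ℂ _ := by
    apply SymmetricAlgebra.algHom_ext
    ext l
    simp [polyDerivHom]
  exact DFunLike.congr_fun this f

/-- The directional derivative `∂_v` of polynomial functions. -/
def polyDeriv (v : V) : Poly V →ₗ[ℂ] Poly V :=
  TrivSqZeroExt.sndHom (Poly V) (Poly V) |>.restrictScalars ℂ |>.comp (polyDerivHom v).toLinearMap

theorem polyDeriv_ι (v : V) (l : Module.Dual ℂ V) :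
    polyDeriv v (SymmetricAlgebra.ι ℂ _ l) = algebraMap ℂ (Poly V) (l v) := by
  simp [polyDeriv, polyDerivHom, Algebra.algebraMap_eq_smul_one]

theorem polyDeriv_mul (v : V) (f f' : Poly V) :
    polyDeriv v (f * f') = f * polyDeriv v f' + f' * polyDeriv v f := by
  simp [polyDeriv, polyDerivHom_fst, mul_comm]

theorem polyDeriv_algebraMap (v : V) (r : ℂ) : polyDeriv v (algebraMap ℂ (Poly V) r) = 0 := by
  simp [polyDeriv, TrivSqZeroExt.algebraMap_eq_inl']


theorem polyDeriv_add (v v' : V) (f : Poly V) :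
    polyDeriv (v + v') f = polyDeriv v f + polyDeriv v' f := by
  induction f using SymmetricAlgebra.induction with
  | algebraMap r => simp [polyDeriv_algebraMap]
  | ι l => simp [polyDeriv_ι]
  | mul f f' h h' => simp only [polyDeriv_mul, h, h']; ring
  | add f f' h h' => simp only [map_add, h, h']; abel

theorem polyDeriv_smul (a : ℂ) (v : V) (f : Poly V) :
    polyDeriv (a • v) f = a • polyDeriv v f := by
  induction f using SymmetricAlgebra.induction with
  | algebraMap r => simp [polyDeriv_algebraMap]
  | ι l => simp [polyDeriv_ι, Algebra.smul_def]
  | mul f f' h h' => simp only [polyDeriv_mul, h, h', mul_smul_comm, smul_add]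
  | add f f' h h' => simp only [map_add, h, h', smul_add]

variable (V) in
/-- Polynomial differential forms on `V`, that is `Sym(V^∨) ⊗ Λ(V^∨)`. -/
abbrev Forms : Type u := Poly V ⊗[ℂ] ExteriorAlgebra ℂ (Module.Dual ℂ V)

variable (V) in
/-- The de Rham differential `d (f ω) = ∑ i, (∂f/∂xᵢ) dxᵢ ∧ ω`. -/
def deRham [Module.Finite ℂ V] : Forms V →ₗ[ℂ] Forms V :=
  ∑ i, TensorProduct.map (polyDeriv (Module.finBasis ℂ V i))
    (LinearMap.mulLeft ℂ (ExteriorAlgebra.ι ℂ ((Module.finBasis ℂ V).coord i)))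

variable (V) in
/-- The space `Ω^k(V)` of polynomial `k`-forms. -/
def kForms (k : ℕ) : Submodule ℂ (Forms V) :=
  LinearMap.range (LinearMap.lTensor (Poly V) (⋀[ℂ]^k (Module.Dual ℂ V)).subtype)

variable (V) in
/-- The space `Ω^k_cl(V)` of closed polynomial `k`-forms. -/
def closedForms [Module.Finite ℂ V] (k : ℕ) : Submodule ℂ (Forms V) :=
  kForms V k ⊓ LinearMap.ker (deRham V)

/-- The action of `GL(V)` on polynomial functions. -/
def polyAct (g : V ≃ₗ[ℂ] V) : Poly V →ₐ[ℂ] Poly V :=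
  SymmetricAlgebra.lift (SymmetricAlgebra.ι ℂ _ ∘ₗ dualAct g)

/-- The action of `GL(V)` on polynomial differential forms. -/
def formsAct (g : V ≃ₗ[ℂ] V) : Forms V →ₗ[ℂ] Forms V :=
  TensorProduct.map (polyAct g).toLinearMap (ExteriorAlgebra.map (dualAct g)).toLinearMap

theorem polyAct_polyDeriv (g : V ≃ₗ[ℂ] V) (v : V) (f : Poly V) :
    polyAct g (polyDeriv v f) = polyDeriv (g v) (polyAct g f) := by
  induction f using SymmetricAlgebra.induction with
  | algebraMap r => simp [polyDeriv_algebraMap]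
  | ι l => simp [polyDeriv_ι, polyAct, dualAct]
  | mul f f' h h' => simp only [polyDeriv_mul, map_mul, map_add, h, h']
  | add f f' h h' => simp only [map_add, h, h']

theorem formsAct_deRham [Module.Finite ℂ V] (g : V ≃ₗ[ℂ] V) (ω : Forms V) :
    formsAct g (deRham V ω) = deRham V (formsAct g ω) := by
  induction ω using TensorProduct.induction_on with
  | zero => simp
  | add x y hx hy => rw [map_add, map_add, map_add, map_add, hx, hy]
  | tmul f η =>
    let B : V →ₗ[ℂ] Module.Dual ℂ V →ₗ[ℂ] Forms V :=
      LinearMap.mk₂ ℂ (fun v l => polyDeriv v (polyAct g f) ⊗ₜ[ℂ]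
          (ExteriorAlgebra.ι ℂ l * ExteriorAlgebra.map (dualAct g) η))
        (fun v v' l => by rw [polyDeriv_add, add_tmul])
        (fun a v l => by rw [polyDeriv_smul, smul_tmul'])
        (fun v l l' => by rw [map_add, add_mul, tmul_add])
        (fun a v l => by rw [map_smul, smul_mul_assoc, tmul_smul])
    have h1 : formsAct g (deRham V (f ⊗ₜ η)) = ∑ i, B (g (Module.finBasis ℂ V i))
        (dualAct g ((Module.finBasis ℂ V).coord i)) := by
      simp [deRham, formsAct, B, polyAct_polyDeriv, LinearMap.sum_apply, map_sum]
    have h2 : deRham V (formsAct g (f ⊗ₜ η)) = ∑ i, B (Module.finBasis ℂ V i)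
        ((Module.finBasis ℂ V).coord i) := by
      simp [deRham, formsAct, B, LinearMap.sum_apply]
    rw [h1, h2, sum_basis_act]

theorem formsAct_kForms (g : V ≃ₗ[ℂ] V) (k : ℕ) {ω : Forms V} (hω : ω ∈ kForms V k) :
    formsAct g ω ∈ kForms V k := by
  obtain ⟨ω, rfl⟩ := hω
  induction ω using TensorProduct.induction_on with
  | zero => simp
  | add x y hx hy => rw [map_add, map_add]; exact add_mem hx hy
  | tmul f η =>
    have h : ExteriorAlgebra.map (dualAct g) η.1 ∈ ⋀[ℂ]^k (Module.Dual ℂ V) := by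
      have h1 := Submodule.mem_map_of_mem (f := (ExteriorAlgebra.map (dualAct g)).toLinearMap) η.2
      rw [Submodule.map_pow] at h1
      refine (pow_le_pow_left' (M := Submodule ℂ (ExteriorAlgebra ℂ (Module.Dual ℂ V))) ?_ k) h1
      rintro _ ⟨_, ⟨l, rfl⟩, rfl⟩
      exact ⟨dualAct g l, by simp⟩
    exact ⟨polyAct g f ⊗ₜ ⟨_, h⟩, by simp [formsAct]⟩

theorem formsAct_closedForms [Module.Finite ℂ V] (g : V ≃ₗ[ℂ] V) (k : ℕ) {ω : Forms V}
    (hω : ω ∈ closedForms V k) : formsAct g ω ∈ closedForms V k :=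
  ⟨formsAct_kForms g k hω.1, by
    have h := LinearMap.mem_ker.mp hω.2
    refine LinearMap.mem_ker.mpr ?_
    rw [← formsAct_deRham, h, map_zero]⟩

section target
variable [Module.Finite ℂ V]

/-- A vector space, as a complex concentrated in degree `n`; the shift `M[k]` is in degree `-k`. -/
abbrev inDegree (n : ℤ) : ModuleCat.{u} ℂ ⥤ CochainComplex (ModuleCat.{u} ℂ) ℤ :=
  HomologicalComplex.single (ModuleCat.{u} ℂ) (ComplexShape.up ℤ) n

open CategoryTheory.Limits

variable (V) in
/-- The complex `ℂ[-1] ⊕ Ω²_cl(V)[1] ⊕ Ω¹(V) ⊕ Ω¹_cl(V)[-1]`, with zero differential. -/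
def targetComplex : CochainComplex (ModuleCat.{u} ℂ) ℤ :=
  (inDegree 1).obj (ModuleCat.of ℂ (ULift.{u} ℂ)) ⊞
    ((inDegree (-1)).obj (ModuleCat.of ℂ (closedForms V 2)) ⊞
      ((inDegree 0).obj (ModuleCat.of ℂ (kForms V 1)) ⊞
        (inDegree 1).obj (ModuleCat.of ℂ (closedForms V 1))))

/-- The action of `GL(V)` on the target complex; it is trivial on `ℂ[-1]`. -/
def targetAct (g : V ≃ₗ[ℂ] V) : targetComplex V ⟶ targetComplex V :=
  biprod.map (𝟙 _)
    (biprod.map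
      ((inDegree (-1)).map (ModuleCat.ofHom
        ((formsAct g).restrict (fun _ h => formsAct_closedForms g 2 h))))
      (biprod.map
        ((inDegree 0).map (ModuleCat.ofHom
          ((formsAct g).restrict (fun _ h => formsAct_kForms g 1 h))))
        ((inDegree 1).map (ModuleCat.ofHom
          ((formsAct g).restrict (fun _ h => formsAct_closedForms g 1 h))))))
end target

end HolomorphicString

end

/-!
The jets of `β` and `b` have positive `ℂ^×_cot`-weight, so the functions of weight `0` are the
polynomials in the jets of `γ` and `c`, and the theorem computes the cohomology of `Q = {S, -}` on
them. Write `γ_m = ∂_z^m γ⁰(0)` and `c_k = ∂_z^k c⁰(0)` for the holomorphic jets of the form degree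
zero components.

The ghost `c` is a gauge field for holomorphic vector fields, so these act trivially on cohomology:
the graded commutator of `Q` with the superderivation `∂/∂c_1` is the rotation generated by
`z ∂/∂z` (`bracket_dc_one_X`), just as that with `∂/∂c_0` is the translation `∂_z`. The
antiholomorphic rotation generated by `z̄ ∂/∂z̄` is homotopic to zero for a different reason: by the
Cartan formula for the Dolbeault operator it is the commutator of `Q` with a contraction
(`bracket_contr_one_X`). Monomials are eigenvectors of both rotations (`rot_mono`), and all
eigenvalues are real, so the two can be handled as one operator with coefficients `1` and `I`. On a
span of eigenvectors an operator is invertible up to its kernel, by an operator commuting with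
everything it commutes with (`exists_inverse_on_eigenvectors`). Hence every cocycle is cohomologous
to a rotation-invariant one (`exists_invariant_add_brst`).

The invariant functions are few. Antiholomorphic derivatives and form components have positive
`z̄`-weight and do not occur, and `c_0`, of `z`-weight `-1`, is the only remaining coordinate of
negative weight and squares to zero. For a polynomial `f` and a one-form `α` on `V`, pulled back
along `γ_0` with `dx ↦ γ_1`, this leaves (`invariantPart_le_normalPart`) the functions `f` in
degree `0`, `c_1 f + c_0 α` in degree `1`, `c_0 c_2 f + c_0 c_1 α` in degree `2` and
`c_0 c_1 c_2 f` in degree `3`. Among them the differential is the de Rham differential: `f ↦ c_0 df`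
and `c_1 f ↦ c_0 c_2 f + c_0 c_1 df`, and everything else is closed. The cohomology is therefore

* in degree `0`: constants, of which only zero is a reduced function;
* in degree `1`: one-forms modulo exact ones, which `c_0 α ↦ dα` identifies with `Ω²_cl(V)`;
* in degree `2`: `Ω¹(V)`, by `c_0 c_2 f + c_0 c_1 α ↦ α - df`;
* in degree `3`: all polynomials `f`, which the constant term and `df` identify with
  `ℂ ⊕ Ω¹_cl(V)`.

The identifications rest on the Poincaré lemma for polynomial forms (`exists_deRham_eq`), proved
with the contraction with the Euler vector field, again by `exists_inverse_on_eigenvectors`.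

The quasi-isomorphism is given on all functions, not only invariant ones, by extracting the
coefficients `f` and `α` with the derivations `∂/∂c_k` and `∂/∂γ_1` followed by restriction to
constant maps (`classOne`, `classTwo`, `topCoeff`). These maps vanish on functions of nonzero
rotation weight, hence on the image of the rotations; modulo that image every function of weight
`0` is invariant, so it is enough to check on the normal forms that they vanish on coboundaries
(`map_brst_eq_zero`). They are visibly `GL(V)`-equivariant.
-/

noncomputable section

namespace HolomorphicString

open scoped TensorProduct
open JetCoord

variable {V : Type u} [AddCommGroup V] [Module ℂ V]

/-! ### Superderivations and their commutators -/

/-- `D` is a derivation of degree `e` for the Koszul sign rule. -/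
def IsSuperDer (e : ℤ) (D : JetFun V →ₗ[ℂ] JetFun V) : Prop :=
  ∀ a b, D (a * b) = sgn e a * D b + D a * b

theorem IsSuperDer.map_one {e : ℤ} {D : JetFun V →ₗ[ℂ] JetFun V} (hD : IsSuperDer e D) :
    D 1 = 0 := by
  have := hD 1 1
  simpa using this

theorem IsSuperDer.X_mul {e : ℤ} {D : JetFun V →ₗ[ℂ] JetFun V} (hD : IsSuperDer e D)
    (x : JetCoord V) (a : JetFun V) :
    D (X x * a) = koszul e x.deg • (X x * D a) + D (X x) * a := by
  rw [hD, sgn_X, smul_mul_assoc]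

theorem IsSuperDer.add {e : ℤ} {D D' : JetFun V →ₗ[ℂ] JetFun V} (hD : IsSuperDer e D)
    (hD' : IsSuperDer e D') : IsSuperDer e (D + D') := fun a b => by
  simp only [LinearMap.add_apply, hD a b, hD' a b, mul_add, add_mul]; abel

theorem IsSuperDer.smul {e : ℤ} {D : JetFun V →ₗ[ℂ] JetFun V} (hD : IsSuperDer e D) (r : ℂ) :
    IsSuperDer e (r • D) := fun a b => by
  simp only [LinearMap.smul_apply, hD a b, smul_add, mul_smul_comm, smul_mul_assoc]

/-- Two linear maps with the same Leibniz rule on products `X x * a` agree on the monomials in the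
coordinates on which they agree. -/
theorem eq_on_mono_of_leibniz {P : JetCoord V → Prop} {s : JetCoord V → ℂ}
    {F G : JetFun V →ₗ[ℂ] JetFun V} (hF1 : F 1 = 0) (hG1 : G 1 = 0)
    (hF : ∀ x a, F (X x * a) = s x • (X x * F a) + F (X x) * a)
    (hG : ∀ x a, G (X x * a) = s x • (X x * G a) + G (X x) * a)
    (hX : ∀ x, P x → F (X x) = G (X x)) (l : List (JetCoord V)) (hl : ∀ x ∈ l, P x) :
    F (mono l) = G (mono l) := by
  induction l with
  | nil => simp [mono, hF1, hG1]
  | cons x l ih =>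
    rw [mono_cons, hF, hG, hX x (hl x (by simp)), ih fun y hy => hl y (by simp [hy])]

/-- A commutation relation `D ∂ = ∂ D + D'` between superderivations, where `∂` has degree `0` and
takes coordinates to coordinates, may be checked on coordinates. -/
theorem IsSuperDer.comm_of_X {e : ℤ} {D D' F : JetFun V →ₗ[ℂ] JetFun V} (hD : IsSuperDer e D)
    (hD' : IsSuperDer e D') (hF : IsSuperDer 0 F) (t : JetCoord V → JetCoord V)
    (ht : ∀ x, (t x).deg = x.deg) (hFt : ∀ x, F (X x) = X (t x))
    (h : ∀ x, D (X (t x)) = F (D (X x)) + D' (X x)) (a : JetFun V) :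
    D (F a) = F (D a) + D' a := by
  have : D ∘ₗ F - F ∘ₗ D = D' := by
    refine linearMap_ext_mono fun l => ?_
    refine eq_on_mono_of_leibniz (P := fun _ => True) (s := fun x => koszul e x.deg) ?_
      hD'.map_one ?_ hD'.X_mul ?_ l (by simp)
    · simp [hF.map_one, hD.map_one]
    · intro x a
      simp only [LinearMap.comp_apply, LinearMap.sub_apply, hF (X x), hF (D (X x)), sgn_zero,
        map_add, map_smul, hD.X_mul, hFt, ht]
      simp only [mul_sub, sub_mul, smul_add, smul_sub]; abel
    · intro x _
      simp [hFt, h]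
  rw [← LinearMap.congr_fun this a]
  simp

theorem superDer_isSuperDer (e : ℤ) (f : JetCoord V → JetFun V) (hf : Compatible f) (hc) :
    IsSuperDer e (superDer e f hf hc) := superDer_mul e f hf hc

theorem isSuperDer_Dz : IsSuperDer 0 (Dz (V := V)) :=
  superDer_isSuperDer _ _ _ _
theorem isSuperDer_Dzbar : IsSuperDer 0 (Dzbar (V := V)) :=
  superDer_isSuperDer _ _ _ _

theorem one_comm_deg_zero (p : ℤ) (hp : p = 0) (y : JetCoord V) (r : ℂ) :
    r • (1 : JetFun V) * X y = koszul p y.deg • (X y * r • 1) := by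
  subst hp; simp [koszul]

theorem smul_X_comm (r : ℂ) (x y : JetCoord V) (p : ℤ) (hp : p = x.deg) :
    r • X x * X y = koszul p y.deg • (X y * r • X x) := by
  subst hp; rw [smul_mul_assoc, X_comm, mul_smul_comm, smul_comm]

/-- The value of `∂/∂c_k` on coordinates, where `c_k` is the coordinate `∂_z^k c⁰(0)`. -/
def dcGen (k : ℕ) : JetCoord V → JetFun V
  | c 0 m 0 => (if m = k then 1 else 0 : ℂ) • 1
  | _ => 0

variable (V) in
/-- The superderivation `∂/∂c_k` of degree `-1`, where `c_k` is the coordinate `∂_z^k c⁰(0)`. -/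
def dc (k : ℕ) : JetFun V →ₗ[ℂ] JetFun V :=
  superDer (-1) (dcGen k) ⟨by simp [dcGen], by simp [dcGen], by simp [dcGen], by simp [dcGen]⟩ (by
    intro x y
    unfold dcGen
    split
    · exact one_comm_deg_zero _ (by simp [deg]) _ _
    · simp)

theorem dc_X (k : ℕ) (x : JetCoord V) : dc V k (X x) = dcGen k x := superDer_X ..

theorem isSuperDer_dc (k : ℕ) : IsSuperDer (-1) (dc V k) :=
  superDer_isSuperDer _ _ _ _

/-- The value of `∂/∂γ_1` in the direction `v`, on coordinates. -/
def dgGen (v : V) : JetCoord V → JetFun V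
  | gamma 0 1 0 l => l v • 1
  | _ => 0

/-- The derivation `∂/∂γ_1` in the direction `v`, where `γ_1` is the jet `∂_z γ⁰(0)`. -/
def dg (v : V) : JetFun V →ₗ[ℂ] JetFun V :=
  superDer 0 (dgGen v)
    ⟨fun j m n l l' => by
      fin_cases j <;> rcases m with _ | _ | m <;> rcases n with _ | n <;> simp [dgGen, add_smul],
     fun j m n a l => by
      fin_cases j <;> rcases m with _ | _ | m <;> rcases n with _ | n <;> simp [dgGen, mul_smul],
     by simp [dgGen], by simp [dgGen]⟩ (by
    intro x y
    unfold dgGen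
    split
    · exact one_comm_deg_zero _ (by simp [deg]) _ _
    · simp)

theorem dg_X (v : V) (x : JetCoord V) : dg v (X x) = dgGen v x := superDer_X ..

theorem isSuperDer_dg (v : V) : IsSuperDer 0 (dg v) :=
  superDer_isSuperDer _ _ _ _

/-- The value on coordinates of minus the contraction with `(z̄^k / k!) ∂/∂z̄`; only the fields
`γ` and `c` are contracted. -/
def contrGen (k : ℕ) : JetCoord V → JetFun V
  | gamma 0 m n l => (-(n.choose k : ℂ)) • X (gamma 1 m (n - k) l)
  | c 0 m n => (-(n.choose k : ℂ)) • X (c 1 m (n - k))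
  | _ => 0

variable (V) in
/-- The superderivation of degree `-1` induced by minus the contraction of the Dolbeault forms
`γ` and `c` with the antiholomorphic vector field `(z̄^k / k!) ∂/∂z̄`. -/
def contr (k : ℕ) : JetFun V →ₗ[ℂ] JetFun V :=
  superDer (-1) (contrGen k)
    ⟨fun j m n l l' => by
      fin_cases j <;> simp [contrGen, X_compatible.gamma_add],
     fun j m n a l => by
      fin_cases j <;> simp [contrGen, X_compatible.gamma_smul, smul_smul, mul_comm],
     by simp [contrGen], by simp [contrGen]⟩ (by
    intro x y
    unfold contrGen
    split
    · exact smul_X_comm _ _ _ _ (by simp [deg])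
    · exact smul_X_comm _ _ _ _ (by simp [deg])
    · simp)

theorem contr_X (k : ℕ) (x : JetCoord V) : contr V k (X x) = contrGen k x := superDer_X ..

theorem isSuperDer_contr (k : ℕ) : IsSuperDer (-1) (contr V k) :=
  superDer_isSuperDer _ _ _ _

theorem dc_zero_Dz (a : JetFun V) : dc V 0 (Dz a) = Dz (dc V 0 a) := by
  have := (isSuperDer_dc 0).comm_of_X (D' := 0) (fun _ _ => by simp) isSuperDer_Dz dz deg_dz Dz_X
    (fun x => ?_) a
  · simpa using this
  · simp only [dc_X, dcGen]
    rcases x with ⟨j, m, n, l⟩ | ⟨j, m, n, l⟩ | ⟨j, m, n⟩ | ⟨j, m, n⟩ <;> fin_cases j <;>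
      rcases n with _ | n <;> (simp [dz]; try split_ifs) <;>
        simp [isSuperDer_Dz.map_one]

theorem dc_succ_Dz (k : ℕ) (a : JetFun V) :
    dc V (k + 1) (Dz a) = Dz (dc V (k + 1) a) + dc V k a := by
  refine (isSuperDer_dc _).comm_of_X (isSuperDer_dc _) isSuperDer_Dz dz deg_dz Dz_X (fun x => ?_) a
  simp only [dc_X, dcGen]
  rcases x with ⟨j, m, n, l⟩ | ⟨j, m, n, l⟩ | ⟨j, m, n⟩ | ⟨j, m, n⟩ <;> fin_cases j <;>
    rcases n with _ | n <;> (simp [dz]; try split_ifs) <;>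
        simp [isSuperDer_Dz.map_one]

theorem dc_Dzbar (k : ℕ) (a : JetFun V) : dc V k (Dzbar a) = Dzbar (dc V k a) := by
  have := (isSuperDer_dc k).comm_of_X (D' := 0) (fun _ _ => by simp) isSuperDer_Dzbar dzbar
    deg_dzbar Dzbar_X (fun x => ?_) a
  · simpa using this
  · simp only [dc_X, dcGen]
    rcases x with ⟨j, m, n, l⟩ | ⟨j, m, n, l⟩ | ⟨j, m, n⟩ | ⟨j, m, n⟩ <;> fin_cases j <;>
      rcases n with _ | n <;> (simp [dzbar]; try split_ifs) <;>
        simp [isSuperDer_Dzbar.map_one]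

theorem contr_Dz (k : ℕ) (a : JetFun V) : contr V k (Dz a) = Dz (contr V k a) := by
  have := (isSuperDer_contr k).comm_of_X (D' := 0) (fun _ _ => by simp) isSuperDer_Dz dz
    deg_dz Dz_X (fun x => ?_) a
  · simpa using this
  · simp only [contr_X, contrGen]
    rcases x with ⟨j, m, n, l⟩ | ⟨j, m, n, l⟩ | ⟨j, m, n⟩ | ⟨j, m, n⟩ <;> fin_cases j <;>
      simp [dz]

theorem contr_zero_Dzbar (a : JetFun V) : contr V 0 (Dzbar a) = Dzbar (contr V 0 a) := by
  have := (isSuperDer_contr 0).comm_of_X (D' := 0) (fun _ _ => by simp) isSuperDer_Dzbar dzbar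
    deg_dzbar Dzbar_X (fun x => ?_) a
  · simpa using this
  · simp only [contr_X, contrGen]
    rcases x with ⟨j, m, n, l⟩ | ⟨j, m, n, l⟩ | ⟨j, m, n⟩ | ⟨j, m, n⟩ <;> fin_cases j <;>
      simp [dzbar]

theorem contr_succ_Dzbar (k : ℕ) (a : JetFun V) :
    contr V (k + 1) (Dzbar a) = Dzbar (contr V (k + 1) a) + contr V k a := by
  refine (isSuperDer_contr _).comm_of_X (isSuperDer_contr _) isSuperDer_Dzbar dzbar deg_dzbar
    Dzbar_X (fun x => ?_) a
  simp only [contr_X, contrGen]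
  have key (n : ℕ) (Y : ℕ → JetFun V) : (-((n + 1).choose (k + 1) : ℂ)) • Y (n + 1 - (k + 1)) =
      (-(n.choose (k + 1) : ℂ)) • Y (n - (k + 1) + 1) + (-(n.choose k : ℂ)) • Y (n - k) := by
    rw [Nat.choose_succ_succ, Nat.add_sub_add_right]
    rcases Nat.lt_or_ge n (k + 1) with h | h
    · simp [Nat.choose_eq_zero_of_lt h]
    · rw [show n - (k + 1) + 1 = n - k by omega]; push_cast; module
  rcases x with ⟨j, m, n, l⟩ | ⟨j, m, n, l⟩ | ⟨j, m, n⟩ | ⟨j, m, n⟩ <;> fin_cases j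
  · simpa [dzbar] using key n fun i => X (gamma 1 m i l)
  · simp [dzbar]
  · simp [dzbar]
  · simp [dzbar]
  · simpa [dzbar] using key n fun i => X (c 1 m i)
  · simp [dzbar]
  · simp [dzbar]
  · simp [dzbar]

/-! ### Rotations are homotopic to zero -/

/-- Coordinates of the fields `γ` and `c` are built from those of order zero by differentiation. -/
theorem coord_induction {P : JetCoord V → Prop} (hg : ∀ j l, P (gamma j 0 0 l))
    (hc : ∀ j, P (c j 0 0)) (hz : ∀ x, x.cotWeight = 0 → P x → P x.dz)
    (hzbar : ∀ x, x.cotWeight = 0 → P x → P x.dzbar) (x : JetCoord V) (hx : x.cotWeight = 0) :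
    P x := by
  rcases x with ⟨j, m, n, l⟩ | ⟨j, m, n, l⟩ | ⟨j, m, n⟩ | ⟨j, m, n⟩
  · induction m with
    | zero =>
      induction n with
      | zero => exact hg j l
      | succ n ih => exact hzbar (gamma j 0 n l) rfl (ih rfl)
    | succ m ih => exact hz (gamma j m n l) rfl (ih rfl)
  · simp [cotWeight] at hx
  · induction m with
    | zero =>
      induction n with
      | zero => exact hc j
      | succ n ih => exact hzbar (c j 0 n) rfl (ih rfl)
    | succ m ih => exact hz (c j m n) rfl (ih rfl)
  · simp [cotWeight] at hx

/-- The weight of a coordinate of `γ` or `c` under `z ↦ λ z`; the ghost `c` is a vector field. -/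
def JetCoord.zWeight : JetCoord V → ℤ
  | gamma _ m _ _ => m
  | c _ m _ => m - 1
  | _ => 0

/-- The weight of a coordinate of `γ` or `c` under `z̄ ↦ λ z̄`. -/
def JetCoord.zbarWeight : JetCoord V → ℕ
  | gamma j _ n _ => n + (j : ℕ)
  | c j _ n => n + (j : ℕ)
  | _ => 0

theorem sgn_dc_X (k : ℕ) (x : JetCoord V) :
    sgn 1 (dc V k (X x)) = -(koszul 1 x.deg) • dc V k (X x) := by
  rw [dc_X]
  unfold dcGen
  split
  · simp [deg, koszul]
  · simp

theorem sgn_contr_X (k : ℕ) (x : JetCoord V) :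
    sgn 1 (contr V k (X x)) = -(koszul 1 x.deg) • contr V k (X x) := by
  rw [contr_X]
  unfold contrGen
  split <;> simp [deg, koszul]

theorem dc_gammaJet (k : ℕ) (j : Fin 2) (l : Module.Dual ℂ V) : dc V k (gammaJet j l) = 0 := by
  simp [gammaJet, dc_X, dcGen]

theorem dc_cJet (k : ℕ) (j : Fin 2) :
    dc V k (cJet V j) = (if j = 0 ∧ k = 0 then 1 else 0 : ℂ) • 1 := by
  fin_cases j <;> rcases k with _ | k <;> simp [cJet, dc_X, dcGen]

theorem dc_Dz_gammaJet (k : ℕ) (j : Fin 2) (l : Module.Dual ℂ V) :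
    dc V k (Dz (gammaJet j l)) = 0 := by
  simp [gammaJet, dc_X, dcGen, dz]

theorem dc_Dz_cJet (k : ℕ) (j : Fin 2) :
    dc V k (Dz (cJet V j)) = (if j = 0 ∧ k = 1 then 1 else 0 : ℂ) • 1 := by
  fin_cases j <;> rcases k with _ | _ | k <;> simp [cJet, dc_X, dcGen, dz]

theorem contr_gammaJet (k : ℕ) (j : Fin 2) (l : Module.Dual ℂ V) : contr V k (gammaJet j l) =
    (if j = 0 ∧ k = 0 then -1 else 0 : ℂ) • gammaJet 1 l := by
  fin_cases j <;> rcases k with _ | k <;> simp [gammaJet, contr_X, contrGen]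

theorem contr_cJet (k : ℕ) (j : Fin 2) : contr V k (cJet V j) =
    (if j = 0 ∧ k = 0 then -1 else 0 : ℂ) • cJet V 1 := by
  fin_cases j <;> rcases k with _ | k <;> simp [cJet, contr_X, contrGen]

theorem sgn_cJet (e : ℤ) (j : Fin 2) : sgn e (cJet V j) = koszul e (1 - (j : ℕ)) • cJet V j := by
  simp [cJet, deg]

variable (V) in
/-- The homotopy for both rotations at once. As the weights are real, the combination with the
coefficient `I` loses nothing: the total weight vanishes only if both weights do. -/
def rotHomotopy : JetFun V →ₗ[ℂ] JetFun V := dc V 1 + Complex.I • contr V 1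

/-- The total weight `zWeight + I zbarWeight`. -/
def JetCoord.rotWeight (x : JetCoord V) : ℂ := zWeight x + zbarWeight x * Complex.I

theorem isSuperDer_rotHomotopy : IsSuperDer (-1) (rotHomotopy V) :=
  (isSuperDer_dc 1).add ((isSuperDer_contr 1).smul _)

section
variable [Module.Finite ℂ V]

variable (V) in
/-- The graded commutator of `Q = {S, -}` with an operator of odd degree. -/
def bracket (D : JetFun V →ₗ[ℂ] JetFun V) : JetFun V →ₗ[ℂ] JetFun V :=
  brst V ∘ₗ D + D ∘ₗ brst V

theorem bracket_apply (D : JetFun V →ₗ[ℂ] JetFun V) (a : JetFun V) :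
    bracket V D a = brst V (D a) + D (brst V a) := rfl

theorem brst_bracket (D : JetFun V →ₗ[ℂ] JetFun V) (a : JetFun V) :
    brst V (bracket V D a) = bracket V D (brst V a) := by
  simp [bracket_apply, brst_brst]

theorem brst_one : brst V 1 = 0 := IsSuperDer.map_one (e := 1) (superDer_isSuperDer _ _ _ _)

theorem bracket_one {D : JetFun V →ₗ[ℂ] JetFun V} (hD : IsSuperDer (-1) D) :
    bracket V D 1 = 0 := by simp [bracket_apply, hD.map_one, brst_one]

theorem bracket_X_mul {D : JetFun V →ₗ[ℂ] JetFun V} (hD : IsSuperDer (-1) D)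
    (hs : ∀ x, sgn 1 (D (X x)) = -(koszul 1 x.deg) • D (X x)) (x : JetCoord V) (a : JetFun V) :
    bracket V D (X x * a) = X x * bracket V D a + bracket V D (X x) * a := by
  have h1 : koszul (-1) x.deg = koszul 1 x.deg := by
    have h : koszul 1 x.deg = koszul (-1) x.deg * (koszul 1 x.deg * koszul 1 x.deg) := by
      rw [← koszul_add_left, ← koszul_add_left]; norm_num
    rw [koszul_mul_self, mul_one] at h
    exact h.symm
  have h2 : sgn (-1) (brst V (X x)) = -(koszul 1 x.deg) • brst V (X x) := by
    rw [brst_X, sgn_reducedPart (-1) (brstGen_mem x), koszul_add_right, h1]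
    simp [koszul]
  have h3 := koszul_mul_self 1 x.deg
  simp only [bracket_apply, brst_mul, hD (X x), hD (brst V (X x)), map_add, sgn_X, h1, h2,
    smul_mul_assoc, map_smul, hs, mul_add, add_mul, smul_add, smul_smul, h3, one_smul, neg_smul,
    neg_mul]
  abel

theorem bracket_dc_zero_Dz (a : JetFun V) :
    bracket V (dc V 0) (Dz a) = Dz (bracket V (dc V 0) a) := by
  simp [bracket_apply, dc_zero_Dz, brst_Dz]

theorem bracket_dc_one_Dz (a : JetFun V) :
    bracket V (dc V 1) (Dz a) = Dz (bracket V (dc V 1) a) + bracket V (dc V 0) a := by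
  simp only [bracket_apply, dc_succ_Dz, brst_Dz, map_add]; abel

theorem bracket_dc_Dzbar (k : ℕ) (a : JetFun V) :
    bracket V (dc V k) (Dzbar a) = Dzbar (bracket V (dc V k) a) := by
  simp [bracket_apply, dc_Dzbar, brst_Dzbar]

theorem bracket_contr_Dz (k : ℕ) (a : JetFun V) :
    bracket V (contr V k) (Dz a) = Dz (bracket V (contr V k) a) := by
  simp [bracket_apply, contr_Dz, brst_Dz]

theorem bracket_contr_zero_Dzbar (a : JetFun V) :
    bracket V (contr V 0) (Dzbar a) = Dzbar (bracket V (contr V 0) a) := by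
  simp [bracket_apply, contr_zero_Dzbar, brst_Dzbar]

theorem bracket_contr_one_Dzbar (a : JetFun V) :
    bracket V (contr V 1) (Dzbar a) =
      Dzbar (bracket V (contr V 1) a) + bracket V (contr V 0) a := by
  simp only [bracket_apply, contr_succ_Dzbar, brst_Dzbar, map_add]; abel

/-- `∂/∂c_0` is a homotopy between the translation `∂_z` and zero. -/
theorem bracket_dc_zero_X (x : JetCoord V) (hx : x.cotWeight = 0) :
    bracket V (dc V 0) (X x) = Dz (X x) := by
  refine coord_induction (P := fun x => bracket V (dc V 0) (X x) = Dz (X x)) ?_ ?_ ?_ ?_ x hx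
  · intro j l
    change bracket V _ (gammaJet j l) = Dz (gammaJet j l)
    fin_cases j <;> simp [bracket_apply, brst_gammaJet_zero, brst_gammaJet_one, dc_gammaJet,
      isSuperDer_dc 0 (cJet V _), dc_cJet, dc_Dz_gammaJet, dc_Dzbar]
  · intro j
    change bracket V _ (cJet V j) = Dz (cJet V j)
    fin_cases j <;> simp [bracket_apply, brst_cJet_zero, brst_cJet_one, brst_one,
      isSuperDer_dc 0 (cJet V _), dc_cJet, dc_Dz_cJet, dc_Dzbar, isSuperDer_Dzbar.map_one]
  · intro x _ h
    rw [← Dz_X, bracket_dc_zero_Dz, h]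
  · intro x _ h
    rw [← Dzbar_X, bracket_dc_Dzbar, h, Dz_Dzbar]

/-- The rotation of `z` is homotopic to zero, by `∂/∂c_1`. -/
theorem bracket_dc_one_X (x : JetCoord V) (hx : x.cotWeight = 0) :
    bracket V (dc V 1) (X x) = (zWeight x : ℂ) • X x := by
  refine coord_induction (P := fun x => bracket V (dc V 1) (X x) = (zWeight x : ℂ) • X x)
    ?_ ?_ ?_ ?_ x hx
  · intro j l
    change bracket V _ (gammaJet j l) = _
    fin_cases j <;> simp [bracket_apply, brst_gammaJet_zero, brst_gammaJet_one, dc_gammaJet,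
      isSuperDer_dc 1 (cJet V _), dc_cJet, dc_Dz_gammaJet, dc_Dzbar, zWeight]
  · intro j
    change bracket V _ (cJet V j) = (zWeight (c j 0 0 : JetCoord V) : ℂ) • cJet V j
    fin_cases j <;> simp [bracket_apply, brst_cJet_zero, brst_cJet_one,
      isSuperDer_dc 1 (cJet V _), dc_cJet, dc_Dz_cJet, dc_Dzbar, zWeight, sgn_cJet, koszul]
  · intro x hx h
    have : (zWeight x.dz : ℂ) = zWeight x + 1 := by
      cases x <;> simp_all [zWeight, dz, cotWeight]
    rw [← Dz_X, bracket_dc_one_Dz, h, bracket_dc_zero_X x hx, map_smul, this, add_smul, one_smul]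
  · intro x _ h
    have : zWeight x.dzbar = zWeight x := by cases x <;> rfl
    rw [← Dzbar_X, bracket_dc_Dzbar, h, map_smul, Dzbar_X, this]

/-- Contraction with `∂/∂z̄` is a homotopy between the translation `∂_z̄` and zero. -/
theorem bracket_contr_zero_X (x : JetCoord V) (hx : x.cotWeight = 0) :
    bracket V (contr V 0) (X x) = Dzbar (X x) := by
  refine coord_induction (P := fun x => bracket V (contr V 0) (X x) = Dzbar (X x)) ?_ ?_ ?_ ?_ x hx
  · intro j l
    change bracket V _ (gammaJet j l) = Dzbar (gammaJet j l)
    fin_cases j <;> simp [bracket_apply, brst_gammaJet_zero, brst_gammaJet_one, contr_gammaJet,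
      isSuperDer_contr 0 (cJet V _), contr_cJet, contr_Dz, contr_zero_Dzbar, sgn_cJet, koszul]
    abel
  · intro j
    change bracket V _ (cJet V j) = Dzbar (cJet V j)
    fin_cases j <;> simp [bracket_apply, brst_cJet_zero, brst_cJet_one,
      isSuperDer_contr 0 (cJet V _), contr_cJet, contr_Dz, contr_zero_Dzbar, sgn_cJet, koszul]
    abel
  · intro x _ h
    rw [← Dz_X, bracket_contr_Dz, h, Dz_Dzbar]
  · intro x _ h
    rw [← Dzbar_X, bracket_contr_zero_Dzbar, h]

/-- The rotation of `z̄` is homotopic to zero, by contraction with `z̄ ∂/∂z̄`. -/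
theorem bracket_contr_one_X (x : JetCoord V) (hx : x.cotWeight = 0) :
    bracket V (contr V 1) (X x) = (zbarWeight x : ℂ) • X x := by
  refine coord_induction (P := fun x => bracket V (contr V 1) (X x) = (zbarWeight x : ℂ) • X x)
    ?_ ?_ ?_ ?_ x hx
  · intro j l
    change bracket V _ (gammaJet j l) = (zbarWeight (gamma j 0 0 l) : ℂ) • gammaJet j l
    fin_cases j <;> simp [bracket_apply, brst_gammaJet_zero, brst_gammaJet_one, contr_gammaJet,
      isSuperDer_contr 1 (cJet V _), contr_cJet, contr_Dz, contr_succ_Dzbar, sgn_cJet, zbarWeight]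
  · intro j
    change bracket V _ (cJet V j) = (zbarWeight (c j 0 0 : JetCoord V) : ℂ) • cJet V j
    fin_cases j <;> simp [bracket_apply, brst_cJet_zero, brst_cJet_one,
      isSuperDer_contr 1 (cJet V _), contr_cJet, contr_Dz, contr_succ_Dzbar, sgn_cJet, zbarWeight]
  · intro x _ h
    have : zbarWeight x.dz = zbarWeight x := by cases x <;> rfl
    rw [← Dz_X, bracket_contr_Dz, h, map_smul, Dz_X, this]
  · intro x hx h
    have : (zbarWeight x.dzbar : ℂ) = zbarWeight x + 1 := by
      cases x <;> simp_all [zbarWeight, dzbar, cotWeight] <;> ring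
    rw [← Dzbar_X, bracket_contr_one_Dzbar, h, bracket_contr_zero_X x hx, map_smul, this, add_smul,
      one_smul]

variable (V) in
/-- The derivation `[Q, h]` for the homotopy `h`. -/
def rot : JetFun V →ₗ[ℂ] JetFun V := bracket V (rotHomotopy V)

theorem rot_apply (a : JetFun V) :
    rot V a = brst V (rotHomotopy V a) + rotHomotopy V (brst V a) := rfl

theorem brst_rot (a : JetFun V) : brst V (rot V a) = rot V (brst V a) := brst_bracket _ _

theorem rot_one : rot V 1 = 0 := bracket_one isSuperDer_rotHomotopy

theorem rot_X (x : JetCoord V) (hx : x.cotWeight = 0) : rot V (X x) = rotWeight x • X x := by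
  have : rot V (X x) = bracket V (dc V 1) (X x) + Complex.I • bracket V (contr V 1) (X x) := by
    simp only [rot, rotHomotopy, bracket_apply, LinearMap.add_apply, LinearMap.smul_apply, map_add,
      map_smul, smul_add]
    abel
  rw [this, bracket_dc_one_X x hx, bracket_contr_one_X x hx, smul_smul, ← add_smul, rotWeight,
    mul_comm]

theorem rot_X_mul (x : JetCoord V) (a : JetFun V) :
    rot V (X x * a) = X x * rot V a + rot V (X x) * a := by
  refine bracket_X_mul isSuperDer_rotHomotopy (fun x => ?_) x a
  simp only [rotHomotopy, LinearMap.add_apply, LinearMap.smul_apply, map_add, map_smul, sgn_dc_X,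
    sgn_contr_X, smul_add, smul_comm Complex.I]

/-- Monomials in the jets of `γ` and `c` are eigenvectors of the rotations. -/
theorem rot_mono (l : List (JetCoord V)) (hl : ∀ x ∈ l, x.cotWeight = 0) :
    rot V (mono l) = (l.map rotWeight).sum • mono l := by
  induction l with
  | nil => simp [mono, rot_one]
  | cons x l ih =>
    rw [mono_cons, rot_X_mul, ih fun y hy => hl y (by simp [hy]), rot_X x (hl x (by simp)),
      List.map_cons, List.sum_cons, add_smul, mul_smul_comm, smul_mul_assoc, add_comm]

end

/-! ### Inverting a diagonalisable operator away from its kernel -/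

/-- On the span of a set `S` of eigenvectors of `T`, the operator `T` has an inverse up to vectors
in its kernel. On each vector the inverse can be taken to be a polynomial `A` in `T`, hence commutes
with whatever commutes with `T` and preserves the subspaces that `T` preserves. -/
theorem exists_inverse_on_eigenvectors {M : Type*} [AddCommGroup M] [Module ℂ M]
    (T : Module.End ℂ M) (S : Set M) (hS : ∀ s ∈ S, ∃ r : ℂ, T s = r • s) {a : M}
    (ha : a ∈ Submodule.span ℂ S) :
    ∃ A : Module.End ℂ M, (∀ C : Module.End ℂ M, Commute C T → Commute C A) ∧
      (∀ N : Submodule ℂ M, (∀ x ∈ N, T x ∈ N) → ∀ x ∈ N, A x ∈ N) ∧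
      a - T (A a) ∈ Submodule.span ℂ {s ∈ S | T s = 0} := by
  induction ha using Submodule.span_induction with
  | mem s hs =>
    obtain ⟨r, hr⟩ := hS s hs
    rcases eq_or_ne r 0 with rfl | h
    · exact ⟨0, by simp, by simp, by
        simpa using Submodule.subset_span (R := ℂ) (s := {s ∈ S | T s = 0})
          ⟨hs, by simpa using hr⟩⟩
    · refine ⟨r⁻¹ • 1, fun C _ => (Commute.one_right C).smul_right _, fun N _ x hx => ?_, ?_⟩
      · simpa using N.smul_mem _ hx
      · simp [hr, smul_smul, h]
  | zero => exact ⟨0, by simp, by simp, by simp⟩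
  | smul r a _ ih =>
    obtain ⟨A, h1, h2, h3⟩ := ih
    refine ⟨A, h1, h2, ?_⟩
    simpa [smul_sub] using Submodule.smul_mem _ r h3
  | add a b _ _ iha ihb =>
    obtain ⟨A, hA1, hA2, hA3⟩ := iha
    obtain ⟨B, hB1, hB2, hB3⟩ := ihb
    have hT : ∀ u ∈ Submodule.span ℂ {s ∈ S | T s = 0}, T u = 0 := by
      intro u hu
      have : Submodule.span ℂ {s ∈ S | T s = 0} ≤ LinearMap.ker T :=
        Submodule.span_le.mpr fun s hs => hs.2
      exact this hu
    have hTA : ∀ x, T (A x) = A (T x) := fun x => LinearMap.congr_fun (hA1 T (Commute.refl T)).eq x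
    have hTB : ∀ x, T (B x) = B (T x) := fun x => LinearMap.congr_fun (hB1 T (Commute.refl T)).eq x
    have hAB : ∀ x, A (B x) = B (A x) := fun x =>
      LinearMap.congr_fun (hB1 A (hA1 T (Commute.refl T)).symm).eq x
    -- `1 - T (A + B - T A B) = (1 - T A) (1 - T B)`
    refine ⟨A + B - T * (A * B), fun C hC => ?_, fun N hN x hx => ?_, ?_⟩
    · exact ((hA1 C hC).add_right (hB1 C hC)).sub_right
        (hC.mul_right ((hA1 C hC).mul_right (hB1 C hC)))
    · exact sub_mem (add_mem (hA2 N hN x hx) (hB2 N hN x hx)) (hN _ (hA2 N hN _ (hB2 N hN x hx)))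
    · have ha := hT _ hA3
      have hb := hT _ hB3
      convert add_mem hA3 hB3 using 1
      have ea : T (B (a - T (A a))) = 0 := by rw [hTB, ha, map_zero]
      have eb : T (A (b - T (B b))) = 0 := by rw [hTA, hb, map_zero]
      simp only [map_sub, sub_eq_zero] at ea eb
      simp only [LinearMap.sub_apply, LinearMap.add_apply, Module.End.mul_apply, map_add, map_sub]
      rw [eb, ea, hAB a, ← hTB (A a), ← hTA (B b)]
      abel

/-! ### Reduction to rotation-invariant functions -/

variable (V) in
/-- The span of the nonempty monomials of degree `p` in the jets of `γ` and `c` that are invariant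
under both rotations. -/
def invariantPart (p : ℤ) : Submodule ℂ (JetFun V) :=
  Submodule.span ℂ {a | ∃ l : List (JetCoord V), l ≠ [] ∧ (∀ x ∈ l, x.cotWeight = 0) ∧
    (l.map deg).sum = p ∧ (l.map rotWeight).sum = 0 ∧ a = mono l}

theorem cotWeight_sum_eq_zero {l : List (JetCoord V)} (h : (l.map cotWeight).sum = 0) :
    ∀ x ∈ l, x.cotWeight = 0 := by
  intro x hx
  have := List.sum_eq_zero_iff.mp h
  exact this _ (List.mem_map_of_mem hx)

/-- The span of the monomials of total weight `r`, for a weight `w` on the coordinates. -/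
def gradedPart {A : Type*} [AddCommMonoid A] (w : JetCoord V → A) (r : A) :
    Submodule ℂ (JetFun V) :=
  Submodule.span ℂ {a | ∃ l : List (JetCoord V), (l.map w).sum = r ∧ a = mono l}

section
variable {A : Type*} [AddCommMonoid A] {w : JetCoord V → A}

theorem mono_mem_gradedPart (w : JetCoord V → A) (l : List (JetCoord V)) :
    mono l ∈ gradedPart w (l.map w).sum := Submodule.subset_span ⟨l, rfl, rfl⟩

theorem X_mem_gradedPart (w : JetCoord V → A) (x : JetCoord V) : X x ∈ gradedPart w (w x) := by
  simpa [mono] using mono_mem_gradedPart w [x]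

theorem one_mem_gradedPart (w : JetCoord V → A) : 1 ∈ gradedPart w 0 := by
  simpa [mono] using mono_mem_gradedPart w []

theorem mem_gradedPart_of_eq {p q : A} {a : JetFun V} (ha : a ∈ gradedPart w p) (h : p = q) :
    a ∈ gradedPart w q := h ▸ ha

theorem mul_mem_gradedPart {p q : A} {a b : JetFun V} (ha : a ∈ gradedPart w p)
    (hb : b ∈ gradedPart w q) : a * b ∈ gradedPart w (p + q) := by
  have := Submodule.mul_mem_mul ha hb
  rw [gradedPart, gradedPart, Submodule.span_mul_span] at this
  refine Submodule.span_mono ?_ this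
  rintro _ ⟨_, ⟨l, rfl, rfl⟩, _, ⟨l', rfl, rfl⟩, rfl⟩
  exact ⟨l ++ l', by simp, (mono_append l l').symm⟩

/-- A superderivation that shifts the weight of the coordinates by `s` does so for all functions. -/
theorem IsSuperDer.mem_gradedPart {e : ℤ} {D : JetFun V →ₗ[ℂ] JetFun V} (hD : IsSuperDer e D)
    {s : A} (hX : ∀ x : JetCoord V, D (X x) ∈ gradedPart w (w x + s)) {p : A}
    {a : JetFun V} (ha : a ∈ gradedPart w p) : D a ∈ gradedPart w (p + s) := by
  induction ha using Submodule.span_induction with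
  | mem a h =>
    obtain ⟨l, rfl, rfl⟩ := h
    induction l with
    | nil => simp [mono, hD.map_one]
    | cons x l ih =>
      rw [mono_cons, hD.X_mul, List.map_cons, List.sum_cons]
      refine add_mem (Submodule.smul_mem _ _ ?_) ?_
      · rw [add_assoc]; exact mul_mem_gradedPart (X_mem_gradedPart w x) ih
      · rw [add_right_comm]; exact mul_mem_gradedPart (hX x) (mono_mem_gradedPart w l)
  | zero => simp
  | add a b _ _ iha ihb => rw [map_add]; exact add_mem iha ihb
  | smul r a _ ih => rw [map_smul]; exact Submodule.smul_mem _ _ ih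

end

variable (V) in
/-- The functions of degree `p` and `ℂ^×_cot`-weight `0`, including the constants if `p = 0`. -/
def homogeneousPart (p : ℤ) : Submodule ℂ (JetFun V) :=
  gradedPart (fun x => (x.deg, x.cotWeight)) (p, 0)

theorem sum_deg_cotWeight (l : List (JetCoord V)) :
    (l.map fun x => (x.deg, x.cotWeight)).sum = ((l.map deg).sum, (l.map cotWeight).sum) := by
  induction l with
  | nil => rfl
  | cons x l ih => simp [ih]

theorem reducedPart_le_homogeneousPart (p : ℤ) : reducedPart V p 0 ≤ homogeneousPart V p :=
  Submodule.span_mono fun _ ⟨l, _, h1, h2, h3⟩ => ⟨l, by rw [sum_deg_cotWeight, h1, h2], h3⟩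

theorem homogeneousPart_le (p : ℤ) :
    homogeneousPart V p ≤ reducedPart V p 0 ⊔ Submodule.span ℂ {1} := by
  refine Submodule.span_le.mpr ?_
  rintro _ ⟨l, h, rfl⟩
  rw [sum_deg_cotWeight, Prod.mk.injEq] at h
  rcases eq_or_ne l [] with rfl | hl
  · exact Submodule.mem_sup_right (Submodule.subset_span (by simp [mono]))
  · exact Submodule.mem_sup_left (Submodule.subset_span ⟨l, hl, h.1, h.2, rfl⟩)

theorem homogeneousPart_le_reducedPart {p : ℤ} (hp : p ≠ 0) :
    homogeneousPart V p ≤ reducedPart V p 0 := by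
  refine Submodule.span_le.mpr ?_
  rintro _ ⟨l, h, rfl⟩
  rw [sum_deg_cotWeight, Prod.mk.injEq] at h
  refine Submodule.subset_span ⟨l, ?_, h.1, h.2, rfl⟩
  rintro rfl
  exact hp (by simpa using h.1.symm)

theorem rotHomotopy_mem {p : ℤ} {a : JetFun V} (ha : a ∈ homogeneousPart V p) :
    rotHomotopy V a ∈ homogeneousPart V (p - 1) := by
  have := isSuperDer_rotHomotopy.mem_gradedPart (s := ((-1, 0) : ℤ × ℕ)) (fun x => ?_) ha
  · exact this
  simp only [rotHomotopy, LinearMap.add_apply, LinearMap.smul_apply, dc_X, contr_X]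
  refine add_mem ?_ (Submodule.smul_mem _ _ ?_)
  · unfold dcGen
    split
    · exact Submodule.smul_mem _ _
        (mem_gradedPart_of_eq (one_mem_gradedPart _) (by simp [deg, cotWeight]; rfl))
    · exact zero_mem _
  · unfold contrGen
    split
    · exact Submodule.smul_mem _ _
        (mem_gradedPart_of_eq (X_mem_gradedPart _ _) (by simp [deg, cotWeight]))
    · exact Submodule.smul_mem _ _
        (mem_gradedPart_of_eq (X_mem_gradedPart _ _) (by simp [deg, cotWeight]))
    · exact zero_mem _

section
variable [Module.Finite ℂ V]

/-- Every function of weight `0` is rotation-invariant up to the image of `rot`; the preimage can be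
taken closed if the function is closed. -/
theorem exists_invariant_add_rot {p : ℤ} {a : JetFun V} (ha : a ∈ reducedPart V p 0) :
    ∃ b ∈ reducedPart V p 0, a - rot V b ∈ invariantPart V p ∧
      (brst V a = 0 → brst V b = 0) := by
  set S : Set (JetFun V) := {a | ∃ l : List (JetCoord V), l ≠ [] ∧ (l.map deg).sum = p ∧
    (l.map cotWeight).sum = 0 ∧ a = mono l} with hS
  have hrot : ∀ s ∈ S, ∃ r : ℂ, rot V s = r • s := by
    rintro _ ⟨l, -, -, hw, rfl⟩
    exact ⟨_, rot_mono l (cotWeight_sum_eq_zero hw)⟩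
  have hst : ∀ x ∈ reducedPart V p 0, rot V x ∈ reducedPart V p 0 := by
    have : reducedPart V p 0 ≤ (reducedPart V p 0).comap (rot V) :=
      Submodule.span_le.mpr fun s hs => by
        obtain ⟨r, hr⟩ := hrot s hs
        simp only [SetLike.mem_coe, Submodule.mem_comap, hr]
        exact Submodule.smul_mem _ _ (Submodule.subset_span hs)
    exact this
  obtain ⟨A, hA1, hA2, hA3⟩ := exists_inverse_on_eigenvectors (rot V) S hrot ha
  refine ⟨A a, hA2 _ hst a ha, ?_, fun h => ?_⟩
  · have : Submodule.span ℂ {s ∈ S | rot V s = 0} ≤ invariantPart V p := by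
      refine Submodule.span_le.mpr ?_
      rintro _ ⟨⟨l, hl, hp, hw, rfl⟩, h0⟩
      rw [rot_mono l (cotWeight_sum_eq_zero hw), smul_eq_zero] at h0
      rcases h0 with h0 | h0
      · exact Submodule.subset_span ⟨l, hl, cotWeight_sum_eq_zero hw, hp, h0, rfl⟩
      · rw [h0]; exact zero_mem _
    exact this hA3
  · have hc : Commute (brst V : Module.End ℂ (JetFun V)) (rot V) := LinearMap.ext brst_rot
    have : brst V (A a) = A (brst V a) := LinearMap.congr_fun (hA1 _ hc).eq a
    rw [this, h, map_zero]

/-- Every cocycle of weight `0` is cohomologous to a rotation-invariant one. -/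
theorem exists_invariant_add_brst {p : ℤ} {a : JetFun V} (ha : a ∈ reducedPart V p 0)
    (h : brst V a = 0) :
    ∃ b ∈ reducedPart V (p - 1) 0, a - brst V b ∈ invariantPart V p := by
  obtain ⟨b, hb, h1, h2⟩ := exists_invariant_add_rot ha
  obtain ⟨u, hu, v, hv, huv⟩ := Submodule.mem_sup.mp
    (homogeneousPart_le _ (rotHomotopy_mem (reducedPart_le_homogeneousPart _ hb)))
  obtain ⟨r, rfl⟩ := Submodule.mem_span_singleton.mp hv
  -- `h b` may have a constant term, as `∂/∂c_1` maps `c_1` to `1`; it is discarded since `Q 1 = 0`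
  refine ⟨u, hu, ?_⟩
  have : rot V b = brst V u := by
    rw [rot_apply, h2 h, map_zero, add_zero, ← huv, map_add, map_smul, brst_one, smul_zero,
      add_zero]
  rwa [← this]

end

/-! ### The Poincaré lemma for polynomial forms -/

/-- The product of a list of linear functions. -/
def symProd (m : List (Module.Dual ℂ V)) : Poly V := (m.map (SymmetricAlgebra.ι ℂ _)).prod

/-- The exterior product of a list of covectors. -/
def extProd (l : List (Module.Dual ℂ V)) : ExteriorAlgebra ℂ (Module.Dual ℂ V) :=
  (l.map (ExteriorAlgebra.ι ℂ)).prod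

theorem symProd_cons (a : Module.Dual ℂ V) (m : List (Module.Dual ℂ V)) :
    symProd (a :: m) = SymmetricAlgebra.ι ℂ _ a * symProd m := by simp [symProd]

theorem extProd_cons (a : Module.Dual ℂ V) (m : List (Module.Dual ℂ V)) :
    extProd (a :: m) = ExteriorAlgebra.ι ℂ a * extProd m := by simp [extProd]

theorem span_symProd : Submodule.span ℂ (Set.range (symProd (V := V))) = ⊤ := by
  rw [eq_top_iff]
  rintro f -
  induction f using SymmetricAlgebra.induction with
  | algebraMap r =>
    rw [Algebra.algebraMap_eq_smul_one]
    exact Submodule.smul_mem _ _ (Submodule.subset_span ⟨[], by simp [symProd]⟩)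
  | ι x => exact Submodule.subset_span ⟨[x], by simp [symProd]⟩
  | add a b ha hb => exact add_mem ha hb
  | mul a b ha hb =>
    have := Submodule.mul_mem_mul ha hb
    rw [Submodule.span_mul_span] at this
    refine Submodule.span_mono ?_ this
    rintro _ ⟨_, ⟨l, rfl⟩, _, ⟨l', rfl⟩, rfl⟩
    exact ⟨l ++ l', by simp [symProd]⟩

theorem ι_mul_mem_exteriorPower {k : ℕ} (a : Module.Dual ℂ V)
    {η : ExteriorAlgebra ℂ (Module.Dual ℂ V)} (hη : η ∈ ⋀[ℂ]^k (Module.Dual ℂ V)) :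
    ExteriorAlgebra.ι ℂ a * η ∈ ⋀[ℂ]^(k + 1) (Module.Dual ℂ V) := by
  change _ ∈ LinearMap.range (ExteriorAlgebra.ι ℂ) ^ (k + 1)
  rw [pow_succ']
  exact Submodule.mul_mem_mul ⟨a, rfl⟩ hη

theorem extProd_mem (l : List (Module.Dual ℂ V)) :
    extProd l ∈ ⋀[ℂ]^l.length (Module.Dual ℂ V) := by
  induction l with
  | nil => simp [extProd]
  | cons a l ih =>
    rw [extProd_cons, List.length_cons]
    exact ι_mul_mem_exteriorPower a ih

theorem exteriorPower_eq_span (k : ℕ) : (⋀[ℂ]^k (Module.Dual ℂ V) : Submodule ℂ _) =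
    Submodule.span ℂ {η | ∃ l : List (Module.Dual ℂ V), l.length = k ∧ η = extProd l} := by
  refine le_antisymm ?_ (Submodule.span_le.mpr ?_)
  · induction k with
    | zero =>
      change LinearMap.range (ExteriorAlgebra.ι ℂ) ^ 0 ≤ _
      rw [pow_zero, Submodule.one_le]
      exact Submodule.subset_span ⟨[], rfl, by simp [extProd]⟩
    | succ k ih =>
      change LinearMap.range (ExteriorAlgebra.ι ℂ) ^ (k + 1) ≤ _
      rw [pow_succ']
      refine Submodule.mul_le.mpr ?_
      rintro _ ⟨a, rfl⟩ y hy
      have : Submodule.span ℂ {η | ∃ l : List (Module.Dual ℂ V), l.length = k ∧ η = extProd l} ≤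
          (Submodule.span ℂ {η | ∃ l : List (Module.Dual ℂ V), l.length = k + 1 ∧
            η = extProd l}).comap (LinearMap.mulLeft ℂ (ExteriorAlgebra.ι ℂ a)) := by
        refine Submodule.span_le.mpr ?_
        rintro _ ⟨l, hl, rfl⟩
        exact Submodule.subset_span ⟨a :: l, by simp [hl], by simp [extProd_cons]⟩
      exact this (ih hy)
  · rintro _ ⟨l, rfl, rfl⟩
    exact extProd_mem l

theorem tmul_mem_kForms {k : ℕ} (f : Poly V) {η : ExteriorAlgebra ℂ (Module.Dual ℂ V)}
    (hη : η ∈ ⋀[ℂ]^k (Module.Dual ℂ V)) : f ⊗ₜ[ℂ] η ∈ kForms V k :=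
  ⟨f ⊗ₜ ⟨η, hη⟩, by simp⟩

/-- The `k`-forms that are products of linear functions and `k` constant one-forms. -/
def monomialForms (V : Type u) [AddCommGroup V] [Module ℂ V] (k : ℕ) : Set (Forms V) :=
  {ω | ∃ m l : List (Module.Dual ℂ V), l.length = k ∧ ω = symProd m ⊗ₜ[ℂ] extProd l}

theorem kForms_eq_span (k : ℕ) : kForms V k = Submodule.span ℂ (monomialForms V k) := by
  refine le_antisymm ?_ (Submodule.span_le.mpr ?_)
  · rintro _ ⟨ω, rfl⟩
    induction ω using TensorProduct.induction_on with
    | zero => simp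
    | add x y hx hy => rw [map_add]; exact add_mem hx hy
    | tmul f η =>
      obtain ⟨η, hη⟩ := η
      have hη' := hη
      rw [exteriorPower_eq_span] at hη'
      have hf : f ∈ Submodule.span ℂ (Set.range (symProd (V := V))) := by simp [span_symProd]
      have := Submodule.apply_mem_map₂
        (TensorProduct.mk ℂ (Poly V) (ExteriorAlgebra ℂ (Module.Dual ℂ V))) hf hη'
      rw [Submodule.map₂_span_span] at this
      refine Submodule.span_mono ?_ this
      rintro _ ⟨_, ⟨m, rfl⟩, _, ⟨l, hl, rfl⟩, rfl⟩
      exact ⟨m, l, hl, rfl⟩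
  · rintro _ ⟨m, l, rfl, rfl⟩
    exact tmul_mem_kForms _ (extProd_mem l)

theorem contractLeft_extProd_mem (d : Module.Dual ℂ (Module.Dual ℂ V)) (k : ℕ)
    (l : List (Module.Dual ℂ V)) (hl : l.length = k + 1) :
    CliffordAlgebra.contractLeft d (extProd l) ∈ ⋀[ℂ]^k (Module.Dual ℂ V) := by
  induction l generalizing k with
  | nil => simp at hl
  | cons a l ih =>
    simp only [List.length_cons, Nat.add_right_cancel_iff] at hl
    rw [extProd_cons, ExteriorAlgebra.ι, CliffordAlgebra.contractLeft_ι_mul]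
    refine sub_mem (Submodule.smul_mem _ _ (hl ▸ extProd_mem l)) ?_
    rcases k with _ | k
    · obtain rfl := List.eq_nil_of_length_eq_zero hl
      have : CliffordAlgebra.contractLeft d (extProd ([] : List (Module.Dual ℂ V))) = 0 := by
        simp [extProd]
      rw [this, mul_zero]; exact zero_mem _
    · exact ι_mul_mem_exteriorPower a (ih k hl)

theorem polyDeriv_comm (v w : V) (f : Poly V) :
    polyDeriv v (polyDeriv w f) = polyDeriv w (polyDeriv v f) := by
  induction f using SymmetricAlgebra.induction with
  | algebraMap r => simp [polyDeriv_algebraMap]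
  | ι l => simp [polyDeriv_ι, polyDeriv_algebraMap]
  | mul f f' h h' => simp only [polyDeriv_mul, map_add, h, h']; ring
  | add f f' h h' => simp only [map_add, h, h']

theorem one_mem_kForms_zero (f : Poly V) : f ⊗ₜ[ℂ] 1 ∈ kForms V 0 :=
  tmul_mem_kForms f (by simp)

theorem exists_eq_tmul_one {ω : Forms V} (hω : ω ∈ kForms V 0) : ∃ f : Poly V, ω = f ⊗ₜ 1 := by
  rw [kForms_eq_span] at hω
  induction hω using Submodule.span_induction with
  | mem _ h =>
    obtain ⟨m, l, hl, rfl⟩ := h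
    obtain rfl := List.eq_nil_of_length_eq_zero hl
    exact ⟨symProd m, by simp [extProd]⟩
  | zero => exact ⟨0, by simp⟩
  | add _ _ _ _ h h' =>
    obtain ⟨f, rfl⟩ := h
    obtain ⟨f', rfl⟩ := h'
    exact ⟨f + f', by rw [TensorProduct.add_tmul]⟩
  | smul r _ _ h =>
    obtain ⟨f, rfl⟩ := h
    exact ⟨r • f, by rw [TensorProduct.smul_tmul']⟩

section
variable [Module.Finite ℂ V]

theorem map_eq_sum_coord {M : Type*} [AddCommGroup M] [Module ℂ M] (T : Module.Dual ℂ V →ₗ[ℂ] M)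
    (a : Module.Dual ℂ V) :
    T a = ∑ i, a (Module.finBasis ℂ V i) • T ((Module.finBasis ℂ V).coord i) := by
  conv_lhs => rw [← (Module.finBasis ℂ V).sum_dual_apply_smul_coord a]
  rw [map_sum]
  exact Finset.sum_congr rfl fun i _ => map_smul _ _ _

theorem deRham_tmul (f : Poly V) (η : ExteriorAlgebra ℂ (Module.Dual ℂ V)) :
    deRham V (f ⊗ₜ η) = ∑ i, polyDeriv (Module.finBasis ℂ V i) f ⊗ₜ[ℂ]
      (ExteriorAlgebra.ι ℂ ((Module.finBasis ℂ V).coord i) * η) := by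
  simp [deRham, LinearMap.sum_apply]

theorem deRham_deRham (ω : Forms V) : deRham V (deRham V ω) = 0 := by
  induction ω using TensorProduct.induction_on with
  | zero => simp
  | add x y hx hy => rw [map_add, map_add, hx, hy, add_zero]
  | tmul f η =>
    have h : deRham V (deRham V (f ⊗ₜ η)) = -deRham V (deRham V (f ⊗ₜ η)) := by
      simp only [deRham_tmul, map_sum]
      conv_rhs => rw [Finset.sum_comm]
      simp only [← Finset.sum_neg_distrib]
      refine Finset.sum_congr rfl fun i _ => Finset.sum_congr rfl fun j _ => ?_
      rw [polyDeriv_comm, ← mul_assoc, ← mul_assoc,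
        eq_neg_of_add_eq_zero_left (ExteriorAlgebra.ι_add_mul_swap _ _), neg_mul,
        TensorProduct.tmul_neg]
    have h2 : (2 : ℂ) • deRham V (deRham V (f ⊗ₜ η)) = 0 := by
      rw [two_smul]
      nth_rewrite 1 [h]
      exact neg_add_cancel _
    exact (smul_eq_zero.mp h2).resolve_left two_ne_zero

theorem deRham_mem {k : ℕ} {ω : Forms V} (hω : ω ∈ kForms V k) : deRham V ω ∈ kForms V (k + 1) := by
  have : kForms V k ≤ (kForms V (k + 1)).comap (deRham V) := by
    rw [kForms_eq_span k]
    refine Submodule.span_le.mpr ?_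
    rintro _ ⟨m, l, rfl, rfl⟩
    rw [SetLike.mem_coe, Submodule.mem_comap, deRham_tmul]
    exact sum_mem fun i _ => tmul_mem_kForms _ (extProd_cons _ l ▸ extProd_mem (_ :: l))
  exact this hω

variable (V) in
/-- The contraction of polynomial forms with the Euler vector field `∑ xᵢ ∂/∂xᵢ`. -/
def eulerContraction : Forms V →ₗ[ℂ] Forms V :=
  ∑ i, TensorProduct.map
    (LinearMap.mulLeft ℂ (SymmetricAlgebra.ι ℂ _ ((Module.finBasis ℂ V).coord i)))
    (CliffordAlgebra.contractLeft (Module.Dual.eval ℂ V (Module.finBasis ℂ V i)))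

theorem eulerContraction_tmul (f : Poly V) (η : ExteriorAlgebra ℂ (Module.Dual ℂ V)) :
    eulerContraction V (f ⊗ₜ η) =
      ∑ i, (SymmetricAlgebra.ι ℂ _ ((Module.finBasis ℂ V).coord i) * f) ⊗ₜ[ℂ]
        CliffordAlgebra.contractLeft (Module.Dual.eval ℂ V (Module.finBasis ℂ V i)) η := by
  simp [eulerContraction, LinearMap.sum_apply]

theorem eulerContraction_mem {k : ℕ} {ω : Forms V} (hω : ω ∈ kForms V (k + 1)) :
    eulerContraction V ω ∈ kForms V k := by
  have : kForms V (k + 1) ≤ (kForms V k).comap (eulerContraction V) := by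
    rw [kForms_eq_span (k + 1)]
    refine Submodule.span_le.mpr ?_
    rintro _ ⟨m, l, hl, rfl⟩
    rw [SetLike.mem_coe, Submodule.mem_comap, eulerContraction_tmul]
    exact sum_mem fun i _ => tmul_mem_kForms _ (contractLeft_extProd_mem _ k l hl)
  exact this hω

variable (V) in
/-- The Euler vector field `∑ xᵢ ∂/∂xᵢ` on polynomial functions. -/
def eulerPoly : Poly V →ₗ[ℂ] Poly V :=
  ∑ i, LinearMap.mulLeft ℂ (SymmetricAlgebra.ι ℂ _ ((Module.finBasis ℂ V).coord i)) ∘ₗ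
    polyDeriv (Module.finBasis ℂ V i)

theorem eulerPoly_apply (f : Poly V) : eulerPoly V f =
    ∑ i, SymmetricAlgebra.ι ℂ _ ((Module.finBasis ℂ V).coord i) *
      polyDeriv (Module.finBasis ℂ V i) f := by
  simp [eulerPoly, LinearMap.sum_apply]

theorem eulerPoly_symProd (m : List (Module.Dual ℂ V)) :
    eulerPoly V (symProd m) = (m.length : ℂ) • symProd m := by
  induction m with
  | nil =>
    have h (v : V) : polyDeriv v (1 : Poly V) = 0 := by
      simpa using polyDeriv_algebraMap v (1 : ℂ)
    simp [eulerPoly_apply, symProd, h]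
  | cons a m ih =>
    have h : SymmetricAlgebra.ι ℂ (Module.Dual ℂ V) a = ∑ i, a (Module.finBasis ℂ V i) •
        SymmetricAlgebra.ι ℂ _ ((Module.finBasis ℂ V).coord i) := map_eq_sum_coord _ a
    have h' : eulerPoly V (SymmetricAlgebra.ι ℂ _ a * symProd m) =
        SymmetricAlgebra.ι ℂ _ a * eulerPoly V (symProd m) +
          (∑ i, a (Module.finBasis ℂ V i) •
            SymmetricAlgebra.ι ℂ _ ((Module.finBasis ℂ V).coord i)) * symProd m := by
      simp only [eulerPoly_apply, polyDeriv_mul, polyDeriv_ι, Finset.mul_sum, Finset.sum_mul,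
        ← Finset.sum_add_distrib, Algebra.smul_def]
      exact Finset.sum_congr rfl fun i _ => by ring
    rw [symProd_cons, h', ← h, ih, List.length_cons, mul_smul_comm]
    push_cast
    rw [add_smul, one_smul]

theorem sum_coord_mul_contractLeft_extProd (l : List (Module.Dual ℂ V)) :
    ∑ i, ExteriorAlgebra.ι ℂ ((Module.finBasis ℂ V).coord i) *
      CliffordAlgebra.contractLeft (Module.Dual.eval ℂ V (Module.finBasis ℂ V i)) (extProd l) =
    (l.length : ℂ) • extProd l := by
  induction l with
  | nil => simp [extProd]
  | cons a l ih =>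
    have h : ExteriorAlgebra.ι ℂ a = ∑ i, a (Module.finBasis ℂ V i) •
        ExteriorAlgebra.ι ℂ ((Module.finBasis ℂ V).coord i) := map_eq_sum_coord _ a
    have h' : ∀ i, ExteriorAlgebra.ι ℂ ((Module.finBasis ℂ V).coord i) *
        CliffordAlgebra.contractLeft (Module.Dual.eval ℂ V (Module.finBasis ℂ V i))
          (extProd (a :: l)) =
        (a (Module.finBasis ℂ V i) • ExteriorAlgebra.ι ℂ ((Module.finBasis ℂ V).coord i)) *
          extProd l + ExteriorAlgebra.ι ℂ a * (ExteriorAlgebra.ι ℂ ((Module.finBasis ℂ V).coord i) *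
        CliffordAlgebra.contractLeft (Module.Dual.eval ℂ V (Module.finBasis ℂ V i))
          (extProd l)) := by
      intro i
      have hs := eq_neg_of_add_eq_zero_left
        (ExteriorAlgebra.ι_add_mul_swap (R := ℂ) a ((Module.finBasis ℂ V).coord i))
      have hc := CliffordAlgebra.contractLeft_ι_mul (Q := (0 : QuadraticForm ℂ (Module.Dual ℂ V)))
        (Module.Dual.eval ℂ V (Module.finBasis ℂ V i)) a (extProd l)
      rw [extProd_cons, ExteriorAlgebra.ι, hc, ← ExteriorAlgebra.ι, ← mul_assoc, hs, mul_sub,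
        neg_mul, mul_smul_comm, smul_mul_assoc, ← mul_assoc, sub_eq_add_neg]
      rfl
    rw [Finset.sum_congr rfl fun i _ => h' i, Finset.sum_add_distrib, ← Finset.sum_mul, ← h,
      ← Finset.mul_sum, ih, extProd_cons, List.length_cons, mul_smul_comm]
    push_cast
    rw [add_smul, one_smul, add_comm]

variable (V) in
/-- The Lie derivative of polynomial forms along the Euler vector field. -/
def eulerLie : Forms V →ₗ[ℂ] Forms V :=
  deRham V ∘ₗ eulerContraction V + eulerContraction V ∘ₗ deRham V

theorem eulerLie_tmul (f : Poly V) (η : ExteriorAlgebra ℂ (Module.Dual ℂ V)) :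
    eulerLie V (f ⊗ₜ η) = eulerPoly V f ⊗ₜ η + f ⊗ₜ[ℂ]
      ∑ i, ExteriorAlgebra.ι ℂ ((Module.finBasis ℂ V).coord i) *
        CliffordAlgebra.contractLeft (Module.Dual.eval ℂ V (Module.finBasis ℂ V i)) η := by
  set e := Module.finBasis ℂ V with he
  have hd : ∀ i j, e.coord i (e j) = if i = j then (1 : ℂ) else 0 := fun i j => by
    rw [Module.Basis.coord_apply, Module.Basis.repr_self, Finsupp.single_apply]
    simp [eq_comm]
  have hd' : ∀ i j, e.coord j (e i) = if i = j then (1 : ℂ) else 0 := fun i j => by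
    rw [Module.Basis.coord_apply, Module.Basis.repr_self, Finsupp.single_apply]
  have h1 : deRham V (eulerContraction V (f ⊗ₜ η)) = ∑ i, ∑ j,
      ((SymmetricAlgebra.ι ℂ _ (e.coord i) * polyDeriv (e j) f) ⊗ₜ[ℂ]
        (ExteriorAlgebra.ι ℂ (e.coord j) *
        CliffordAlgebra.contractLeft (Module.Dual.eval ℂ V (e i)) η) +
      (if i = j then (1 : ℂ) else 0) • f ⊗ₜ[ℂ] (ExteriorAlgebra.ι ℂ (e.coord j) *
        CliffordAlgebra.contractLeft (Module.Dual.eval ℂ V (e i)) η)) := by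
    simp only [eulerContraction_tmul, map_sum, deRham_tmul]
    refine Finset.sum_congr rfl fun i _ => Finset.sum_congr rfl fun j _ => ?_
    rw [polyDeriv_mul, polyDeriv_ι, hd, TensorProduct.add_tmul, mul_comm f, ← Algebra.smul_def,
      TensorProduct.smul_tmul']
  have h2 : eulerContraction V (deRham V (f ⊗ₜ η)) = ∑ i, ∑ j,
      ((if i = j then (1 : ℂ) else 0) •
        (SymmetricAlgebra.ι ℂ _ (e.coord i) * polyDeriv (e j) f) ⊗ₜ[ℂ] η -
      (SymmetricAlgebra.ι ℂ _ (e.coord i) * polyDeriv (e j) f) ⊗ₜ[ℂ]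
        (ExteriorAlgebra.ι ℂ (e.coord j) *
        CliffordAlgebra.contractLeft (Module.Dual.eval ℂ V (e i)) η)) := by
    simp only [deRham_tmul, map_sum, eulerContraction_tmul]
    rw [Finset.sum_comm]
    refine Finset.sum_congr rfl fun i _ => Finset.sum_congr rfl fun j _ => ?_
    have hc := CliffordAlgebra.contractLeft_ι_mul (Q := (0 : QuadraticForm ℂ (Module.Dual ℂ V)))
      (Module.Dual.eval ℂ V (e i)) (e.coord j) η
    rw [ExteriorAlgebra.ι, hc, Module.Dual.eval_apply, hd', TensorProduct.tmul_sub,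
      TensorProduct.tmul_smul]
  rw [eulerLie, LinearMap.add_apply, LinearMap.comp_apply, LinearMap.comp_apply, h1, h2,
    ← Finset.sum_add_distrib, eulerPoly_apply, TensorProduct.sum_tmul, TensorProduct.tmul_sum,
    ← Finset.sum_add_distrib]
  refine Finset.sum_congr rfl fun i _ => ?_
  rw [← Finset.sum_add_distrib, Finset.sum_eq_single i]
  · simp only [if_true, one_smul]; abel
  · intro j _ hj
    simp only [if_neg hj.symm, zero_smul]; abel
  · simp

theorem eulerLie_monomial (m l : List (Module.Dual ℂ V)) :
    eulerLie V (symProd m ⊗ₜ extProd l) =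
      ((m.length + l.length : ℕ) : ℂ) • symProd m ⊗ₜ[ℂ] extProd l := by
  rw [eulerLie_tmul, eulerPoly_symProd, sum_coord_mul_contractLeft_extProd, TensorProduct.tmul_smul,
    ← TensorProduct.smul_tmul', ← add_smul]
  push_cast
  rfl

/-- **Poincaré lemma** for polynomial forms of positive degree. -/
theorem exists_deRham_eq {k : ℕ} {ω : Forms V} (hω : ω ∈ kForms V (k + 1)) (hd : deRham V ω = 0) :
    ∃ η ∈ kForms V k, deRham V η = ω := by
  have hS : ∀ s ∈ monomialForms V (k + 1), ∃ r : ℂ, eulerLie V s = r • s := by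
    rintro _ ⟨m, l, -, rfl⟩
    exact ⟨_, eulerLie_monomial m l⟩
  obtain ⟨A, hA1, hA2, hA3⟩ := exists_inverse_on_eigenvectors (eulerLie V) (monomialForms V (k + 1))
    hS (kForms_eq_span (V := V) (k + 1) ▸ hω)
  have h0 : {s ∈ monomialForms V (k + 1) | eulerLie V s = 0} ⊆ {0} := by
    rintro _ ⟨⟨m, l, hl, rfl⟩, h⟩
    rw [eulerLie_monomial, smul_eq_zero] at h
    exact h.resolve_left (Nat.cast_ne_zero.mpr (by omega))
  have hz := Submodule.span_mono (R := ℂ) h0 hA3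
  rw [Submodule.span_zero_singleton, Submodule.mem_bot, sub_eq_zero] at hz
  have hst : ∀ x ∈ kForms V (k + 1), eulerLie V x ∈ kForms V (k + 1) := fun x hx =>
    add_mem (deRham_mem (eulerContraction_mem hx)) (eulerContraction_mem (deRham_mem hx))
  have hc : Commute (deRham V : Module.End ℂ (Forms V)) (eulerLie V) := by
    refine LinearMap.ext fun x => ?_
    simp [eulerLie, deRham_deRham]
  have hdA : deRham V (A ω) = 0 := by
    have : deRham V (A ω) = A (deRham V ω) := LinearMap.congr_fun (hA1 _ hc).eq ω
    rw [this, hd, map_zero]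
  refine ⟨eulerContraction V (A ω), eulerContraction_mem (hA2 _ hst ω hω), ?_⟩
  conv_rhs => rw [hz]
  simp [eulerLie, hdA]

/-- A polynomial with zero differential is constant. -/
theorem eq_algebraMap_of_deRham_eq_zero {f : Poly V} (hf : deRham V (f ⊗ₜ 1) = 0) :
    ∃ r : ℂ, f = algebraMap ℂ _ r := by
  have hE : eulerPoly V f = 0 := by
    have h : eulerLie V (f ⊗ₜ 1) = 0 := by
      simp [eulerLie, hf, eulerContraction_tmul]
    rw [eulerLie_tmul] at h
    simp only [CliffordAlgebra.contractLeft_one, mul_zero, Finset.sum_const_zero,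
      TensorProduct.tmul_zero, add_zero] at h
    have := congrArg (TensorProduct.rid ℂ (Poly V) ∘ LinearMap.lTensor (Poly V)
      (ExteriorAlgebra.algebraMapInv (R := ℂ) (M := Module.Dual ℂ V)).toLinearMap) h
    simpa using this
  have hS : ∀ s ∈ Set.range (symProd (V := V)), ∃ r : ℂ, eulerPoly V s = r • s := by
    rintro _ ⟨m, rfl⟩
    exact ⟨_, eulerPoly_symProd m⟩
  obtain ⟨A, hA1, -, hA3⟩ := exists_inverse_on_eigenvectors (eulerPoly V) _ hS
    (a := f) (by simp [span_symProd])
  have hEA : eulerPoly V (A f) = A (eulerPoly V f) :=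
    LinearMap.congr_fun (hA1 _ (Commute.refl _)).eq f
  rw [hEA, hE, map_zero, sub_zero] at hA3
  have h0 : Submodule.span ℂ {s ∈ Set.range (symProd (V := V)) | eulerPoly V s = 0} ≤
      Submodule.span ℂ {1} := by
    refine Submodule.span_le.mpr ?_
    rintro _ ⟨⟨m, rfl⟩, h⟩
    rw [eulerPoly_symProd, smul_eq_zero] at h
    rcases h with h | h
    · obtain rfl := List.eq_nil_of_length_eq_zero (by exact_mod_cast h)
      exact Submodule.subset_span (by simp [symProd])
    · rw [h]; exact zero_mem _
  obtain ⟨r, hr⟩ := Submodule.mem_span_singleton.mp (h0 hA3)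
  exact ⟨r, by rw [← hr, Algebra.algebraMap_eq_smul_one]⟩

end

/-! ### Normal forms of rotation-invariant functions -/

/-- The universal property of the symmetric algebra, for a map to a noncommutative algebra with
commuting values. -/
def symLift {R M A : Type*} [CommRing R] [AddCommGroup M] [Module R M] [Ring A] [Algebra R A]
    (f : M →ₗ[R] A) (hf : ∀ x y, f x * f y = f y * f x) : SymmetricAlgebra R M →ₐ[R] A :=
  RingCon.liftₐEquiv (TensorAlgebra.symRingCon R M) ⟨TensorAlgebra.lift R f, by
    refine RingCon.ringConGen_le.2 fun x y h' => ?_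
    induction h' with | mul_comm x y
    rw [RingCon.ker_apply]
    simp [hf x y]⟩

theorem symLift_ι {R M A : Type*} [CommRing R] [AddCommGroup M] [Module R M] [Ring A] [Algebra R A]
    (f : M →ₗ[R] A) (hf) (a : M) : symLift f hf (SymmetricAlgebra.ι R M a) = f a :=
  TensorAlgebra.lift_ι_apply f a

variable (V) in
/-- The coordinate `c_k = ∂_z^k c⁰(0)`. -/
def ghost (k : ℕ) : JetFun V := X (c 0 k 0)

/-- The coordinate `γ_m = ∂_z^m γ⁰(0)`, as a linear function of the covector. -/
def gammaZ (m : ℕ) : Module.Dual ℂ V →ₗ[ℂ] JetFun V where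
  toFun l := X (gamma 0 m 0 l)
  map_add' := X_compatible.gamma_add 0 m 0
  map_smul' := X_compatible.gamma_smul 0 m 0

theorem gammaZ_apply (m : ℕ) (l : Module.Dual ℂ V) : gammaZ m l = X (gamma 0 m 0 l) := rfl

theorem gammaZ_comm (m : ℕ) (l : Module.Dual ℂ V) (a : JetFun V) :
    gammaZ m l * a = a * gammaZ m l := by
  have : LinearMap.mulLeft ℂ (gammaZ m l) = LinearMap.mulRight ℂ (gammaZ m l) := by
    refine linearMap_ext_mono fun l' => ?_
    simp [gammaZ_apply, mono_mul_X, deg, koszul]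
  exact LinearMap.congr_fun this a

theorem ghost_swap (i j : ℕ) : ghost V i * ghost V j = -(ghost V j * ghost V i) := by
  rw [ghost, ghost, X_comm]; simp [deg, koszul]

theorem ghost_swap_assoc (i j : ℕ) (a : JetFun V) :
    ghost V i * (ghost V j * a) = -(ghost V j * (ghost V i * a)) := by
  rw [← mul_assoc, ghost_swap, neg_mul, mul_assoc]

theorem ghost_sq (k : ℕ) : ghost V k * ghost V k = 0 := by
  have h := ghost_swap (V := V) k k
  rw [eq_neg_iff_add_eq_zero, ← two_smul ℂ] at h
  exact (smul_eq_zero.mp h).resolve_left two_ne_zero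

theorem ghost_sq_assoc (k : ℕ) (a : JetFun V) : ghost V k * (ghost V k * a) = 0 := by
  rw [← mul_assoc, ghost_sq, zero_mul]

variable (V) in
/-- The pullback of polynomials along the value `γ⁰(0)`. -/
def polyJet : Poly V →ₐ[ℂ] JetFun V :=
  symLift (gammaZ 0) fun _ _ => gammaZ_comm _ _ _

theorem polyJet_ι (l : Module.Dual ℂ V) :
    polyJet V (SymmetricAlgebra.ι ℂ _ l) = gammaZ 0 l := symLift_ι _ _ _

theorem polyJet_comm (f : Poly V) (a : JetFun V) : polyJet V f * a = a * polyJet V f := by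
  induction f using SymmetricAlgebra.induction with
  | algebraMap r => rw [AlgHom.commutes]; exact Algebra.commutes r a
  | ι l => rw [polyJet_ι, gammaZ_comm]
  | mul f f' h h' => rw [map_mul, mul_assoc, h', ← mul_assoc, h, mul_assoc]
  | add f f' h h' => rw [map_add, add_mul, mul_add, h, h']

variable (V) in
/-- The pullback of one-forms: `f dl` becomes `f(γ_0) ⟨l, γ_1⟩`. The components of a form of degree
other than one go to zero. -/
def formJet : Forms V →ₗ[ℂ] JetFun V :=
  TensorProduct.lift ((LinearMap.mul ℂ (JetFun V)).compl₁₂ (polyJet V).toLinearMap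
    (gammaZ 1 ∘ₗ ExteriorAlgebra.ιInv))

theorem formJet_tmul (f : Poly V) (η : ExteriorAlgebra ℂ (Module.Dual ℂ V)) :
    formJet V (f ⊗ₜ η) = polyJet V f * gammaZ 1 (ExteriorAlgebra.ιInv η) := by
  simp [formJet]

theorem formJet_tmul_ι (f : Poly V) (l : Module.Dual ℂ V) :
    formJet V (f ⊗ₜ ExteriorAlgebra.ι ℂ l) = polyJet V f * gammaZ 1 l := by
  rw [formJet_tmul, ExteriorAlgebra.ι_leftInverse]

theorem sgn_polyJet (e : ℤ) (f : Poly V) : sgn e (polyJet V f) = polyJet V f := by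
  induction f using SymmetricAlgebra.induction with
  | algebraMap r => simp
  | ι l => simp [polyJet_ι, gammaZ_apply, deg, koszul]
  | mul f f' h h' => rw [map_mul, map_mul, h, h']
  | add f f' h h' => rw [map_add, map_add, h, h']

theorem polyJet_mul_formJet (f : Poly V) (α : Forms V) :
    polyJet V f * formJet V α = formJet V ((f ⊗ₜ 1 : Forms V) * α) := by
  induction α using TensorProduct.induction_on with
  | zero => simp
  | add x y hx hy => rw [map_add, mul_add, mul_add, map_add, hx, hy]
  | tmul f' η => simp [formJet_tmul, mul_assoc]

theorem tmul_one_mul_mem_kForms {k : ℕ} (f : Poly V) {α : Forms V} (hα : α ∈ kForms V k) :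
    (f ⊗ₜ 1 : Forms V) * α ∈ kForms V k := by
  obtain ⟨α, rfl⟩ := hα
  induction α using TensorProduct.induction_on with
  | zero => simp
  | add x y hx hy => rw [map_add, mul_add]; exact add_mem hx hy
  | tmul f' η => exact ⟨(f * f') ⊗ₜ η, by simp⟩

section
variable [Module.Finite ℂ V]

theorem deRham_mul_tmul_one (f f' : Poly V) : deRham V ((f * f') ⊗ₜ 1) =
    (f ⊗ₜ 1 : Forms V) * deRham V (f' ⊗ₜ 1) + (f' ⊗ₜ 1 : Forms V) * deRham V (f ⊗ₜ 1) := by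
  simp only [deRham_tmul, polyDeriv_mul, TensorProduct.add_tmul, Finset.sum_add_distrib,
    Finset.mul_sum, Algebra.TensorProduct.tmul_mul_tmul, one_mul]

theorem deRham_ι_tmul_one (l : Module.Dual ℂ V) :
    deRham V (SymmetricAlgebra.ι ℂ _ l ⊗ₜ 1) = 1 ⊗ₜ ExteriorAlgebra.ι ℂ l := by
  have h : l = ∑ i, l (Module.finBasis ℂ V i) • (Module.finBasis ℂ V).coord i :=
    ((Module.finBasis ℂ V).sum_dual_apply_smul_coord l).symm
  conv_rhs => rw [h, map_sum, TensorProduct.tmul_sum]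
  rw [deRham_tmul]
  refine Finset.sum_congr rfl fun i _ => ?_
  rw [polyDeriv_ι, Algebra.algebraMap_eq_smul_one, mul_one, map_smul, TensorProduct.smul_tmul]

theorem deRham_algebraMap_tmul_one (r : ℂ) :
    deRham V (algebraMap ℂ (Poly V) r ⊗ₜ 1) = 0 := by
  simp [deRham_tmul, polyDeriv_algebraMap]

theorem brst_ghost_mul (k : ℕ) (a : JetFun V) :
    brst V (ghost V k * a) = -(ghost V k * brst V a) + brst V (ghost V k) * a := by
  rw [brst_mul, ghost, sgn_X]; simp [deg, koszul]

theorem brst_ghost_zero : brst V (ghost V 0) = ghost V 0 * ghost V 1 := by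
  simpa [cJet, ghost, dz] using brst_cJet_zero (V := V)

theorem brst_ghost_one : brst V (ghost V 1) = ghost V 0 * ghost V 2 := by
  have h : ghost V 1 = Dz (ghost V 0) := by simp [ghost, dz]
  rw [h, brst_Dz, brst_ghost_zero, Dz_mul, ← h, ghost_sq, add_zero]
  simp [ghost, dz]

theorem brst_ghost_two : brst V (ghost V 2) = ghost V 0 * ghost V 3 + ghost V 1 * ghost V 2 := by
  have h : ghost V 2 = Dz (ghost V 1) := by simp [ghost, dz]
  rw [h, brst_Dz, brst_ghost_one, Dz_mul]
  simp [ghost, dz]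

theorem brst_gammaZ_zero (l : Module.Dual ℂ V) :
    brst V (gammaZ 0 l) = ghost V 0 * gammaZ 1 l := by
  simpa [gammaJet, cJet, gammaZ_apply, ghost, dz] using brst_gammaJet_zero l

theorem brst_gammaZ_one (l : Module.Dual ℂ V) :
    brst V (gammaZ 1 l) = ghost V 0 * gammaZ 2 l + ghost V 1 * gammaZ 1 l := by
  have h : gammaZ 1 l = Dz (gammaZ 0 l) := by simp [gammaZ_apply, dz]
  rw [h, brst_Dz, brst_gammaZ_zero, Dz_mul]
  simp [gammaZ_apply, ghost, dz]

/-- On polynomials in `γ_0`, the operator `Q` is the de Rham differential. -/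
theorem brst_polyJet (f : Poly V) :
    brst V (polyJet V f) = ghost V 0 * formJet V (deRham V (f ⊗ₜ 1)) := by
  induction f using SymmetricAlgebra.induction with
  | algebraMap r =>
    rw [AlgHom.commutes, Algebra.algebraMap_eq_smul_one, map_smul, brst_one,
      deRham_algebraMap_tmul_one]
    simp
  | ι l =>
    rw [polyJet_ι, brst_gammaZ_zero, deRham_ι_tmul_one, formJet_tmul_ι, map_one, one_mul]
  | mul f f' h h' =>
    rw [map_mul, brst_mul, sgn_polyJet, h, h', deRham_mul_tmul_one, map_add, mul_add,
      ← polyJet_mul_formJet, ← polyJet_mul_formJet, ← mul_assoc, polyJet_comm, mul_assoc,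
      polyJet_comm f', mul_assoc]
  | add f f' h h' => rw [map_add, map_add, h, h', TensorProduct.add_tmul, map_add, map_add, mul_add]

/-- Up to terms killed by `c_0`, the operator `Q` acts on one-forms as the rotation of `γ_1`. -/
theorem ghost_zero_mul_brst_formJet (α : Forms V) :
    ghost V 0 * brst V (formJet V α) = ghost V 0 * (ghost V 1 * formJet V α) := by
  induction α using TensorProduct.induction_on with
  | zero => simp
  | add x y hx hy => simp only [map_add, mul_add, hx, hy]
  | tmul f η =>
    rw [formJet_tmul, brst_mul, sgn_polyJet, brst_polyJet, brst_gammaZ_one, mul_add, mul_add,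
      mul_add, mul_assoc (ghost V 0) (formJet V _), ghost_sq_assoc, add_zero,
      ← mul_assoc (polyJet V f),
      polyJet_comm f (ghost V 0), mul_assoc (ghost V 0) (polyJet V f), ghost_sq_assoc, zero_add,
      ← mul_assoc (polyJet V f), polyJet_comm f (ghost V 1), mul_assoc (ghost V 1)]

theorem brst_ghost_one_mul_polyJet (f : Poly V) : brst V (ghost V 1 * polyJet V f) =
    ghost V 0 * (ghost V 2 * polyJet V f) +
      ghost V 0 * (ghost V 1 * formJet V (deRham V (f ⊗ₜ 1))) := by
  rw [brst_ghost_mul, brst_polyJet, brst_ghost_one, ghost_swap_assoc 1 0, neg_neg, mul_assoc,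
    add_comm]

theorem brst_ghost_zero_mul_formJet (α : Forms V) : brst V (ghost V 0 * formJet V α) = 0 := by
  rw [brst_ghost_mul, ghost_zero_mul_brst_formJet, brst_ghost_zero, mul_assoc, neg_add_cancel]

theorem brst_ghost_zero_two_mul_polyJet (f : Poly V) :
    brst V (ghost V 0 * (ghost V 2 * polyJet V f)) = 0 := by
  rw [brst_ghost_mul, brst_ghost_mul, brst_polyJet, brst_ghost_zero, brst_ghost_two,
    ghost_swap_assoc 2 0, neg_neg, mul_add, ghost_sq_assoc, zero_add, add_mul, mul_add, mul_assoc,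
    ghost_sq_assoc, zero_add, mul_assoc, mul_assoc, neg_add_cancel]

theorem brst_ghost_zero_one_mul_formJet (α : Forms V) :
    brst V (ghost V 0 * (ghost V 1 * formJet V α)) = 0 := by
  rw [← ghost_zero_mul_brst_formJet, brst_ghost_mul, brst_brst, mul_zero, neg_zero, zero_add,
    brst_ghost_zero, mul_assoc, ghost_swap_assoc, ghost_zero_mul_brst_formJet, ghost_swap_assoc 1 0,
    ghost_sq_assoc]
  simp

theorem brst_ghost_zero_one_two_mul_polyJet (f : Poly V) :
    brst V (ghost V 0 * (ghost V 1 * (ghost V 2 * polyJet V f))) = 0 := by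
  have h := brst_ghost_mul 0 (ghost V 1 * (ghost V 2 * polyJet V f))
  have h1 := brst_ghost_mul 1 (ghost V 2 * polyJet V f)
  have h2 := brst_ghost_mul 2 (polyJet V f)
  rw [h, h1, h2, brst_polyJet, brst_ghost_zero, brst_ghost_one, brst_ghost_two]
  simp only [mul_add, add_mul, mul_neg, mul_assoc, ghost_sq_assoc, ghost_swap_assoc 1 0,
    ghost_swap_assoc 2 0, neg_neg, neg_zero, mul_zero, add_zero]

end

/-! ### Classification of the invariant monomials -/

theorem mono_perm {l l' : List (JetCoord V)} (h : l.Perm l') : ∃ r : ℂ, mono l = r • mono l' := by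
  induction h with
  | nil => exact ⟨1, by simp⟩
  | cons x _ ih =>
    obtain ⟨r, hr⟩ := ih
    exact ⟨r, by rw [mono_cons, mono_cons, hr, mul_smul_comm]⟩
  | swap x y l =>
    exact ⟨koszul y.deg x.deg, by
      simp only [mono_cons, ← mul_assoc]; rw [X_comm y x, smul_mul_assoc]⟩
  | trans _ _ ih ih' =>
    obtain ⟨r, hr⟩ := ih
    obtain ⟨r', hr'⟩ := ih'
    exact ⟨r * r', by rw [hr, hr', smul_smul]⟩

theorem forall_eq_zero_of_sum_eq_zero {ι : Type*} {f : ι → ℤ} {l : List ι}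
    (h : ∀ x ∈ l, 0 ≤ f x) (hs : (l.map f).sum = 0) : ∀ x ∈ l, f x = 0 := by
  induction l with
  | nil => simp
  | cons x l ih =>
    simp only [List.mem_cons, forall_eq_or_imp, List.map_cons, List.sum_cons] at h hs ⊢
    have hl : 0 ≤ (l.map f).sum := List.sum_nonneg (by simpa using h.2)
    exact ⟨by linarith [h.1], ih h.2 (by linarith [h.1])⟩

theorem sum_weights_eq_zero {l : List (JetCoord V)} (h : (l.map rotWeight).sum = 0) :
    (l.map zWeight).sum = 0 ∧ ∀ x ∈ l, x.zbarWeight = 0 := by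
  have key : (l.map rotWeight).sum = ((l.map zWeight).sum : ℤ) +
      ((l.map zbarWeight).sum : ℕ) * Complex.I := by
    clear h
    induction l with
    | nil => simp
    | cons x l ih => simp only [List.map_cons, List.sum_cons, ih, rotWeight]; push_cast; ring
  rw [key, Complex.ext_iff] at h
  simp only [Complex.add_re, Complex.intCast_re, Complex.mul_re, Complex.natCast_re, Complex.I_re,
    Complex.add_im, Complex.intCast_im, Complex.mul_im, Complex.natCast_im, Complex.I_im,
    Complex.zero_re, Complex.zero_im, mul_zero, sub_zero, add_zero, mul_one,
    zero_add] at h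
  refine ⟨by exact_mod_cast h.1, ?_⟩
  have h2 : (l.map zbarWeight).sum = 0 := by exact_mod_cast h.2
  exact fun x hx => List.sum_eq_zero_iff.mp h2 _ (List.mem_map_of_mem hx)

/-- `a` is zero, or it has degree `p` and the shape of a rotation-invariant monomial without
`c_0`. -/
def IsWeightZero (p : ℤ) (a : JetFun V) : Prop :=
  (p = 0 ∧ ∃ f, a = polyJet V f) ∨ (p = 1 ∧ ∃ f, a = ghost V 1 * polyJet V f) ∨ a = 0

/-- `a` is zero, or it has degree `p` and the shape of a monomial without `c_0` of `z`-weight `1`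
and `z̄`-weight `0`, so that its product with `c_0` is rotation-invariant. -/
def IsWeightOne (p : ℤ) (a : JetFun V) : Prop :=
  (p = 0 ∧ ∃ α ∈ kForms V 1, a = formJet V α) ∨
  (p = 1 ∧ ∃ α ∈ kForms V 1, a = ghost V 1 * formJet V α) ∨
  (p = 1 ∧ ∃ f, a = ghost V 2 * polyJet V f) ∨
  (p = 2 ∧ ∃ f, a = ghost V 1 * (ghost V 2 * polyJet V f)) ∨ a = 0

theorem X_eq_of_zWeight_eq_zero {x : JetCoord V} (hc : x.cotWeight = 0) (hb : x.zbarWeight = 0)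
    (hz : x.zWeight = 0) :
    (x.deg = 0 ∧ ∃ l, X x = gammaZ 0 l) ∨ (x.deg = 1 ∧ X x = ghost V 1) := by
  rcases x with ⟨j, m, n, l⟩ | ⟨j, m, n, l⟩ | ⟨j, m, n⟩ | ⟨j, m, n⟩
  · fin_cases j <;> simp_all [zbarWeight, zWeight, deg]
    exact ⟨l, rfl⟩
  · simp [cotWeight] at hc
  · fin_cases j <;> simp_all [zbarWeight, zWeight, deg]
    rw [show m = 1 by omega]; rfl
  · simp [cotWeight] at hc

theorem X_eq_of_zWeight_eq_one {x : JetCoord V} (hc : x.cotWeight = 0) (hb : x.zbarWeight = 0)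
    (hz : x.zWeight = 1) :
    (x.deg = 0 ∧ ∃ l, X x = gammaZ 1 l) ∨ (x.deg = 1 ∧ X x = ghost V 2) := by
  rcases x with ⟨j, m, n, l⟩ | ⟨j, m, n, l⟩ | ⟨j, m, n⟩ | ⟨j, m, n⟩
  · fin_cases j <;> simp_all [zbarWeight, zWeight, deg]
    exact ⟨l, rfl⟩
  · simp [cotWeight] at hc
  · fin_cases j <;> simp_all [zbarWeight, zWeight, deg]
    rw [show m = 2 by omega]; rfl
  · simp [cotWeight] at hc

theorem zWeight_nonneg {x : JetCoord V} (hc : x.cotWeight = 0) (hb : x.zbarWeight = 0)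
    (h0 : x ≠ c 0 0 0) : 0 ≤ x.zWeight := by
  rcases x with ⟨j, m, n, l⟩ | ⟨j, m, n, l⟩ | ⟨j, m, n⟩ | ⟨j, m, n⟩
  · simp [zWeight]
  · simp [zWeight]
  · fin_cases j <;> simp_all [zbarWeight, zWeight]
    omega
  · simp [zWeight]

theorem isWeightZero_mono {l : List (JetCoord V)} (hc : ∀ x ∈ l, x.cotWeight = 0)
    (hb : ∀ x ∈ l, x.zbarWeight = 0) (hz : ∀ x ∈ l, x.zWeight = 0) :
    IsWeightZero (l.map deg).sum (mono l) := by
  induction l with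
  | nil => exact Or.inl ⟨rfl, 1, by simp [mono]⟩
  | cons x l ih =>
    simp only [List.mem_cons, forall_eq_or_imp] at hc hb hz
    simp only [mono_cons, List.map_cons, List.sum_cons]
    rcases X_eq_of_zWeight_eq_zero hc.1 hb.1 hz.1 with ⟨hd, l', hX⟩ | ⟨hd, hX⟩ <;>
      rcases ih hc.2 hb.2 hz.2 with ⟨hp, f, hf⟩ | ⟨hp, f, hf⟩ | h0 <;>
      simp only [*]
    · exact Or.inl ⟨by simp, SymmetricAlgebra.ι ℂ _ l' * f, by rw [map_mul, polyJet_ι]⟩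
    · refine Or.inr (Or.inl ⟨by simp, SymmetricAlgebra.ι ℂ _ l' * f, ?_⟩)
      rw [map_mul, polyJet_ι, ← mul_assoc, gammaZ_comm, mul_assoc]
    · exact Or.inr (Or.inr (by simp))
    · exact Or.inr (Or.inl ⟨by simp, f, rfl⟩)
    · exact Or.inr (Or.inr (ghost_sq_assoc _ _))
    · exact Or.inr (Or.inr (by simp))

theorem isWeightOne_mono {l : List (JetCoord V)} (hc : ∀ x ∈ l, x.cotWeight = 0)
    (hb : ∀ x ∈ l, x.zbarWeight = 0) (h0 : c 0 0 0 ∉ l) (hz : (l.map zWeight).sum = 1) :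
    IsWeightOne (l.map deg).sum (mono l) := by
  induction l with
  | nil => simp at hz
  | cons x l ih =>
    simp only [List.mem_cons, forall_eq_or_imp, not_or] at hc hb h0
    simp only [List.map_cons, List.sum_cons] at hz
    simp only [mono_cons, List.map_cons, List.sum_cons]
    have hx := zWeight_nonneg hc.1 hb.1 (Ne.symm h0.1)
    have hnn : ∀ y ∈ l, 0 ≤ y.zWeight := fun y hy =>
      zWeight_nonneg (hc.2 y hy) (hb.2 y hy) fun h => h0.2 (h ▸ hy)
    have hl : 0 ≤ (l.map zWeight).sum := List.sum_nonneg (by simpa using hnn)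
    rcases (by omega : x.zWeight = 0 ∨ x.zWeight = 1) with h | h
    · have hs : (l.map zWeight).sum = 1 := by omega
      rcases X_eq_of_zWeight_eq_zero hc.1 hb.1 h with ⟨hd, l', hX⟩ | ⟨hd, hX⟩ <;>
        rcases ih hc.2 hb.2 h0.2 hs with ⟨hp, α, hα, hf⟩ | ⟨hp, α, hα, hf⟩ | ⟨hp, f, hf⟩ |
          ⟨hp, f, hf⟩ | hf <;>
        simp only [*]
      · refine Or.inl ⟨by simp, _, tmul_one_mul_mem_kForms (SymmetricAlgebra.ι ℂ _ l') hα, ?_⟩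
        rw [← polyJet_mul_formJet, polyJet_ι]
      · refine Or.inr (Or.inl ⟨by simp, _,
          tmul_one_mul_mem_kForms (SymmetricAlgebra.ι ℂ _ l') hα, ?_⟩)
        rw [← polyJet_mul_formJet, polyJet_ι, ← mul_assoc, gammaZ_comm, mul_assoc]
      · refine Or.inr (Or.inr (Or.inl ⟨by simp, SymmetricAlgebra.ι ℂ _ l' * f, ?_⟩))
        rw [map_mul, polyJet_ι, ← mul_assoc, gammaZ_comm, mul_assoc]
      · refine Or.inr (Or.inr (Or.inr (Or.inl ⟨by simp, SymmetricAlgebra.ι ℂ _ l' * f, ?_⟩)))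
        rw [map_mul, polyJet_ι, gammaZ_comm, mul_assoc, mul_assoc, ← gammaZ_comm 0 l' (polyJet V f)]
      · exact Or.inr (Or.inr (Or.inr (Or.inr (by simp))))
      · exact Or.inr (Or.inl ⟨by simp, α, hα, rfl⟩)
      · exact Or.inr (Or.inr (Or.inr (Or.inr (ghost_sq_assoc _ _))))
      · exact Or.inr (Or.inr (Or.inr (Or.inl ⟨by simp, f, rfl⟩)))
      · exact Or.inr (Or.inr (Or.inr (Or.inr (ghost_sq_assoc _ _))))
      · exact Or.inr (Or.inr (Or.inr (Or.inr (by simp))))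
    · have hs : (l.map zWeight).sum = 0 := by omega
      have hz0 : ∀ y ∈ l, y.zWeight = 0 :=
        forall_eq_zero_of_sum_eq_zero hnn hs
      rcases X_eq_of_zWeight_eq_one hc.1 hb.1 h with ⟨hd, l', hX⟩ | ⟨hd, hX⟩ <;>
        rcases isWeightZero_mono hc.2 hb.2 hz0 with ⟨hp, f, hf⟩ | ⟨hp, f, hf⟩ | hf <;>
        simp only [*]
      · refine Or.inl ⟨by simp, f ⊗ₜ ExteriorAlgebra.ι ℂ l', tmul_mem_kForms f (by simp), ?_⟩
        rw [formJet_tmul_ι, gammaZ_comm]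
      · refine Or.inr (Or.inl ⟨by simp, f ⊗ₜ ExteriorAlgebra.ι ℂ l', tmul_mem_kForms f (by simp),
          ?_⟩)
        rw [formJet_tmul_ι, gammaZ_comm, mul_assoc]
      · exact Or.inr (Or.inr (Or.inr (Or.inr (by simp))))
      · exact Or.inr (Or.inr (Or.inl ⟨by simp, f, rfl⟩))
      · refine Or.inr (Or.inr (Or.inr (Or.inl ⟨by simp, -f, ?_⟩)))
        rw [ghost_swap_assoc, map_neg, mul_neg, mul_neg]
      · exact Or.inr (Or.inr (Or.inr (Or.inr (by simp))))

variable (V) in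
/-- The normal forms of the rotation-invariant functions of degree `p`, constants included. With `f`
a polynomial and `α` a one-form on `V`, evaluated at the value of `γ`, they are `f`,
`c_1 f + c_0 α`, `c_0 c_2 f + c_0 c_1 α` and `c_0 c_1 c_2 f` in degrees `0` to `3`. -/
def normalPart (p : ℤ) : Submodule ℂ (JetFun V) :=
  if p = 0 then LinearMap.range (polyJet V).toLinearMap
  else if p = 1 then
    (LinearMap.range (polyJet V).toLinearMap).map (LinearMap.mulLeft ℂ (ghost V 1)) ⊔
      ((kForms V 1).map (formJet V)).map (LinearMap.mulLeft ℂ (ghost V 0))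
  else if p = 2 then
    (LinearMap.range (polyJet V).toLinearMap).map (LinearMap.mulLeft ℂ (ghost V 0 * ghost V 2)) ⊔
      ((kForms V 1).map (formJet V)).map (LinearMap.mulLeft ℂ (ghost V 0 * ghost V 1))
  else if p = 3 then
    (LinearMap.range (polyJet V).toLinearMap).map
      (LinearMap.mulLeft ℂ (ghost V 0 * ghost V 1 * ghost V 2))
  else ⊥

theorem invariantPart_le_normalPart (p : ℤ) : invariantPart V p ≤ normalPart V p := by
  refine Submodule.span_le.mpr ?_
  rintro _ ⟨l, -, hc, rfl, hw, rfl⟩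
  obtain ⟨hz, hb⟩ := sum_weights_eq_zero hw
  rw [SetLike.mem_coe]
  by_cases h0 : c 0 0 0 ∈ l
  · obtain ⟨s, t, rfl⟩ := List.append_of_mem h0
    have hp : (s ++ c 0 0 0 :: t).Perm (c 0 0 0 :: (s ++ t)) := List.perm_middle
    obtain ⟨r, hr⟩ := mono_perm hp
    rw [hr, (hp.map deg).sum_eq]
    refine Submodule.smul_mem _ _ ?_
    rw [(hp.map zWeight).sum_eq] at hz
    replace hc : ∀ x ∈ s ++ t, x.cotWeight = 0 := fun x hx => hc x (hp.mem_iff.mpr (by simp [hx]))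
    replace hb : ∀ x ∈ s ++ t, x.zbarWeight = 0 := fun x hx => hb x (hp.mem_iff.mpr (by simp [hx]))
    generalize s ++ t = l at hz hb hc
    rw [mono_cons, List.map_cons, List.sum_cons, show (c 0 0 0 : JetCoord V).deg = 1 by simp [deg]]
    change ghost V 0 * mono l ∈ _
    by_cases h1 : c 0 0 0 ∈ l
    · obtain ⟨s, t, rfl⟩ := List.append_of_mem h1
      obtain ⟨r, hr⟩ := mono_perm
        (List.perm_middle : (s ++ c 0 0 0 :: t).Perm (c 0 0 0 :: (s ++ t)))
      have : ghost V 0 * mono (s ++ c 0 0 0 :: t) = 0 := by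
        rw [hr, mono_cons, mul_smul_comm]
        change r • (ghost V 0 * (ghost V 0 * _)) = 0
        rw [ghost_sq_assoc, smul_zero]
      rw [this]; exact zero_mem _
    · have hz1 : (l.map zWeight).sum = 1 := by simp [zWeight] at hz; linarith
      rcases isWeightOne_mono hc hb h1 hz1 with ⟨hp, α, hα, hf⟩ | ⟨hp, α, hα, hf⟩ | ⟨hp, f, hf⟩ |
        ⟨hp, f, hf⟩ | hf <;> rw [hf]
      · rw [hp]
        exact Submodule.mem_sup_right ⟨_, ⟨α, hα, rfl⟩, rfl⟩
      · rw [hp]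
        exact Submodule.mem_sup_right ⟨_, ⟨α, hα, rfl⟩, mul_assoc _ _ _⟩
      · rw [hp]
        exact Submodule.mem_sup_left ⟨_, ⟨f, rfl⟩, mul_assoc _ _ _⟩
      · rw [hp]
        exact ⟨_, ⟨f, rfl⟩, by simp [mul_assoc]⟩
      · simp
  · have hnn : ∀ y ∈ l, 0 ≤ y.zWeight := fun y hy =>
      zWeight_nonneg (hc y hy) (hb y hy) fun h => h0 (h ▸ hy)
    have hz0 : ∀ y ∈ l, y.zWeight = 0 :=
      forall_eq_zero_of_sum_eq_zero hnn hz
    rcases isWeightZero_mono hc hb hz0 with ⟨hp, f, hf⟩ | ⟨hp, f, hf⟩ | hf <;> rw [hf]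
    · rw [hp]
      exact ⟨f, rfl⟩
    · rw [hp]
      exact Submodule.mem_sup_left ⟨_, ⟨f, rfl⟩, rfl⟩
    · exact zero_mem _

/-! ### The coefficients of a normal form -/

/-- The value on coordinates of the restriction of functions to constant maps `γ`. -/
def constGen : JetCoord V → Poly V
  | gamma 0 0 0 l => SymmetricAlgebra.ι ℂ _ l
  | _ => 0

variable (V) in
/-- The restriction of functions on jets to the jets of constant maps `γ : ℂ → V`, with all other
fields zero. -/
def constEval : JetFun V →ₐ[ℂ] Poly V :=
  liftHom constGen
    ⟨fun j m n l l' => by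
      fin_cases j <;> rcases m with _ | m <;> rcases n with _ | n <;> simp [constGen],
     fun j m n a l => by
      fin_cases j <;> rcases m with _ | m <;> rcases n with _ | n <;> simp [constGen],
     by simp [constGen], by simp [constGen]⟩ (by
    intro x y
    rw [mul_comm (constGen y)]
    by_cases hx : x.deg = 0
    · simp [hx, koszul]
    · have : constGen x = 0 := by
        unfold constGen
        split
        · simp [deg] at hx
        · rfl
      simp [this])

theorem constEval_X (x : JetCoord V) : constEval V (X x) = constGen x := liftHom_X ..

theorem constEval_polyJet (f : Poly V) : constEval V (polyJet V f) = f := by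
  have : (constEval V).comp (polyJet V) = AlgHom.id ℂ _ := by
    apply SymmetricAlgebra.algHom_ext
    ext l
    simp [polyJet_ι, gammaZ_apply, constEval_X, constGen]
  exact DFunLike.congr_fun this f

theorem dc_ghost_mul (k j : ℕ) (a : JetFun V) :
    dc V k (ghost V j * a) = -(ghost V j * dc V k a) + (if j = k then a else 0) := by
  rw [ghost, (isSuperDer_dc k).X_mul, dc_X]
  rcases eq_or_ne j k with h | h <;> simp [deg, koszul, dcGen, h]

theorem dc_polyJet (k : ℕ) (f : Poly V) : dc V k (polyJet V f) = 0 := by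
  induction f using SymmetricAlgebra.induction with
  | algebraMap r => simp [Algebra.algebraMap_eq_smul_one, (isSuperDer_dc (V := V) k).map_one]
  | ι l => simp [polyJet_ι, gammaZ_apply, dc_X, dcGen]
  | mul f f' h h' => rw [map_mul, isSuperDer_dc, h, h', mul_zero, zero_mul, add_zero]
  | add f f' h h' => rw [map_add, map_add, h, h', add_zero]

theorem dc_formJet (k : ℕ) (α : Forms V) : dc V k (formJet V α) = 0 := by
  induction α using TensorProduct.induction_on with
  | zero => simp
  | add x y hx hy => rw [map_add, map_add, hx, hy, add_zero]
  | tmul f η =>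
    rw [formJet_tmul, isSuperDer_dc, dc_polyJet, gammaZ_apply, dc_X]
    simp [dcGen]

theorem dg_polyJet (v : V) (f : Poly V) : dg v (polyJet V f) = 0 := by
  induction f using SymmetricAlgebra.induction with
  | algebraMap r => simp [Algebra.algebraMap_eq_smul_one, (isSuperDer_dg v).map_one]
  | ι l => simp [polyJet_ι, gammaZ_apply, dg_X, dgGen]
  | mul f f' h h' => rw [map_mul, isSuperDer_dg, h, h', mul_zero, zero_mul, add_zero]
  | add f f' h h' => rw [map_add, map_add, h, h', add_zero]

variable (V) in
/-- The coefficient `f` of a cocycle `c_0 c_1 c_2 f`. -/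
def topCoeff : JetFun V →ₗ[ℂ] Poly V :=
  (constEval V).toLinearMap ∘ₗ dc V 2 ∘ₗ dc V 1 ∘ₗ dc V 0

theorem topCoeff_normal (f : Poly V) :
    topCoeff V (ghost V 0 * (ghost V 1 * (ghost V 2 * polyJet V f))) = f := by
  simp [topCoeff, dc_ghost_mul, dc_polyJet, constEval_polyJet]

theorem dc_mem_gradedPart (k : ℕ) {r : ℂ} {a : JetFun V} (ha : a ∈ gradedPart rotWeight r) :
    dc V k a ∈ gradedPart rotWeight (r + (1 - k)) := by
  refine (isSuperDer_dc k).mem_gradedPart (fun x => ?_) ha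
  rw [dc_X]
  unfold dcGen
  split
  · split_ifs with h
    · refine Submodule.smul_mem _ _ (mem_gradedPart_of_eq (one_mem_gradedPart _) ?_)
      simp [rotWeight, zWeight, zbarWeight, h]
    · simp
  · exact zero_mem _

theorem dg_mem_gradedPart (v : V) {r : ℂ} {a : JetFun V} (ha : a ∈ gradedPart rotWeight r) :
    dg v a ∈ gradedPart rotWeight (r + (-1)) := by
  refine (isSuperDer_dg v).mem_gradedPart (fun x => ?_) ha
  rw [dg_X]
  unfold dgGen
  split
  · refine Submodule.smul_mem _ _ (mem_gradedPart_of_eq (one_mem_gradedPart _) ?_)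
    simp [rotWeight, zWeight, zbarWeight]
  · exact zero_mem _

theorem constEval_eq_zero_of_mem_gradedPart {r : ℂ} {a : JetFun V} (hr : r ≠ 0)
    (ha : a ∈ gradedPart rotWeight r) : constEval V a = 0 := by
  have : gradedPart rotWeight r ≤ LinearMap.ker (constEval V).toLinearMap := by
    refine Submodule.span_le.mpr ?_
    rintro _ ⟨l, rfl, rfl⟩
    by_contra h
    refine hr (List.sum_eq_zero ?_)
    simp only [List.mem_map, forall_exists_index, and_imp]
    rintro _ x hx rfl
    by_contra hw
    refine h ?_
    have h0 : constGen x = 0 := by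
      unfold constGen
      split
      · simp [rotWeight, zWeight, zbarWeight] at hw
      · rfl
    rw [SetLike.mem_coe, LinearMap.mem_ker, AlgHom.toLinearMap_apply, mono, map_list_prod]
    exact List.prod_eq_zero (by
      simp only [List.map_map, List.mem_map]
      exact ⟨x, hx, by simp [constEval_X, h0]⟩)
  exact this ha

theorem topCoeff_eq_zero_of_mem_gradedPart (r : ℂ) (hr : r ≠ 0) (a : JetFun V)
    (ha : a ∈ gradedPart rotWeight r) : topCoeff V a = 0 := by
  exact constEval_eq_zero_of_mem_gradedPart (by push_cast; ring_nf; exact hr)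
    (dc_mem_gradedPart 2 (dc_mem_gradedPart 1 (dc_mem_gradedPart 0 ha)))

theorem mem_normalPart_zero {a : JetFun V} (ha : a ∈ normalPart V 0) : ∃ f, a = polyJet V f := by
  obtain ⟨f, rfl⟩ := ha
  exact ⟨f, rfl⟩

theorem mem_normalPart_one {a : JetFun V} (ha : a ∈ normalPart V 1) :
    ∃ f, ∃ α ∈ kForms V 1, a = ghost V 1 * polyJet V f + ghost V 0 * formJet V α := by
  obtain ⟨_, ⟨_, ⟨f, rfl⟩, rfl⟩, _, ⟨_, ⟨α, hα, rfl⟩, rfl⟩, rfl⟩ := Submodule.mem_sup.mp ha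
  exact ⟨f, α, hα, rfl⟩

theorem mem_normalPart_two {a : JetFun V} (ha : a ∈ normalPart V 2) :
    ∃ f, ∃ α ∈ kForms V 1, a = ghost V 0 * (ghost V 2 * polyJet V f) +
      ghost V 0 * (ghost V 1 * formJet V α) := by
  obtain ⟨_, ⟨_, ⟨f, rfl⟩, rfl⟩, _, ⟨_, ⟨α, hα, rfl⟩, rfl⟩, rfl⟩ := Submodule.mem_sup.mp ha
  exact ⟨f, α, hα, congrArg₂ _ (mul_assoc _ _ _) (mul_assoc _ _ _)⟩

theorem mem_normalPart_three {a : JetFun V} (ha : a ∈ normalPart V 3) :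
    ∃ f, a = ghost V 0 * (ghost V 1 * (ghost V 2 * polyJet V f)) := by
  obtain ⟨_, ⟨f, rfl⟩, rfl⟩ := ha
  exact ⟨f, by simp [mul_assoc]⟩

section
variable [Module.Finite ℂ V]

variable (V) in
/-- The part of a function that is linear in `γ_1 = ∂_z γ⁰(0)` and otherwise depends only on
`γ_0 = γ⁰(0)`, as a one-form on `V`. -/
def formCoeff : JetFun V →ₗ[ℂ] Forms V :=
  ∑ i, (TensorProduct.mk ℂ (Poly V) (ExteriorAlgebra ℂ (Module.Dual ℂ V))).flip
      (ExteriorAlgebra.ι ℂ ((Module.finBasis ℂ V).coord i)) ∘ₗ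
    (constEval V).toLinearMap ∘ₗ dg (Module.finBasis ℂ V i)

theorem formCoeff_apply (a : JetFun V) : formCoeff V a =
    ∑ i, constEval V (dg (Module.finBasis ℂ V i) a) ⊗ₜ[ℂ]
      ExteriorAlgebra.ι ℂ ((Module.finBasis ℂ V).coord i) := by
  simp [formCoeff, LinearMap.sum_apply]

theorem formCoeff_mem (a : JetFun V) : formCoeff V a ∈ kForms V 1 := by
  rw [formCoeff_apply]
  exact sum_mem fun i _ => tmul_mem_kForms _ (by simp)

theorem formCoeff_formJet {α : Forms V} (hα : α ∈ kForms V 1) :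
    formCoeff V (formJet V α) = α := by
  rw [kForms_eq_span] at hα
  induction hα using Submodule.span_induction with
  | mem _ h =>
    obtain ⟨m, l, hl, rfl⟩ := h
    obtain ⟨a, rfl⟩ := List.length_eq_one_iff.mp hl
    have h : ExteriorAlgebra.ι ℂ a = ∑ i, a (Module.finBasis ℂ V i) •
        ExteriorAlgebra.ι ℂ ((Module.finBasis ℂ V).coord i) := map_eq_sum_coord _ a
    rw [show extProd [a] = ExteriorAlgebra.ι ℂ a by simp [extProd], formJet_tmul_ι,
      formCoeff_apply, h, TensorProduct.tmul_sum]
    refine Finset.sum_congr rfl fun i _ => ?_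
    rw [isSuperDer_dg, dg_polyJet, zero_mul, add_zero, gammaZ_apply, dg_X, sgn_polyJet,
      TensorProduct.tmul_smul]
    simp [dgGen, constEval_polyJet, TensorProduct.smul_tmul']
  | zero => simp
  | add _ _ _ _ h h' => rw [map_add, map_add, h, h']
  | smul r _ _ h => rw [map_smul, map_smul, h]

variable (V) in
/-- The differential of a polynomial. -/
def polyD : Poly V →ₗ[ℂ] Forms V :=
  deRham V ∘ₗ (TensorProduct.mk ℂ (Poly V) (ExteriorAlgebra ℂ (Module.Dual ℂ V))).flip 1

theorem polyD_apply (f : Poly V) : polyD V f = deRham V (f ⊗ₜ 1) := rfl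

theorem polyD_mem (f : Poly V) : polyD V f ∈ kForms V 1 := deRham_mem (one_mem_kForms_zero f)

theorem deRham_polyD (f : Poly V) : deRham V (polyD V f) = 0 := deRham_deRham _

variable (V) in
/-- The class of a cocycle `c_1 f + c_0 α`, which is `dα`. -/
def classOne : JetFun V →ₗ[ℂ] Forms V := deRham V ∘ₗ formCoeff V ∘ₗ dc V 0

variable (V) in
/-- The class of a cocycle `c_0 c_2 f + c_0 c_1 α`, which is `α - df`. -/
def classTwo : JetFun V →ₗ[ℂ] Forms V :=
  formCoeff V ∘ₗ dc V 1 ∘ₗ dc V 0 - polyD V ∘ₗ (constEval V).toLinearMap ∘ₗ dc V 2 ∘ₗ dc V 0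

theorem classOne_mem (a : JetFun V) : classOne V a ∈ closedForms V 2 :=
  ⟨deRham_mem (formCoeff_mem _), by simp [classOne, deRham_deRham]⟩

theorem classTwo_mem (a : JetFun V) : classTwo V a ∈ kForms V 1 :=
  sub_mem (formCoeff_mem _) (polyD_mem _)

theorem polyD_mem_closedForms (f : Poly V) : polyD V f ∈ closedForms V 1 :=
  ⟨polyD_mem f, deRham_polyD f⟩

theorem classOne_normal (f : Poly V) {α : Forms V} (hα : α ∈ kForms V 1) :
    classOne V (ghost V 1 * polyJet V f + ghost V 0 * formJet V α) = deRham V α := by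
  simp [classOne, dc_ghost_mul, dc_polyJet, dc_formJet, formCoeff_formJet hα]

theorem classTwo_normal (f : Poly V) {α : Forms V} (hα : α ∈ kForms V 1) :
    classTwo V (ghost V 0 * (ghost V 2 * polyJet V f) + ghost V 0 * (ghost V 1 * formJet V α)) =
      α - polyD V f := by
  simp [classTwo, dc_ghost_mul, dc_polyJet, dc_formJet, formCoeff_formJet hα, constEval_polyJet]

/-! ### Vanishing of the classes in nonzero weight -/

theorem formCoeff_eq_zero_of_mem_gradedPart {r : ℂ} {a : JetFun V} (hr : r ≠ 1)
    (ha : a ∈ gradedPart rotWeight r) : formCoeff V a = 0 := by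
  rw [formCoeff_apply]
  refine Finset.sum_eq_zero fun i _ => ?_
  rw [constEval_eq_zero_of_mem_gradedPart (by rw [← sub_eq_add_neg]; exact sub_ne_zero.mpr hr)
    (dg_mem_gradedPart _ ha), TensorProduct.zero_tmul]

/-- A linear map that vanishes on all functions of nonzero weight vanishes on the image of
the rotations. -/
theorem map_rot_eq_zero {M : Type*} [AddCommGroup M] [Module ℂ M] (F : JetFun V →ₗ[ℂ] M)
    (hF : ∀ r : ℂ, r ≠ 0 → ∀ a ∈ gradedPart rotWeight r, F a = 0) {p : ℤ} {a : JetFun V}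
    (ha : a ∈ reducedPart V p 0) : F (rot V a) = 0 := by
  induction ha using Submodule.span_induction with
  | mem _ h =>
    obtain ⟨l, -, -, hw, rfl⟩ := h
    rw [rot_mono l (cotWeight_sum_eq_zero hw), map_smul]
    by_cases hr : (l.map rotWeight).sum = 0
    · rw [hr, zero_smul]
    · rw [hF _ hr _ (mono_mem_gradedPart _ l), smul_zero]
  | zero => simp
  | add _ _ _ _ h h' => rw [map_add, map_add, h, h', add_zero]
  | smul r _ _ h => rw [map_smul, map_smul, h, smul_zero]

theorem classOne_eq_zero_of_mem_gradedPart (r : ℂ) (hr : r ≠ 0) (a : JetFun V)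
    (ha : a ∈ gradedPart rotWeight r) : classOne V a = 0 := by
  have := formCoeff_eq_zero_of_mem_gradedPart (by simpa using hr) (dc_mem_gradedPart 0 ha)
  simp [classOne, this]

theorem classTwo_eq_zero_of_mem_gradedPart (r : ℂ) (hr : r ≠ 0) (a : JetFun V)
    (ha : a ∈ gradedPart rotWeight r) : classTwo V a = 0 := by
  have h1 := formCoeff_eq_zero_of_mem_gradedPart (by simpa using hr)
    (dc_mem_gradedPart 1 (dc_mem_gradedPart 0 ha))
  have h2 := constEval_eq_zero_of_mem_gradedPart (by push_cast; ring_nf; exact hr)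
    (dc_mem_gradedPart 2 (dc_mem_gradedPart 0 ha))
  simp [classTwo, h1, h2]

/-! ### The cohomology -/

/-- A linear map that vanishes on functions of nonzero weight and on the differentials of normal
forms is zero on coboundaries. -/
theorem map_brst_eq_zero {M : Type*} [AddCommGroup M] [Module ℂ M] (F : JetFun V →ₗ[ℂ] M)
    (hF : ∀ r : ℂ, r ≠ 0 → ∀ a ∈ gradedPart rotWeight r, F a = 0) {p : ℤ}
    (hN : ∀ a ∈ normalPart V p, F (brst V a) = 0) {a : JetFun V} (ha : a ∈ reducedPart V p 0) :
    F (brst V a) = 0 := by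
  obtain ⟨b, hb, h, -⟩ := exists_invariant_add_rot ha
  have h1 := hN _ (invariantPart_le_normalPart p h)
  rwa [map_sub, map_sub, brst_rot, map_rot_eq_zero F hF (brst_mem hb), sub_zero] at h1

theorem classOne_brst {a : JetFun V} (ha : a ∈ reducedPart V 0 0) : classOne V (brst V a) = 0 := by
  refine map_brst_eq_zero _ classOne_eq_zero_of_mem_gradedPart (fun a ha => ?_) ha
  obtain ⟨f, rfl⟩ := mem_normalPart_zero ha
  have := classOne_normal 0 (polyD_mem f)
  rw [map_zero, mul_zero, zero_add, deRham_polyD] at this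
  rw [brst_polyJet]
  exact this

theorem classTwo_brst {a : JetFun V} (ha : a ∈ reducedPart V 1 0) : classTwo V (brst V a) = 0 := by
  refine map_brst_eq_zero _ classTwo_eq_zero_of_mem_gradedPart (fun a ha => ?_) ha
  obtain ⟨f, α, -, rfl⟩ := mem_normalPart_one ha
  have := classTwo_normal f (polyD_mem f)
  rw [map_add, brst_ghost_zero_mul_formJet, add_zero, brst_ghost_one_mul_polyJet]
  rwa [sub_self] at this

theorem topCoeff_brst {a : JetFun V} (ha : a ∈ reducedPart V 2 0) : topCoeff V (brst V a) = 0 := by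
  refine map_brst_eq_zero _ topCoeff_eq_zero_of_mem_gradedPart (fun a ha => ?_) ha
  obtain ⟨f, α, -, rfl⟩ := mem_normalPart_two ha
  rw [map_add, brst_ghost_zero_two_mul_polyJet, brst_ghost_zero_one_mul_formJet, add_zero, map_zero]

/-- Every cocycle is cohomologous to a normal form. -/
theorem exists_normal_add_brst {p : ℤ} {a : JetFun V} (ha : a ∈ reducedPart V p 0)
    (h : brst V a = 0) :
    ∃ w ∈ normalPart V p, w ∈ reducedPart V p 0 ∧ ∃ b ∈ reducedPart V (p - 1) 0,
      brst V w = 0 ∧ a = w + brst V b := by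
  obtain ⟨b, hb, hw⟩ := exists_invariant_add_brst ha h
  refine ⟨_, invariantPart_le_normalPart p hw, ?_, b, hb, ?_, (sub_add_cancel _ _).symm⟩
  · exact sub_mem ha (mem_reducedPart_of_eq (brst_mem hb) (by ring) rfl)
  · rw [map_sub, h, brst_brst, sub_zero]

end

variable (V) in
/-- The value of functions on jets at the zero jet. -/
def zeroEval : JetFun V →ₐ[ℂ] ℂ := SymmetricAlgebra.algebraMapInv.comp (constEval V)

theorem zeroEval_eq_zero {p : ℤ} {w : ℕ} {a : JetFun V} (ha : a ∈ reducedPart V p w) :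
    zeroEval V a = 0 := by
  have : reducedPart V p w ≤ LinearMap.ker (zeroEval V).toLinearMap := by
    refine Submodule.span_le.mpr ?_
    rintro _ ⟨l, hl, -, -, rfl⟩
    obtain ⟨x, l, rfl⟩ := List.exists_cons_of_ne_nil hl
    have hx : zeroEval V (X x) = 0 := by
      simp only [zeroEval, AlgHom.comp_apply, constEval_X]
      unfold constGen
      split
      · exact SymmetricAlgebra.algebraMapInv_ι _
      · exact map_zero _
    rw [SetLike.mem_coe, LinearMap.mem_ker, AlgHom.toLinearMap_apply, mono_cons, map_mul, hx,
      zero_mul]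
  exact this ha

theorem zeroEval_polyJet (f : Poly V) :
    zeroEval V (polyJet V f) = SymmetricAlgebra.algebraMapInv f := by
  simp [zeroEval, constEval_polyJet]

theorem gammaZ_mem (m : ℕ) (l : Module.Dual ℂ V) : gammaZ m l ∈ homogeneousPart V 0 :=
  X_mem_gradedPart (fun x : JetCoord V => (x.deg, x.cotWeight)) (gamma 0 m 0 l)

theorem ghost_mul_mem (k : ℕ) {p q : ℤ} (h : p + 1 = q) {a : JetFun V}
    (ha : a ∈ homogeneousPart V p) : ghost V k * a ∈ homogeneousPart V q := by
  have := mul_mem_gradedPart (X_mem_gradedPart _ (c 0 k 0)) ha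
  exact mem_gradedPart_of_eq this (by simp [deg, cotWeight, ← h, add_comm])

theorem polyJet_mem (f : Poly V) : polyJet V f ∈ homogeneousPart V 0 := by
  induction f using SymmetricAlgebra.induction with
  | algebraMap r =>
    rw [AlgHom.commutes, Algebra.algebraMap_eq_smul_one]
    exact Submodule.smul_mem _ _ (one_mem_gradedPart _)
  | ι l => rw [polyJet_ι]; exact gammaZ_mem 0 l
  | mul f f' h h' =>
    rw [map_mul]
    exact mem_gradedPart_of_eq (mul_mem_gradedPart h h') (by simp)
  | add f f' h h' => rw [map_add]; exact add_mem h h'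

theorem formJet_mem (α : Forms V) : formJet V α ∈ homogeneousPart V 0 := by
  induction α using TensorProduct.induction_on with
  | zero => simp
  | add x y hx hy => rw [map_add]; exact add_mem hx hy
  | tmul f η =>
    rw [formJet_tmul]
    exact mem_gradedPart_of_eq (mul_mem_gradedPart (polyJet_mem f) (gammaZ_mem 1 _)) (by simp)

theorem polyJet_mem_reducedPart {f : Poly V} (hf : SymmetricAlgebra.algebraMapInv f = (0 : ℂ)) :
    polyJet V f ∈ reducedPart V 0 0 := by
  obtain ⟨u, hu, v, hv, huv⟩ := Submodule.mem_sup.mp (homogeneousPart_le 0 (polyJet_mem f))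
  obtain ⟨r, rfl⟩ := Submodule.mem_span_singleton.mp hv
  have h := congrArg (zeroEval V) huv
  rw [zeroEval_polyJet, hf, map_add, zeroEval_eq_zero hu, map_smul, map_one, zero_add, smul_eq_mul,
    mul_one] at h
  rw [← huv, h, zero_smul, add_zero]
  exact hu

section
variable [Module.Finite ℂ V]

/-- A closed one-form is the differential of a polynomial without constant term. -/
theorem exists_polyD_eq {α : Forms V} (hα : α ∈ kForms V 1) (hd : deRham V α = 0) (r : ℂ) :
    ∃ f : Poly V, SymmetricAlgebra.algebraMapInv f = r ∧ polyD V f = α := by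
  obtain ⟨η, hη, h⟩ := exists_deRham_eq hα hd
  obtain ⟨f, rfl⟩ := exists_eq_tmul_one hη
  refine ⟨f + algebraMap ℂ _ (r - SymmetricAlgebra.algebraMapInv f), ?_, ?_⟩
  · rw [map_add, SymmetricAlgebra.algebraMap_leftInverse]; ring
  · rw [map_add, polyD_apply, polyD_apply, h, deRham_algebraMap_tmul_one, add_zero]

theorem eq_zero_of_polyD_eq_zero {f : Poly V} (hf : SymmetricAlgebra.algebraMapInv f = (0 : ℂ))
    (hd : polyD V f = 0) : f = 0 := by
  obtain ⟨r, rfl⟩ := eq_algebraMap_of_deRham_eq_zero hd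
  rw [SymmetricAlgebra.algebraMap_leftInverse] at hf
  rw [hf, map_zero]

/-- In degree `0` exactness holds because the functions are reduced: a constant is closed. -/
theorem exact_of_degree_ne {p : ℤ} (h1 : p ≠ 1) (h2 : p ≠ 2) (h3 : p ≠ 3) {a : JetFun V}
    (ha : a ∈ reducedPart V p 0) (h : brst V a = 0) :
    ∃ b ∈ reducedPart V (p - 1) 0, brst V b = a := by
  obtain ⟨w, hw, hwr, b, hb, hd, rfl⟩ := exists_normal_add_brst ha h
  refine ⟨b, hb, ?_⟩
  suffices w = 0 by rw [this, zero_add]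
  by_cases h0 : p = 0
  · subst h0
    obtain ⟨f, rfl⟩ := mem_normalPart_zero hw
    have hf : polyD V f = 0 := by
      have := congrArg (formCoeff V ∘ dc V 0) hd
      simpa [brst_polyJet, dc_ghost_mul, dc_formJet, ← polyD_apply,
        formCoeff_formJet (polyD_mem f)] using this
    rw [eq_zero_of_polyD_eq_zero (by rw [← zeroEval_polyJet, zeroEval_eq_zero hwr]) hf, map_zero]
  · simpa [normalPart, h0, h1, h2, h3] using hw

theorem exact_of_classOne_eq_zero {a : JetFun V} (ha : a ∈ reducedPart V 1 0) (h : brst V a = 0)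
    (hc : classOne V a = 0) : ∃ b ∈ reducedPart V 0 0, brst V b = a := by
  obtain ⟨w, hw, hwr, b, hb, hd, rfl⟩ := exists_normal_add_brst ha h
  rw [sub_self] at hb
  rw [map_add, classOne_brst hb, add_zero] at hc
  obtain ⟨f, α, hα, rfl⟩ := mem_normalPart_one hw
  rw [classOne_normal f hα] at hc
  have hf : f = 0 := by
    have := congrArg (constEval V ∘ dc V 2 ∘ dc V 0) hd
    simpa [brst_ghost_zero_mul_formJet, brst_ghost_one_mul_polyJet, dc_ghost_mul, dc_polyJet,
      dc_formJet, constEval_polyJet] using this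
  obtain ⟨f', hf', rfl⟩ := exists_polyD_eq hα hc 0
  refine ⟨polyJet V f' + b, add_mem (polyJet_mem_reducedPart hf') hb, ?_⟩
  rw [hf, map_add, brst_polyJet, map_zero, mul_zero, zero_add, polyD_apply]

theorem exact_of_classTwo_eq_zero {a : JetFun V} (ha : a ∈ reducedPart V 2 0) (h : brst V a = 0)
    (hc : classTwo V a = 0) : ∃ b ∈ reducedPart V 1 0, brst V b = a := by
  obtain ⟨w, hw, hwr, b, hb, hd, rfl⟩ := exists_normal_add_brst ha h
  norm_num at hb
  rw [map_add, classTwo_brst hb, add_zero] at hc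
  obtain ⟨f, α, hα, rfl⟩ := mem_normalPart_two hw
  rw [classTwo_normal f hα, sub_eq_zero] at hc
  refine ⟨ghost V 1 * polyJet V f + b, add_mem ?_ hb, ?_⟩
  · exact homogeneousPart_le_reducedPart one_ne_zero
      (ghost_mul_mem 1 (zero_add 1) (polyJet_mem f))
  · rw [map_add, brst_ghost_one_mul_polyJet, hc, polyD_apply]

theorem exact_of_topCoeff_eq_zero {a : JetFun V} (ha : a ∈ reducedPart V 3 0) (h : brst V a = 0)
    (hc : topCoeff V a = 0) : ∃ b ∈ reducedPart V 2 0, brst V b = a := by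
  obtain ⟨w, hw, hwr, b, hb, hd, rfl⟩ := exists_normal_add_brst ha h
  norm_num at hb
  rw [map_add, topCoeff_brst hb, add_zero] at hc
  obtain ⟨f, rfl⟩ := mem_normalPart_three hw
  rw [topCoeff_normal] at hc
  exact ⟨b, hb, by rw [hc]; simp⟩

theorem exists_classOne_eq {ω : Forms V} (hω : ω ∈ closedForms V 2) :
    ∃ a ∈ reducedPart V 1 0, brst V a = 0 ∧ classOne V a = ω := by
  obtain ⟨α, hα, rfl⟩ := exists_deRham_eq hω.1 hω.2
  refine ⟨ghost V 0 * formJet V α, homogeneousPart_le_reducedPart one_ne_zero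
    (ghost_mul_mem 0 (zero_add 1) (formJet_mem α)), brst_ghost_zero_mul_formJet α, ?_⟩
  simpa using classOne_normal 0 hα

theorem exists_classTwo_eq {α : Forms V} (hα : α ∈ kForms V 1) :
    ∃ a ∈ reducedPart V 2 0, brst V a = 0 ∧ classTwo V a = α := by
  refine ⟨ghost V 0 * (ghost V 1 * formJet V α), homogeneousPart_le_reducedPart two_ne_zero
    (ghost_mul_mem 0 one_add_one_eq_two (ghost_mul_mem 1 (zero_add 1) (formJet_mem α))),
    brst_ghost_zero_one_mul_formJet α, ?_⟩
  simpa using classTwo_normal 0 hα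

theorem exists_topCoeff_eq (f : Poly V) :
    ∃ a ∈ reducedPart V 3 0, brst V a = 0 ∧ topCoeff V a = f :=
  ⟨_, homogeneousPart_le_reducedPart three_ne_zero
    (ghost_mul_mem 0 two_add_one_eq_three (ghost_mul_mem 1 one_add_one_eq_two
      (ghost_mul_mem 2 (zero_add 1) (polyJet_mem f)))),
    brst_ghost_zero_one_two_mul_polyJet f, topCoeff_normal f⟩

end

/-! ### Equivariance -/

/-- An intertwining relation between superderivations may be checked on coordinates. -/
theorem jetAct_superDer {e : ℤ} {D D' : JetFun V →ₗ[ℂ] JetFun V} (hD : IsSuperDer e D)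
    (hD' : IsSuperDer e D') (g : V ≃ₗ[ℂ] V)
    (h : ∀ x, jetAct g (D (X x)) = D' (X (x.act g))) (a : JetFun V) :
    jetAct g (D a) = D' (jetAct g a) := by
  have : (jetAct g).toLinearMap ∘ₗ D = D' ∘ₗ (jetAct g).toLinearMap := by
    refine linearMap_ext_mono fun l => ?_
    simp only [LinearMap.comp_apply, AlgHom.toLinearMap_apply]
    induction l with
    | nil => simp [mono, hD.map_one, hD'.map_one]
    | cons x l ih =>
      rw [mono_cons, hD.X_mul, map_mul, jetAct_X, hD'.X_mul, map_add, map_smul, map_mul, map_mul,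
        ih, jetAct_X, h, deg_act]
  exact LinearMap.congr_fun this a

theorem jetAct_dc (g : V ≃ₗ[ℂ] V) (k : ℕ) (a : JetFun V) :
    jetAct g (dc V k a) = dc V k (jetAct g a) := by
  refine jetAct_superDer (isSuperDer_dc k) (isSuperDer_dc k) g (fun x => ?_) a
  rw [dc_X, dc_X]
  rcases x with ⟨j, m, n, l⟩ | ⟨j, m, n, l⟩ | ⟨j, m, n⟩ | ⟨j, m, n⟩ <;> fin_cases j <;>
    rcases n with _ | n <;> simp [dcGen, JetCoord.act]

theorem jetAct_dg (g : V ≃ₗ[ℂ] V) (v : V) (a : JetFun V) :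
    jetAct g (dg v a) = dg (g v) (jetAct g a) := by
  refine jetAct_superDer (isSuperDer_dg v) (isSuperDer_dg _) g (fun x => ?_) a
  rw [dg_X, dg_X]
  rcases x with ⟨j, m, n, l⟩ | ⟨j, m, n, l⟩ | ⟨j, m, n⟩ | ⟨j, m, n⟩
  · fin_cases j <;> rcases m with _ | _ | m <;> rcases n with _ | n <;>
      simp [dgGen, JetCoord.act, dualAct]
  all_goals simp [dgGen, JetCoord.act]

theorem constEval_jetAct (g : V ≃ₗ[ℂ] V) (a : JetFun V) :
    constEval V (jetAct g a) = polyAct g (constEval V a) := by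
  have : ((constEval V).comp (jetAct g)).toLinearMap =
      ((polyAct g).comp (constEval V)).toLinearMap := by
    refine linearMap_ext_mono fun l => ?_
    induction l with
    | nil => simp [mono]
    | cons x l ih =>
      have hx : constGen (x.act g) = polyAct g (constGen x) := by
        rcases x with ⟨j, m, n, l⟩ | ⟨j, m, n, l⟩ | ⟨j, m, n⟩ | ⟨j, m, n⟩
        · fin_cases j <;> rcases m with _ | m <;> rcases n with _ | n <;>
            simp [constGen, JetCoord.act, polyAct]
        all_goals simp [constGen, JetCoord.act]
      simp only [AlgHom.toLinearMap_apply, AlgHom.comp_apply, mono_cons, map_mul] at ih ⊢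
      rw [ih, jetAct_X, constEval_X, constEval_X, hx]
  exact LinearMap.congr_fun this a

theorem algebraMapInv_polyAct (g : V ≃ₗ[ℂ] V) (f : Poly V) :
    SymmetricAlgebra.algebraMapInv (polyAct g f) = (SymmetricAlgebra.algebraMapInv f : ℂ) := by
  have : SymmetricAlgebra.algebraMapInv.comp (polyAct g) =
      (SymmetricAlgebra.algebraMapInv : Poly V →ₐ[ℂ] ℂ) := by
    apply SymmetricAlgebra.algHom_ext
    ext l
    simp [polyAct, SymmetricAlgebra.algebraMapInv_ι]
  exact DFunLike.congr_fun this f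

theorem dg_add (v w : V) (a : JetFun V) : dg (v + w) a = dg v a + dg w a := by
  have : dg (v + w) = dg v + dg w := by
    refine linearMap_ext_mono fun l => eq_on_mono_of_leibniz (P := fun _ => True)
      (isSuperDer_dg _).map_one ((isSuperDer_dg v).add (isSuperDer_dg w)).map_one
      (isSuperDer_dg _).X_mul ((isSuperDer_dg v).add (isSuperDer_dg w)).X_mul (fun x _ => ?_) l
      (by simp)
    simp only [LinearMap.add_apply, dg_X]
    unfold dgGen
    split <;> simp [add_smul]
  exact LinearMap.congr_fun this a

theorem dg_smul (r : ℂ) (v : V) (a : JetFun V) : dg (r • v) a = r • dg v a := by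
  have : dg (r • v) = r • dg v := by
    refine linearMap_ext_mono fun l => eq_on_mono_of_leibniz (P := fun _ => True)
      (isSuperDer_dg _).map_one ((isSuperDer_dg v).smul r).map_one
      (isSuperDer_dg _).X_mul ((isSuperDer_dg v).smul r).X_mul (fun x _ => ?_) l
      (by simp)
    simp only [LinearMap.smul_apply, dg_X]
    unfold dgGen
    split <;> simp [mul_smul]
  exact LinearMap.congr_fun this a

theorem topCoeff_jetAct (g : V ≃ₗ[ℂ] V) (a : JetFun V) :
    topCoeff V (jetAct g a) = polyAct g (topCoeff V a) := by
  simp [topCoeff, ← jetAct_dc, constEval_jetAct]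

section
variable [Module.Finite ℂ V]

theorem formCoeff_jetAct (g : V ≃ₗ[ℂ] V) (a : JetFun V) :
    formCoeff V (jetAct g a) = formsAct g (formCoeff V a) := by
  let B : V →ₗ[ℂ] Module.Dual ℂ V →ₗ[ℂ] Forms V :=
    LinearMap.mk₂ ℂ (fun v l => constEval V (dg v (jetAct g a)) ⊗ₜ[ℂ] ExteriorAlgebra.ι ℂ l)
      (fun v v' l => by rw [dg_add, map_add, TensorProduct.add_tmul])
      (fun r v l => by rw [dg_smul, map_smul, TensorProduct.smul_tmul'])
      (fun v l l' => by rw [map_add, TensorProduct.tmul_add])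
      (fun r v l => by rw [map_smul, TensorProduct.tmul_smul])
  have h1 : formsAct g (formCoeff V a) = ∑ i, B (g (Module.finBasis ℂ V i))
      (dualAct g ((Module.finBasis ℂ V).coord i)) := by
    simp [formCoeff_apply, formsAct, B, ← jetAct_dg, constEval_jetAct]
  have h2 : formCoeff V (jetAct g a) = ∑ i, B (Module.finBasis ℂ V i)
      ((Module.finBasis ℂ V).coord i) := by
    simp [formCoeff_apply, B]
  rw [h1, h2, sum_basis_act]

theorem polyD_polyAct (g : V ≃ₗ[ℂ] V) (f : Poly V) :
    polyD V (polyAct g f) = formsAct g (polyD V f) := by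
  rw [polyD_apply, polyD_apply, formsAct_deRham]
  simp [formsAct]

theorem classOne_jetAct (g : V ≃ₗ[ℂ] V) (a : JetFun V) :
    classOne V (jetAct g a) = formsAct g (classOne V a) := by
  simp [classOne, ← jetAct_dc, formCoeff_jetAct, formsAct_deRham]

theorem classTwo_jetAct (g : V ≃ₗ[ℂ] V) (a : JetFun V) :
    classTwo V (jetAct g a) = formsAct g (classTwo V a) := by
  simp [classTwo, ← jetAct_dc, formCoeff_jetAct, constEval_jetAct, polyD_polyAct]

end

/-! ### The quasi-isomorphism -/

open Limits

/-- A map to a complex with zero differential is a quasi-isomorphism if every element is the image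
of a cocycle and every cocycle in the kernel is a coboundary. -/
theorem quasiIso_of_zero_differential {C D : CochainComplex (ModuleCat.{u} ℂ) ℤ} (f : C ⟶ D)
    (hD : ∀ i j, D.d i j = 0)
    (hsurj : ∀ i (y : D.X i), ∃ x : C.X i, C.d i (i + 1) x = 0 ∧ f.f i x = y)
    (hinj : ∀ i (x : C.X i), C.d i (i + 1) x = 0 → f.f i x = 0 → ∃ z, C.d (i - 1) i z = x) :
    QuasiIso f := by
  refine ⟨fun i => ?_⟩
  rw [quasiIsoAt_iff' f (i - 1) i (i + 1) (by simp) (by simp)]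
  have hg : (D.sc' (i - 1) i (i + 1)).g = 0 := hD _ _
  have hf : (D.sc' (i - 1) i (i + 1)).f = 0 := hD _ _
  let h : ShortComplex.LeftHomologyMapData
      ((HomologicalComplex.shortComplexFunctor' _ _ (i - 1) i (i + 1)).map f)
      (ShortComplex.moduleCatLeftHomologyData _)
      (ShortComplex.LeftHomologyData.ofZeros _ hf hg) := default
  rw [h.quasiIso_iff, ConcreteCategory.isIso_iff_bijective]
  have key : ∀ x : LinearMap.ker (C.d i (i + 1)).hom,
      h.φH ((C.sc' (i - 1) i (i + 1)).moduleCatLeftHomologyData.π x) = f.f i x.1 := by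
    intro x
    have h1 := ConcreteCategory.congr_hom h.commπ x
    have h2 := ConcreteCategory.congr_hom h.commi x
    exact h1.trans h2
  constructor
  · rw [injective_iff_map_eq_zero]
    intro y hy
    obtain ⟨x, rfl⟩ := Submodule.Quotient.mk_surjective _ y
    obtain ⟨z, hz⟩ := hinj i x.1 x.2 ((key x).symm.trans hy)
    exact (Submodule.Quotient.mk_eq_zero _).mpr ⟨z, Subtype.ext hz⟩
  · intro y
    obtain ⟨x, hx, hxy⟩ := hsurj i y
    exact ⟨_, (key ⟨x, hx⟩).trans hxy⟩

section
variable [Module.Finite ℂ V]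

/-- The function on jets underlying an element of the deformation complex. -/
def jetFun (w : ℕ) (i : ℤ) : (defComplex V w).X i →ₗ[ℂ] JetFun V :=
  (reducedPart V (i + 2) w).subtype

theorem jetFun_injective (w : ℕ) (i : ℤ) : Function.Injective (jetFun (V := V) w i) :=
  Subtype.val_injective

theorem jetFun_mem {w : ℕ} {i : ℤ} (x : (defComplex V w).X i) :
    jetFun w i x ∈ reducedPart V (i + 2) w := x.2

theorem exists_jetFun_eq {w : ℕ} {i : ℤ} {p : ℤ} (hp : i + 2 = p) {a : JetFun V}
    (ha : a ∈ reducedPart V p w) : ∃ x, jetFun w i x = a := by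
  subst hp
  exact ⟨⟨a, ha⟩, rfl⟩

/-- The shift by `2` introduces no sign, so the differential of the deformation complex is `Q`. -/
theorem jetFun_d (w : ℕ) {i j : ℤ} (h : i + 1 = j) (x : (defComplex V w).X i) :
    jetFun w j ((defComplex V w).d i j x) = brst V (jetFun w i x) := by
  have hd : ((jetComplex V w)⟦(2 : ℤ)⟧).d i j = (jetComplex V w).d (i + 2) (j + 2) := by
    rw [CochainComplex.shiftFunctor_obj_d', Int.negOnePow_even 2 even_two, one_smul]
  obtain ⟨p, hp⟩ : ∃ p, p = i + 2 := ⟨_, rfl⟩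
  obtain ⟨q, hq⟩ : ∃ q, q = j + 2 := ⟨_, rfl⟩
  have hpq : p + 1 = q := by omega
  have key : ∀ y : (jetComplex V w).X p,
      (show reducedPart V q w from (jetComplex V w).d p q y).1
        = brst V (show reducedPart V p w from y).1 := by
    subst hpq
    intro y
    rw [jetComplex_d]
    rfl
  subst hp hq
  exact (congrArg _ (ConcreteCategory.congr_hom hd x)).trans (key x)

/-- The map from the deformation complex to a space in one degree, given by a linear map on
functions of that degree that vanishes on coboundaries. -/
def toInDegree (q : ℤ) {M : Type u} [AddCommGroup M] [Module ℂ M]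
    (φ : reducedPart V (q + 2) 0 →ₗ[ℂ] M)
    (hφ : ∀ a ∈ reducedPart V (q + 1) 0, ∀ h, φ ⟨brst V a, h⟩ = 0) :
    defComplex V 0 ⟶ (inDegree q).obj (ModuleCat.of ℂ M) :=
  HomologicalComplex.mkHomToSingle (ModuleCat.ofHom φ) (fun i hi => by
    ext x
    have h := jetFun_d 0 hi x
    have hx := jetFun_mem x
    rw [show i + 2 = q + 1 by simp only [ComplexShape.up_Rel] at hi; omega] at hx
    have h' := jetFun_mem ((defComplex V 0).d i q x)
    rw [h] at h'
    have e : (⟨jetFun 0 q ((defComplex V 0).d i q x), jetFun_mem _⟩ : reducedPart V (q + 2) 0) =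
        ⟨brst V (jetFun 0 i x), h'⟩ := Subtype.ext h
    exact (congrArg φ e).trans (hφ _ hx h'))

/-- The identification of a space with the only nonzero term of its complex. -/
abbrev inDegreeSelf (q : ℤ) (M : ModuleCat.{u} ℂ) : ((inDegree q).obj M).X q ≅ M :=
  HomologicalComplex.singleObjXSelf (ComplexShape.up ℤ) q M

theorem mkHomToSingle_apply {K : CochainComplex (ModuleCat.{u} ℂ) ℤ} {q : ℤ} {M : ModuleCat.{u} ℂ}
    (φ : K.X q ⟶ M) (hφ : ∀ i, (ComplexShape.up ℤ).Rel i q → K.d i q ≫ φ = 0) (x : K.X q) :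
    (inDegreeSelf q M).hom ((HomologicalComplex.mkHomToSingle φ hφ).f q x) = φ x := by
  rw [HomologicalComplex.mkHomToSingle_f, ← ConcreteCategory.comp_apply, Category.assoc,
    Iso.inv_hom_id, Category.comp_id]

theorem toInDegree_apply (q : ℤ) {M : Type u} [AddCommGroup M] [Module ℂ M]
    (φ : reducedPart V (q + 2) 0 →ₗ[ℂ] M)
    (hφ : ∀ a ∈ reducedPart V (q + 1) 0, ∀ h, φ ⟨brst V a, h⟩ = 0)
    (x : (defComplex V 0).X q) :
    (inDegreeSelf q (ModuleCat.of ℂ M)).hom ((toInDegree q φ hφ).f q x) =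
      φ ⟨jetFun 0 q x, jetFun_mem x⟩ :=
  mkHomToSingle_apply (K := defComplex V 0) _ _ x

theorem inDegree_eq_of_ne {q i : ℤ} (h : i ≠ q) (M : ModuleCat.{u} ℂ)
    (y y' : ((inDegree q).obj M).X i) : y = y' := by
  have := ModuleCat.subsingleton_of_isZero
    (HomologicalComplex.isZero_single_obj_X (ComplexShape.up ℤ) q M i h)
  exact Subsingleton.elim _ _

theorem inDegree_eq {q : ℤ} (M : ModuleCat.{u} ℂ) {y y' : ((inDegree q).obj M).X q}
    (h : (inDegreeSelf q M).hom y = (inDegreeSelf q M).hom y') : y = y' :=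
  ((ConcreteCategory.isIso_iff_bijective (inDegreeSelf q M).hom).mp inferInstance).1 h

theorem biprod_d {K L : CochainComplex (ModuleCat.{u} ℂ) ℤ} {i j : ℤ} (hK : K.d i j = 0)
    (hL : L.d i j = 0) : (K ⊞ L).d i j = 0 := by
  refine HomologicalComplex.biprodX_ext_from ?_ ?_ <;>
    rw [HomologicalComplex.Hom.comm, comp_zero]
  · rw [hK, zero_comp]
  · rw [hL, zero_comp]

theorem biprod_eq {K L : CochainComplex (ModuleCat.{u} ℂ) ℤ} {i : ℤ} {y y' : (K ⊞ L).X i}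
    (h1 : (biprod.fst : K ⊞ L ⟶ K).f i y = (biprod.fst : K ⊞ L ⟶ K).f i y')
    (h2 : (biprod.snd : K ⊞ L ⟶ L).f i y = (biprod.snd : K ⊞ L ⟶ L).f i y') : y = y' := by
  have h (y : (K ⊞ L).X i) : (biprod.inl : K ⟶ K ⊞ L).f i ((biprod.fst : K ⊞ L ⟶ K).f i y) +
      (biprod.inr : L ⟶ K ⊞ L).f i ((biprod.snd : K ⊞ L ⟶ L).f i y) = y :=
    ConcreteCategory.congr_hom (HomologicalComplex.biprod_total_f K L i) y
  rw [← h y, ← h y', h1, h2]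

/-- Equivariance of a map to a space in one degree. -/
theorem act_toInDegree (q : ℤ) {M : Type u} [AddCommGroup M] [Module ℂ M]
    (φ : reducedPart V (q + 2) 0 →ₗ[ℂ] M)
    (hφ : ∀ a ∈ reducedPart V (q + 1) 0, ∀ h, φ ⟨brst V a, h⟩ = 0) (g : V ≃ₗ[ℂ] V)
    (T : M →ₗ[ℂ] M) (hT : ∀ a, φ ⟨jetAct g a.1, jetAct_mem g a.2⟩ = T (φ a)) :
    defComplexAct 0 g ≫ toInDegree q φ hφ =
      toInDegree q φ hφ ≫ (inDegree q).map (ModuleCat.ofHom T) := by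
  refine HomologicalComplex.to_single_hom_ext ?_
  ext x
  apply inDegree_eq
  rw [HomologicalComplex.comp_f, HomologicalComplex.comp_f, ConcreteCategory.comp_apply,
    ConcreteCategory.comp_apply, toInDegree_apply, HomologicalComplex.single_map_f_self,
    ← ConcreteCategory.comp_apply, Category.assoc, Category.assoc, Iso.inv_hom_id, Category.comp_id,
    ConcreteCategory.comp_apply, toInDegree_apply]
  exact hT ⟨jetFun 0 q x, jetFun_mem x⟩

variable (V)

/-- The component `Ω²_cl(V)[1]` of the quasi-isomorphism. -/
def mapClassOne : defComplex V 0 ⟶ (inDegree (-1)).obj (ModuleCat.of ℂ (closedForms V 2)) :=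
  toInDegree (-1) (((classOne V).codRestrict _ classOne_mem).domRestrict _)
    (fun _ ha _ => Subtype.ext (classOne_brst ha))

/-- The component `Ω¹(V)` of the quasi-isomorphism. -/
def mapClassTwo : defComplex V 0 ⟶ (inDegree 0).obj (ModuleCat.of ℂ (kForms V 1)) :=
  toInDegree 0 (((classTwo V).codRestrict _ classTwo_mem).domRestrict _)
    (fun _ ha _ => Subtype.ext (classTwo_brst ha))

/-- The component `Ω¹_cl(V)[-1]` of the quasi-isomorphism. -/
def mapTopD : defComplex V 0 ⟶ (inDegree 1).obj (ModuleCat.of ℂ (closedForms V 1)) :=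
  toInDegree 1 (((polyD V).codRestrict _ polyD_mem_closedForms ∘ₗ topCoeff V).domRestrict _)
    (fun a ha _ => by
      simp only [LinearMap.domRestrict_apply, LinearMap.comp_apply]
      rw [topCoeff_brst ha, map_zero])

/-- The component `ℂ[-1]` of the quasi-isomorphism. -/
def mapTopConst : defComplex V 0 ⟶ (inDegree 1).obj (ModuleCat.of ℂ (ULift.{u} ℂ)) :=
  toInDegree 1 ((ULift.moduleEquiv.symm.toLinearMap ∘ₗ
      (SymmetricAlgebra.algebraMapInv : Poly V →ₐ[ℂ] ℂ).toLinearMap ∘ₗ topCoeff V).domRestrict _)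
    (fun a ha _ => by
      simp only [LinearMap.domRestrict_apply, LinearMap.comp_apply]
      rw [topCoeff_brst ha, map_zero, map_zero])

/-- The quasi-isomorphism from the deformation complex to the target, by its four components. -/
def cohomologyMap : defComplex V 0 ⟶ targetComplex V :=
  biprod.lift (mapTopConst V)
    (biprod.lift (mapClassOne V) (biprod.lift (mapClassTwo V) (mapTopD V)))

variable {V}

theorem targetComplex_d (i j : ℤ) : (targetComplex V).d i j = 0 :=
  biprod_d (HomologicalComplex.single_obj_d ..) (biprod_d (HomologicalComplex.single_obj_d ..)
    (biprod_d (HomologicalComplex.single_obj_d ..) (HomologicalComplex.single_obj_d ..)))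

variable (V) in
/-- The projection of the target complex to `ℂ[-1]`. -/
def projTopConst : targetComplex V ⟶ (inDegree 1).obj (ModuleCat.of ℂ (ULift.{u} ℂ)) := biprod.fst

variable (V) in
/-- The projection of the target complex to `Ω²_cl(V)[1]`. -/
def projClassOne : targetComplex V ⟶ (inDegree (-1)).obj (ModuleCat.of ℂ (closedForms V 2)) :=
  biprod.snd (C := CochainComplex (ModuleCat.{u} ℂ) ℤ) ≫ biprod.fst

variable (V) in
/-- The projection of the target complex to `Ω¹(V)`. -/
def projClassTwo : targetComplex V ⟶ (inDegree 0).obj (ModuleCat.of ℂ (kForms V 1)) :=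
  biprod.snd (C := CochainComplex (ModuleCat.{u} ℂ) ℤ) ≫ biprod.snd ≫ biprod.fst

variable (V) in
/-- The projection of the target complex to `Ω¹_cl(V)[-1]`. -/
def projTopD : targetComplex V ⟶ (inDegree 1).obj (ModuleCat.of ℂ (closedForms V 1)) :=
  biprod.snd (C := CochainComplex (ModuleCat.{u} ℂ) ℤ) ≫ biprod.snd ≫ biprod.snd

theorem cohomologyMap_projTopConst : cohomologyMap V ≫ projTopConst V = mapTopConst V :=
  biprod.lift_fst ..

theorem cohomologyMap_projClassOne : cohomologyMap V ≫ projClassOne V = mapClassOne V :=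
  (biprod.lift_snd_assoc ..).trans (biprod.lift_fst ..)

theorem cohomologyMap_projClassTwo : cohomologyMap V ≫ projClassTwo V = mapClassTwo V :=
  (biprod.lift_snd_assoc ..).trans ((biprod.lift_snd_assoc ..).trans (biprod.lift_fst ..))

theorem cohomologyMap_projTopD : cohomologyMap V ≫ projTopD V = mapTopD V :=
  (biprod.lift_snd_assoc ..).trans ((biprod.lift_snd_assoc ..).trans (biprod.lift_snd ..))

/-- An element maps to `y` as soon as its four components do. -/
theorem cohomologyMap_eq {i : ℤ} (x : (defComplex V 0).X i) (y : (targetComplex V).X i)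
    (h1 : (mapTopConst V).f i x = (projTopConst V).f i y)
    (h2 : (mapClassOne V).f i x = (projClassOne V).f i y)
    (h3 : (mapClassTwo V).f i x = (projClassTwo V).f i y)
    (h4 : (mapTopD V).f i x = (projTopD V).f i y) :
    (cohomologyMap V).f i x = y := by
  rw [← cohomologyMap_projTopConst] at h1
  rw [← cohomologyMap_projClassOne] at h2
  rw [← cohomologyMap_projClassTwo] at h3
  rw [← cohomologyMap_projTopD] at h4
  exact biprod_eq h1 (biprod_eq h2 (biprod_eq h3 h4))

theorem component_eq_zero {K L M : CochainComplex (ModuleCat.{u} ℂ) ℤ} {f : K ⟶ L} {p : L ⟶ M}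
    {f' : K ⟶ M} (h : f ≫ p = f') {i : ℤ} {x : K.X i} (hx : f.f i x = 0) : f'.f i x = 0 := by
  rw [← h, HomologicalComplex.comp_f, ConcreteCategory.comp_apply, hx, map_zero]

theorem mapClassOne_apply (x : (defComplex V 0).X (-1)) :
    (inDegreeSelf (-1) (ModuleCat.of ℂ (closedForms V 2))).hom ((mapClassOne V).f (-1) x) =
      (⟨classOne V (jetFun 0 (-1) x), classOne_mem _⟩ : closedForms V 2) :=
  toInDegree_apply ..

theorem mapClassTwo_apply (x : (defComplex V 0).X 0) :
    (inDegreeSelf 0 (ModuleCat.of ℂ (kForms V 1))).hom ((mapClassTwo V).f 0 x) =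
      (⟨classTwo V (jetFun 0 0 x), classTwo_mem _⟩ : kForms V 1) :=
  toInDegree_apply ..

theorem mapTopD_apply (x : (defComplex V 0).X 1) :
    (inDegreeSelf 1 (ModuleCat.of ℂ (closedForms V 1))).hom ((mapTopD V).f 1 x) =
      (⟨polyD V (topCoeff V (jetFun 0 1 x)), polyD_mem_closedForms _⟩ : closedForms V 1) :=
  toInDegree_apply ..

theorem mapTopConst_apply (x : (defComplex V 0).X 1) :
    (inDegreeSelf 1 (ModuleCat.of ℂ (ULift.{u} ℂ))).hom ((mapTopConst V).f 1 x) =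
      ULift.up.{u} (SymmetricAlgebra.algebraMapInv (topCoeff V (jetFun 0 1 x)) : ℂ) :=
  toInDegree_apply ..

/-- Every element of the target is the image of a cocycle. -/
theorem cohomologyMap_surjective (i : ℤ) (y : (targetComplex V).X i) :
    ∃ x, (defComplex V 0).d i (i + 1) x = 0 ∧ (cohomologyMap V).f i x = y := by
  have cocycle {i : ℤ} {x : (defComplex V 0).X i} (h : brst V (jetFun 0 i x) = 0) :
      (defComplex V 0).d i (i + 1) x = 0 :=
    jetFun_injective 0 _ (by rw [jetFun_d 0 rfl, h, map_zero])
  by_cases h1 : i = -1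
  · subst h1
    obtain ⟨ω, hω⟩ : ∃ ω : closedForms V 2,
        (inDegreeSelf (-1) (ModuleCat.of ℂ (closedForms V 2))).hom
          ((projClassOne V).f (-1) y) = ω :=
      ⟨_, rfl⟩
    obtain ⟨a, ha, hb, hc⟩ := exists_classOne_eq ω.2
    obtain ⟨x, rfl⟩ := exists_jetFun_eq (show (-1 : ℤ) + 2 = _ by norm_num) ha
    refine ⟨x, cocycle hb, cohomologyMap_eq x y ?_ ?_ ?_ ?_⟩
    · exact inDegree_eq_of_ne (by decide) _ _ _
    · exact inDegree_eq _ ((mapClassOne_apply x).trans ((Subtype.ext hc).trans hω.symm))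
    · exact inDegree_eq_of_ne (by decide) _ _ _
    · exact inDegree_eq_of_ne (by decide) _ _ _
  by_cases h2 : i = 0
  · subst h2
    obtain ⟨α, hα⟩ : ∃ α : kForms V 1,
        (inDegreeSelf 0 (ModuleCat.of ℂ (kForms V 1))).hom ((projClassTwo V).f 0 y) = α :=
      ⟨_, rfl⟩
    obtain ⟨a, ha, hb, hc⟩ := exists_classTwo_eq α.2
    obtain ⟨x, rfl⟩ := exists_jetFun_eq (show (0 : ℤ) + 2 = _ by norm_num) ha
    refine ⟨x, cocycle hb, cohomologyMap_eq x y ?_ ?_ ?_ ?_⟩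
    · exact inDegree_eq_of_ne (by decide) _ _ _
    · exact inDegree_eq_of_ne (by decide) _ _ _
    · exact inDegree_eq _ ((mapClassTwo_apply x).trans ((Subtype.ext hc).trans hα.symm))
    · exact inDegree_eq_of_ne (by decide) _ _ _
  by_cases h3 : i = 1
  · subst h3
    obtain ⟨α, hα⟩ : ∃ α : closedForms V 1,
        (inDegreeSelf 1 (ModuleCat.of ℂ (closedForms V 1))).hom ((projTopD V).f 1 y) = α :=
      ⟨_, rfl⟩
    obtain ⟨r, hr⟩ : ∃ r : ULift.{u} ℂ,
        (inDegreeSelf 1 (ModuleCat.of ℂ (ULift.{u} ℂ))).hom ((projTopConst V).f 1 y) = r :=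
      ⟨_, rfl⟩
    obtain ⟨f, hf, hd⟩ := exists_polyD_eq α.2.1 α.2.2 r.down
    obtain ⟨a, ha, hb, rfl⟩ := exists_topCoeff_eq f
    obtain ⟨x, rfl⟩ := exists_jetFun_eq (show (1 : ℤ) + 2 = _ by norm_num) ha
    refine ⟨x, cocycle hb, cohomologyMap_eq x y ?_ ?_ ?_ ?_⟩
    · exact inDegree_eq _ ((mapTopConst_apply x).trans ((congrArg ULift.up hf).trans hr.symm))
    · exact inDegree_eq_of_ne (by decide) _ _ _
    · exact inDegree_eq_of_ne (by decide) _ _ _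
    · exact inDegree_eq _ ((mapTopD_apply x).trans ((Subtype.ext hd).trans hα.symm))
  · refine ⟨0, map_zero _, cohomologyMap_eq 0 y ?_ ?_ ?_ ?_⟩
    · exact inDegree_eq_of_ne h3 _ _ _
    · exact inDegree_eq_of_ne h1 _ _ _
    · exact inDegree_eq_of_ne h2 _ _ _
    · exact inDegree_eq_of_ne h3 _ _ _

/-- The cocycles that map to zero are coboundaries. -/
theorem cohomologyMap_injective (i : ℤ) (x : (defComplex V 0).X i)
    (hx : (defComplex V 0).d i (i + 1) x = 0) (h : (cohomologyMap V).f i x = 0) :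
    ∃ z, (defComplex V 0).d (i - 1) i z = x := by
  have hd : brst V (jetFun 0 i x) = 0 := by rw [← jetFun_d 0 rfl, hx, map_zero]
  suffices ∃ b ∈ reducedPart V (i - 1 + 2) 0, brst V b = jetFun 0 i x by
    obtain ⟨b, hb, hbx⟩ := this
    obtain ⟨z, rfl⟩ := exists_jetFun_eq rfl hb
    exact ⟨z, jetFun_injective 0 _ (by rw [jetFun_d 0 (sub_add_cancel i 1), hbx])⟩
  have c1 := component_eq_zero cohomologyMap_projTopConst h
  have c2 := component_eq_zero cohomologyMap_projClassOne h
  have c3 := component_eq_zero cohomologyMap_projClassTwo h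
  have c4 := component_eq_zero cohomologyMap_projTopD h
  have ha := jetFun_mem x
  by_cases h1 : i = -1
  · subst h1
    have := (mapClassOne_apply x).symm.trans (by rw [c2, map_zero])
    exact exact_of_classOne_eq_zero ha hd (congrArg Subtype.val this)
  by_cases h2 : i = 0
  · subst h2
    have := (mapClassTwo_apply x).symm.trans (by rw [c3, map_zero])
    exact exact_of_classTwo_eq_zero ha hd (congrArg Subtype.val this)
  by_cases h3 : i = 1
  · subst h3
    have e1 := (mapTopConst_apply x).symm.trans (by rw [c1, map_zero])
    have e2 := (mapTopD_apply x).symm.trans (by rw [c4, map_zero])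
    exact exact_of_topCoeff_eq_zero ha hd
      (eq_zero_of_polyD_eq_zero (congrArg ULift.down e1) (congrArg Subtype.val e2))
  · rw [show i - 1 + 2 = i + 2 - 1 by ring]
    exact exact_of_degree_ne (by omega) (by omega) (by omega) ha hd

theorem comp_biprod_lift {K L M : CochainComplex (ModuleCat.{u} ℂ) ℤ} {a : K ⟶ K} {f : K ⟶ L}
    {h : K ⟶ M} {S : L ⟶ L} {T : M ⟶ M} (hf : a ≫ f = f ≫ S) (hh : a ≫ h = h ≫ T) :
    a ≫ biprod.lift f h = biprod.lift f h ≫ biprod.map S T := by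
  refine biprod.hom_ext _ _ ?_ ?_ <;> simp [hf, hh]

theorem cohomologyMap_equivariant (g : V ≃ₗ[ℂ] V) :
    defComplexAct 0 g ≫ cohomologyMap V = cohomologyMap V ≫ targetAct g := by
  have e1 : defComplexAct 0 g ≫ mapTopConst V = mapTopConst V ≫ 𝟙 _ := by
    refine (act_toInDegree _ _ _ g LinearMap.id fun a => ?_).trans ?_
    · simp only [LinearMap.domRestrict_apply, LinearMap.comp_apply, topCoeff_jetAct]
      exact congrArg ULift.up (algebraMapInv_polyAct g _)
    · rw [ModuleCat.ofHom_id, CategoryTheory.Functor.map_id]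
      rfl
  have e2 : defComplexAct 0 g ≫ mapClassOne V = mapClassOne V ≫ (inDegree (-1)).map
      (ModuleCat.ofHom ((formsAct g).restrict (fun _ h => formsAct_closedForms g 2 h))) :=
    act_toInDegree _ _ _ g _ fun a => Subtype.ext (classOne_jetAct g a.1)
  have e3 : defComplexAct 0 g ≫ mapClassTwo V = mapClassTwo V ≫ (inDegree 0).map
      (ModuleCat.ofHom ((formsAct g).restrict (fun _ h => formsAct_kForms g 1 h))) :=
    act_toInDegree _ _ _ g _ fun a => Subtype.ext (classTwo_jetAct g a.1)
  have e4 : defComplexAct 0 g ≫ mapTopD V = mapTopD V ≫ (inDegree 1).map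
      (ModuleCat.ofHom ((formsAct g).restrict (fun _ h => formsAct_closedForms g 1 h))) :=
    act_toInDegree _ _ _ g _ fun a => Subtype.ext (by
      simp only [LinearMap.domRestrict_apply, LinearMap.comp_apply, topCoeff_jetAct]
      exact polyD_polyAct g _)
  exact comp_biprod_lift e1 (comp_biprod_lift e2 (comp_biprod_lift e3 e4))

end

end HolomorphicString

end

theorem mainTheorem8 (V : Type*) [AddCommGroup V] [Module ℂ V] [Module.Finite ℂ V] :
    ∃ f : HolomorphicString.defComplex V 0 ⟶ HolomorphicString.targetComplex V,
      QuasiIso f ∧ ∀ g : V ≃ₗ[ℂ] V,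
        HolomorphicString.defComplexAct 0 g ≫ f = f ≫ HolomorphicString.targetAct g :=
  ⟨HolomorphicString.cohomologyMap V,
    HolomorphicString.quasiIso_of_zero_differential _ HolomorphicString.targetComplex_d
      HolomorphicString.cohomologyMap_surjective HolomorphicString.cohomologyMap_injective,
    HolomorphicString.cohomologyMap_equivariant⟩
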